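/- **Setting.** Let $p\in\mathbb{N}$, let $h^*$ be a real polynomial in $p$ variables, and let $K_\sigma,K_\xi,K_\rho>0$. For $d\in\mathbb{N}$, a $p$-dimensional subspace $V\subset\mathbb{R}^d$ and an orthonormal basis of $V$, regard $h^*$ as a polynomial map $V\to\mathbb{R}$ in the coordinates of this basis, and put $f^*(x)=h^*(x_V)$, where $x_V$ is the orthogonal projection of $x\in\mathbb{R}^d$ onto $V$. Write $\mathbb{E}_x$ for the expectation over $x\sim\mathcal{N}(0,I_d)$, and $\theta=(a,w)\in\mathbb{R}\times\mathbb{R}^d=\mathbb{R}^{d+1}$. For $\sigma:\mathbb{R}\to\mathbb{R}$ and a probability measure $\rho$ on $\mathbb{R}^{d+1}$ let $$f_{\mathrm{NN}}(x;\rho)=\int a\,\sigma(w^\top x)\,\rho(da,dw),\qquad \Phi(\theta;\rho)=a\,\mathbb{E}_x\big[(f_{\mathrm{NN}}(x;\rho)-f^*(x))\,\sigma(w^\top x)\big].$$ Let $\xi(t)=\mathrm{diag}(\xi_a(t),\xi_w(t)I_d)$ with $\xi_a,\xi_w:[0,\infty)\to[0,\infty)$. A *mean-field flow* is a family $(\rho_t)_{t\ge0}$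 of probability measures on $\mathbb{R}^{d+1}$, continuous in $t\in[0,\infty)$ for weak convergence, such that $\int|a|\,\rho_t(da,dw)$ is finite for every $t\ge0$ and is an integrable function of $t$ on every interval $[0,T]$, and which solves $\partial_t\rho_t=\nabla_\theta\cdot(\rho_t\,\xi(t)\nabla_\theta\Phi(\theta;\rho_t))$ in the weak sense: $$\int_0^\infty\!\!\int\big(-\partial_t\eta+\nabla_\theta\eta\cdot(\xi(t)\nabla_\theta\Phi(\theta;\rho_t))\big)\,\rho_t(d\theta)\,dt=0\qquad\text{for all }\eta\in C_c^\infty(\mathbb{R}^{d+1}\times(0,\infty)).$$ **Assumption 1** (for the initial law $\rho_0$). (i) $\sigma\in C^2(\mathbb{R})$ and $|\sigma|,|\sigma'|,|\sigma''|\le K_\sigma$. (ii) $\xi_a,\xi_w$ are bounded by $K_\xi$ and Lipschitz continuous, with $\int_0^\infty\xi_a(t)\,dt=\int_0^\infty\xi_w(t)\,dt=\infty$. (iii) $\rho_0=\rho_a\times\rho_w$ for probability measures $\rho_a$ on $\mathbb{R}$ and $\rho_w$ on $\mathbb{R}^d$, where $\rho_a$ is symmetric and supported in $[-K_\rho,K_\rho]$.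 **Theorem 3.5.** For every $T\in(0,\infty)$ there is a constant $C_s>0$ depending only on $p$, $h^*$, $K_\sigma$, $K_\xi$, $K_\rho$ and $T$ (in particular not on $d$, on $V$ and its basis, on $\sigma,\xi_a,\xi_w$ beyond the constants $K_\sigma,K_\xi$, or on the initial laws) such that the following holds. If $(\rho_t)$ and $(\tilde\rho_t)$ are mean-field flows with the same $f^*$, $\sigma$, $\xi_a$, $\xi_w$, and Assumption 1 holds for both $\rho_0$ and $\tilde\rho_0$, then $$\sup_{0\le t\le T}\mathbb{E}_x\big[|f_{\mathrm{NN}}(x;\rho_t)-f_{\mathrm{NN}}(x;\tilde\rho_t)|^2\big]\le C_s\,W_2^2(\rho_0,\tilde\rho_0).$$ Here $W_2$ is the $2$-Wasserstein distance for the Euclidean distance on $\mathbb{R}^{d+1}$, that is, $W_2^2(\rho_0,\tilde\rho_0)=\inf_\gamma\int(|a-\tilde a|^2+\|w-\tilde w\|^2)\,d\gamma\in[0,\infty]$ over the couplings $\gamma$ of $\rho_0$ and $\tilde\rho_0$. -/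

import Mathlib

open MeasureTheory ProbabilityTheory Set

open scoped ENNReal ContDiff

noncomputable section

/-- The parameter space `ℝ^{d+1}` of a neuron `θ = (a, w)` with `a ∈ ℝ`, `w ∈ ℝ^d`. The product is
used for its topology and Borel sets only: the Euclidean structure of `ℝ^{d+1}` is written out
through the components `a` and `w` wherever it matters. -/
abbrev Param (d : ℕ) : Type := ℝ × EuclideanSpace ℝ (Fin d)

/-- The expectation `E_x[g(x)]` for `x ∼ N(0, I_d)`. -/
def gaussExp {d : ℕ} (g : EuclideanSpace ℝ (Fin d) → ℝ) : ℝ :=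
  ∫ x, g x ∂(stdGaussian (EuclideanSpace ℝ (Fin d)))

/-- The infinite-width two-layer network `f_NN(x; ρ) = ∫ a σ(wᵀx) ρ(da, dw)`. -/
def fNN {d : ℕ} (σ : ℝ → ℝ) (ρ : Measure (Param d)) (x : EuclideanSpace ℝ (Fin d)) : ℝ :=
  ∫ θ, θ.1 * σ (inner ℝ θ.2 x) ∂ρ

/-- The subspace-sparse polynomial `f*(x) = h*(x_V)`: `x_V` is the orthogonal projection of `x` to
the subspace `V`, and the polynomial map `h* : V → ℝ` is given as a polynomial `h` in the
coordinates with respect to an orthonormal basis `b` of `V`. -/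
def target {d p : ℕ} (h : MvPolynomial (Fin p) ℝ) (V : Submodule ℝ (EuclideanSpace ℝ (Fin d)))
    (b : OrthonormalBasis (Fin p) ℝ V) (x : EuclideanSpace ℝ (Fin d)) : ℝ :=
  MvPolynomial.eval (fun i => b.repr (V.orthogonalProjectionOnto x) i) h

/-- `Φ(θ; ρ) = a E_x[(f_NN(x; ρ) - f*(x)) σ(wᵀx)]` for `θ = (a, w)`. -/
def potential {d : ℕ} (σ : ℝ → ℝ) (fstar : EuclideanSpace ℝ (Fin d) → ℝ)
    (ρ : Measure (Param d)) (θ : Param d) : ℝ :=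
  θ.1 * gaussExp (fun x => (fNN σ ρ x - fstar x) * σ (inner ℝ θ.2 x))

/-- The integrand `-∂_t η + ∇_θ η · (ξ(t) ∇_θ Φ(θ; ρ))` of the weak formulation at `(θ, t)`, with
`ξ(t) = diag(ξ_a(t), ξ_w(t) I_d)`. -/
def weakIntegrand {d : ℕ} (σ : ℝ → ℝ) (fstar : EuclideanSpace ℝ (Fin d) → ℝ) (ξa ξw : ℝ → ℝ)
    (ρ : Measure (Param d)) (η : Param d × ℝ → ℝ) (θ : Param d) (t : ℝ) : ℝ :=
  -deriv (fun s => η (θ, s)) t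
    + (deriv (fun a => η ((a, θ.2), t)) θ.1
        * (ξa t * deriv (fun a => potential σ fstar ρ (a, θ.2)) θ.1)
      + inner ℝ (gradient (fun w => η ((θ.1, w), t)) θ.2)
          (ξw t • gradient (fun w => potential σ fstar ρ (θ.1, w)) θ.2))

/-- `(ρ_t)_{t ≥ 0}` is a weak solution of the mean-field equation
`∂_t ρ_t = ∇_θ · (ρ_t ξ(t) ∇_θ Φ(θ; ρ_t))`. The values of `ρ`, `ξa`, `ξw` at negative times play
no role. -/
structure IsMeanFieldFlow {d : ℕ} (σ : ℝ → ℝ) (fstar : EuclideanSpace ℝ (Fin d) → ℝ)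
    (ξa ξw : ℝ → ℝ) (ρ : ℝ → ProbabilityMeasure (Param d)) : Prop where
  /-- Continuity in time for weak convergence of probability measures; this gives the initial
  condition `ρ_t |_{t = 0} = ρ 0` its meaning. -/
  continuousOn : ContinuousOn ρ (Ici 0)
  /-- The integral that defines `f_NN(x; ρ_t)` converges at every time. -/
  moment_lt_top : ∀ t : ℝ, 0 ≤ t → ∫⁻ θ, ‖θ.1‖ₑ ∂(ρ t : Measure (Param d)) < ⊤
  /-- `t ↦ ∫ |a| ρ_t(da, dw)` is locally integrable on `[0, ∞)`: the time integral in the weak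
  formulation converges, since `|∇_θ Φ(θ; ρ_t)|` is at most `C (1 + |a|) (1 + ∫ |a'| ρ_t(dθ'))`. -/
  moment_integrable : ∀ T : ℝ, 0 < T →
    ∫⁻ t in Icc 0 T, ∫⁻ θ, ‖θ.1‖ₑ ∂(ρ t : Measure (Param d)) < ⊤
  /-- The weak formulation, with test functions in `C_c^∞(ℝ^{d+1} × (0, ∞))`. -/
  weak : ∀ η : Param d × ℝ → ℝ, ContDiff ℝ ∞ η → HasCompactSupport η →
    tsupport η ⊆ univ ×ˢ Ioi 0 →
    ∫ t in Ioi (0 : ℝ), ∫ θ, weakIntegrand σ fstar ξa ξw (ρ t) η θ t ∂(ρ t : Measure (Param d)) = 0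

/-- The activation function is `C²`, and `σ`, `σ'`, `σ''` are bounded by `K`. -/
structure IsActivation (σ : ℝ → ℝ) (K : ℝ) : Prop where
  contDiff : ContDiff ℝ 2 σ
  bound : ∀ s, |σ s| ≤ K
  bound_deriv : ∀ s, |deriv σ s| ≤ K
  bound_deriv_two : ∀ s, |deriv (deriv σ) s| ≤ K

/-- A learning rate `ξ : [0, ∞) → [0, ∞)`: bounded by `K`, Lipschitz continuous, and with
`∫_0^∞ ξ(t) dt = ∞`. -/
structure IsLearningRate (ξ : ℝ → ℝ) (K : ℝ) : Prop where
  nonneg : ∀ t, 0 ≤ t → 0 ≤ ξ t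
  bound : ∀ t, 0 ≤ t → |ξ t| ≤ K
  lipschitz : ∃ L, LipschitzOnWith L ξ (Ici 0)
  integral_eq_top : ∫⁻ t in Ici 0, ENNReal.ofReal (ξ t) = ⊤

/-- The initialization is `ρ₀ = ρ_a × ρ_w`, where `ρ_a` is symmetric and is supported in
`[-K, K]`. -/
def IsInitialization {d : ℕ} (ρ₀ : ProbabilityMeasure (Param d)) (K : ℝ) : Prop :=
  ∃ (ρa : Measure ℝ) (ρw : Measure (EuclideanSpace ℝ (Fin d))),
    IsProbabilityMeasure ρa ∧ IsProbabilityMeasure ρw ∧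
      (ρ₀ : Measure (Param d)) = ρa.prod ρw ∧
      ρa.map (fun a => -a) = ρa ∧ ρa (Icc (-K) K)ᶜ = 0

/-- The couplings of `μ` and `ν`: the measures on the product space with marginals `μ` and `ν`. -/
def couplings {d : ℕ} (μ ν : Measure (Param d)) : Set (Measure (Param d × Param d)) :=
  {γ | γ.map Prod.fst = μ ∧ γ.map Prod.snd = ν}

/-- The 2-Wasserstein distance for the Euclidean distance on `ℝ^{d+1}`, with values in `[0, ∞]`. -/
def W2 {d : ℕ} (μ ν : Measure (Param d)) : ℝ≥0∞ :=
  (⨅ γ ∈ couplings μ ν,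
    ∫⁻ z, ENNReal.ofReal (|z.1.1 - z.2.1| ^ 2 + ‖z.1.2 - z.2.2‖ ^ 2) ∂γ) ^ (1 / 2 : ℝ)

end

/-!
The velocity of a neuron grows linearly in its output weight `a`, so there is no global Lipschitz
bound to start from. However, the speed of the output weights is bounded by an affine function of
the current mean of `|a|`, and Grönwall's inequality bounds them up to time `T` if they are bounded
initially. Hence the mean-field flow also solves the continuity equation of the velocity at the
*clipped* output weight, which is a bounded Lipschitz field; the Lipschitz constant is independent
of the dimension because `𝔼 |⟨u, x⟩|⁴ = 3 ‖u‖⁴`. For such a field weak solutions are unique, by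
duality: testing with functions that are constant along the characteristics shows that `ρ_t` is the
push-forward of `ρ_0` under the characteristic flow.

Transporting a coupling of `ρ_0` and `ρ'_0` along the two characteristic flows gives couplings at
all later times. The two velocity fields differ by at most a constant times the `L²` distance of the
two networks, which in turn is at most a constant times the first moment of the cost of the
transported coupling, and Grönwall's inequality closes the loop.
-/

noncomputable section

namespace MeanFieldStability

open Filter Topology

open scoped NNReal BoundedContinuousFunction

section Flow

variable {X : Type*} [NormedAddCommGroup X] {v : ℝ → X → X} {M L : ℝ≥0}

/-- A time-dependent vector field that is bounded by `M`, Lipschitz in space with constant `L`, and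
uniformly continuous in space-time. -/
structure IsRegularField (v : ℝ → X → X) (M L : ℝ≥0) : Prop where
  norm_le : ∀ t x, ‖v t x‖ ≤ M
  lipschitz : ∀ t, LipschitzWith L (v t)
  uniformContinuous : UniformContinuous (Function.uncurry v)

namespace IsRegularField

theorem continuous (hv : IsRegularField v M L) (x : X) : Continuous (v · x) :=
  hv.uniformContinuous.continuous.comp (Continuous.prodMk_left x)

theorem reverse (hv : IsRegularField v M L) : IsRegularField (fun t x => -v (-t) x) M L where
  norm_le t x := by simpa only [norm_neg] using hv.norm_le (-t) x
  lipschitz t := (hv.lipschitz (-t)).neg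
  uniformContinuous :=
    (hv.uniformContinuous.comp
      (uniformContinuous_fst.neg.prodMk uniformContinuous_snd)).neg

end IsRegularField

variable [NormedSpace ℝ X]

/-- The flow of a vector field: `flow v s x` is the integral curve of `v` which is at `x` at
time `s`. It is a junk value if no such curve exists. -/
def flow (v : ℝ → X → X) (s : ℝ) (x : X) : ℝ → X :=
  Classical.epsilon fun α => α s = x ∧ IsIntegralCurve α v

namespace IsRegularField

theorem exists_hasDerivAt_Ioo [CompleteSpace X] (hv : IsRegularField v M L) (s : ℝ) (x : X)
    (r : ℝ≥0) :
    ∃ α : ℝ → X, α s = x ∧ ∀ t ∈ Ioo (s - r) (s + r), HasDerivAt α (v t (α t)) t := by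
  have hs : s ∈ Icc (s - r) (s + r) := by simp
  have hPL : IsPicardLindelof v ⟨s, hs⟩ x (M * r) 0 M L :=
    { lipschitzOnWith := fun t _ => (hv.lipschitz t).lipschitzOnWith
      continuousOn := fun y _ => (hv.continuous y).continuousOn
      norm_le := fun t _ y _ => hv.norm_le t y
      mul_max_le := by simp }
  obtain ⟨α, hα, hα'⟩ := hPL.exists_eq_forall_mem_Icc_hasDerivWithinAt₀
  exact ⟨α, hα, fun t ht => (hα' t (Ioo_subset_Icc_self ht)).hasDerivAt (Icc_mem_nhds ht.1 ht.2)⟩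

theorem eq_of_hasDerivAt_Ioo (hv : IsRegularField v M L) {α β : ℝ → X} {s r : ℝ}
    (hα : ∀ t ∈ Ioo (s - r) (s + r), HasDerivAt α (v t (α t)) t)
    (hβ : ∀ t ∈ Ioo (s - r) (s + r), HasDerivAt β (v t (β t)) t) (h : α s = β s) :
    EqOn α β (Ioo (s - r) (s + r)) := fun t ht => by
  have hr : 0 < r := by linarith [ht.1.trans ht.2]
  exact ODE_solution_unique_of_mem_Ioo (s := fun _ => univ)
    (fun t _ => (hv.lipschitz t).lipschitzOnWith) ⟨by linarith, by linarith⟩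
    (fun t ht => ⟨hα t ht, mem_univ _⟩) (fun t ht => ⟨hβ t ht, mem_univ _⟩) h ht

theorem exists_isIntegralCurve [CompleteSpace X] (hv : IsRegularField v M L) (s : ℝ) (x : X) :
    ∃ α : ℝ → X, α s = x ∧ IsIntegralCurve α v := by
  choose α hα hα' using fun n : ℕ => hv.exists_hasDerivAt_Ioo s x (n + 1)
  have mem_Ioo {n : ℕ} {t : ℝ} : t ∈ Ioo (s - (n + 1 : ℝ≥0)) (s + (n + 1 : ℝ≥0)) ↔
      |t - s| < n + 1 := by
    rw [abs_sub_lt_iff, mem_Ioo]; push_cast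
    constructor <;> rintro ⟨h₁, h₂⟩ <;> constructor <;> linarith
  have mono {m n : ℕ} (hmn : m ≤ n) {t : ℝ} (ht : |t - s| < m + 1) : α m t = α n t :=
    hv.eq_of_hasDerivAt_Ioo (hα' m)
      (fun t ht => hα' n t (mem_Ioo.2 ((mem_Ioo.1 ht).trans_le (by gcongr))))
      ((hα m).trans (hα n).symm) (mem_Ioo.2 ht)
  refine ⟨fun t => α ⌈|t - s|⌉₊ t, hα _, fun t => ?_⟩
  have ht : |t - s| < ⌈|t - s|⌉₊ + 1 := (Nat.le_ceil _).trans_lt (lt_add_one _)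
  refine (hα' _ t (mem_Ioo.2 ht)).congr_of_eventuallyEq ?_
  filter_upwards [(by fun_prop : Continuous fun r : ℝ => |r - s|).continuousAt.eventually_lt
    continuousAt_const ht] with r hr
  rcases le_total ⌈|r - s|⌉₊ ⌈|t - s|⌉₊ with h | h
  · exact mono h ((Nat.le_ceil _).trans_lt (lt_add_one _))
  · exact (mono h hr).symm

variable [CompleteSpace X]

theorem flow_self (hv : IsRegularField v M L) (s : ℝ) (x : X) : flow v s x s = x :=
  (Classical.epsilon_spec (hv.exists_isIntegralCurve s x)).1

theorem isIntegralCurve_flow (hv : IsRegularField v M L) (s : ℝ) (x : X) :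
    IsIntegralCurve (flow v s x) v :=
  (Classical.epsilon_spec (hv.exists_isIntegralCurve s x)).2

theorem flow_eq (hv : IsRegularField v M L) {α : ℝ → X} (hα : IsIntegralCurve α v) (s : ℝ) :
    flow v s (α s) = α :=
  ODE_solution_unique_univ (s := fun _ => univ) (fun t => (hv.lipschitz t).lipschitzOnWith)
    (fun t => ⟨hv.isIntegralCurve_flow s (α s) t, mem_univ _⟩) (fun t => ⟨hα t, mem_univ _⟩)
    (hv.flow_self s (α s))

theorem flow_flow (hv : IsRegularField v M L) (r s : ℝ) (x : X) :
    flow v r (flow v s x r) = flow v s x :=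
  hv.flow_eq (hv.isIntegralCurve_flow s x) r

theorem norm_flow_sub_flow_le (hv : IsRegularField v M L) (s : ℝ) (x : X) (t t' : ℝ) :
    ‖flow v s x t - flow v s x t'‖ ≤ M * |t - t'| :=
  convex_univ.norm_image_sub_le_of_norm_hasDerivWithin_le
    (fun r _ => (hv.isIntegralCurve_flow s x r).hasDerivWithinAt) (fun r _ => hv.norm_le r _)
    (mem_univ t') (mem_univ t)

theorem dist_flow_le_of_le (hv : IsRegularField v M L) {s t : ℝ} (hst : s ≤ t) (x y : X) :
    dist (flow v s x t) (flow v s y t) ≤ dist x y * Real.exp (L * (t - s)) :=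
  dist_le_of_trajectories_ODE hv.lipschitz
    (fun r _ => (hv.isIntegralCurve_flow s x r).continuousAt.continuousWithinAt)
    (fun r _ => (hv.isIntegralCurve_flow s x r).hasDerivWithinAt)
    (fun r _ => (hv.isIntegralCurve_flow s y r).continuousAt.continuousWithinAt)
    (fun r _ => (hv.isIntegralCurve_flow s y r).hasDerivWithinAt)
    (by rw [hv.flow_self, hv.flow_self]) t ⟨hst, le_rfl⟩

theorem flow_reverse (hv : IsRegularField v M L) (s : ℝ) (x : X) (t : ℝ) :
    flow (fun t x => -v (-t) x) s x t = flow v (-s) x (-t) := by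
  have hα : IsIntegralCurve (fun t => flow v (-s) x (-t)) (fun t x => -v (-t) x) := fun t => by
    simpa [Function.comp_def] using
      (hv.isIntegralCurve_flow (-s) x (-t)).scomp t (hasDerivAt_neg t)
  have h := congrFun (hv.reverse.flow_eq hα s) t
  rwa [hv.flow_self] at h

theorem dist_flow_le (hv : IsRegularField v M L) (s t : ℝ) (x y : X) :
    dist (flow v s x t) (flow v s y t) ≤ dist x y * Real.exp (L * |t - s|) := by
  rcases le_total s t with h | h
  · rw [abs_of_nonneg (sub_nonneg.2 h)]
    exact hv.dist_flow_le_of_le h x y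
  · rw [abs_of_nonpos (sub_nonpos.2 h)]
    have := hv.reverse.dist_flow_le_of_le (neg_le_neg h) x y
    simp only [hv.flow_reverse, neg_neg] at this
    rwa [show -(t - s) = -t - -s by ring]

theorem lipschitzWith_flow (hv : IsRegularField v M L) (s t : ℝ) :
    LipschitzWith (Real.exp (L * |t - s|)).toNNReal (fun x => flow v s x t) :=
  LipschitzWith.of_dist_le_mul fun x y => by
    rw [Real.coe_toNNReal _ (Real.exp_nonneg _), mul_comm]
    exact hv.dist_flow_le s t x y

theorem continuous_flow (hv : IsRegularField v M L) (s : ℝ) (x : X) :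
    Continuous (flow v s x) :=
  continuous_iff_continuousAt.2 fun t => (hv.isIntegralCurve_flow s x t).continuousAt

theorem continuous_velocity_flow (hv : IsRegularField v M L) (s : ℝ) (x : X) :
    Continuous fun t => v t (flow v s x t) :=
  hv.uniformContinuous.continuous.comp (continuous_id.prodMk (hv.continuous_flow s x))

theorem integral_velocity_flow (hv : IsRegularField v M L) (x : X) (t : ℝ) :
    ∫ s in 0..t, v s (flow v 0 x s) = flow v 0 x t - x := by
  rw [intervalIntegral.integral_eq_sub_of_hasDerivAt (fun s _ => hv.isIntegralCurve_flow 0 x s)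
    ((hv.continuous_velocity_flow 0 x).intervalIntegrable 0 t), hv.flow_self]

end IsRegularField

end Flow

section WeakDerivative

theorem absolutelyContinuousOnInterval_comp_of_locallyLipschitz {g f : ℝ → ℝ} {a b : ℝ}
    (hg : LocallyLipschitz g)
    (hf : AbsolutelyContinuousOnInterval f a b) : AbsolutelyContinuousOnInterval (g ∘ f) a b := by
  obtain ⟨K, hK⟩ := hg.locallyLipschitzOn.exists_lipschitzOnWith_of_compact
    (isCompact_uIcc.image_of_continuousOn hf.continuousOn)
  have hlim : Tendsto _ _ (𝓝 (K * 0 : ℝ)) := Tendsto.const_mul (K : ℝ) hf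
  rw [mul_zero] at hlim
  refine squeeze_zero' (Eventually.of_forall fun E => by positivity) ?_ hlim
  filter_upwards [mem_inf_of_right (mem_principal_self _)] with E hE
  rw [Finset.mul_sum]
  exact Finset.sum_le_sum fun i hi => hK.dist_le_mul _ (mem_image_of_mem f (hE.1 i hi).1) _
    (mem_image_of_mem f (hE.1 i hi).2)

theorem le_mul_exp_of_ae_deriv_le {Φ k : ℝ → ℝ} {a b : ℝ} (hab : a ≤ b)
    (hΦ : AbsolutelyContinuousOnInterval Φ a b) (hk : AbsolutelyContinuousOnInterval k a b)
    (h : ∀ᵐ t, t ∈ Icc a b → deriv Φ t ≤ deriv k t * Φ t) :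
    Φ b ≤ Φ a * Real.exp (k b - k a) := by
  have hexp : LocallyLipschitz Real.exp := (Real.contDiff_exp (n := 1)).locallyLipschitz
  have hE : AbsolutelyContinuousOnInterval (Real.exp ∘ (-k)) a b :=
    absolutelyContinuousOnInterval_comp_of_locallyLipschitz hexp hk.neg
  have hderiv : ∫ t in a..b, deriv (Φ * (Real.exp ∘ (-k))) t ≤ ∫ _ in a..b, (0 : ℝ) := by
    refine intervalIntegral.integral_mono_ae_restrict hab (hΦ.mul hE).intervalIntegrable_deriv
      (by simp) ((ae_restrict_iff' measurableSet_Icc).2 ?_)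
    filter_upwards [h, hΦ.ae_differentiableAt, hk.ae_differentiableAt] with t ht hΦt hkt hmem
    have hmem' : t ∈ uIcc a b := by rwa [uIcc_of_le hab]
    have hE' : HasDerivAt (Real.exp ∘ (-k)) (Real.exp (-k t) * -deriv k t) t :=
      (hkt hmem').hasDerivAt.neg.exp
    rw [((hΦt hmem').hasDerivAt.mul hE').deriv]
    have := mul_le_mul_of_nonneg_right (ht hmem) (Real.exp_nonneg (-k t))
    simp only [Function.comp_apply, Pi.neg_apply]
    linarith
  rw [(hΦ.mul hE).integral_deriv_eq_sub, intervalIntegral.integral_zero, sub_nonpos] at hderiv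
  have hle : Φ b * Real.exp (-k b) ≤ Φ a * Real.exp (-k a) := hderiv
  calc Φ b = Φ b * Real.exp (-k b) * Real.exp (k b) := by
        rw [mul_assoc, ← Real.exp_add, neg_add_cancel, Real.exp_zero, mul_one]
    _ ≤ Φ a * Real.exp (-k a) * Real.exp (k b) := by gcongr
    _ = Φ a * Real.exp (k b - k a) := by
        rw [mul_assoc, ← Real.exp_add, neg_add_eq_sub]

theorem le_mul_exp_integral {u κ : ℝ → ℝ} {A T : ℝ} (hT : 0 ≤ T)
    (hκ : IntervalIntegrable κ volume 0 T) (hκ₀ : ∀ t ∈ Icc 0 T, 0 ≤ κ t)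
    (hκu : IntervalIntegrable (fun t => κ t * u t) volume 0 T)
    (h : ∀ t ∈ Icc 0 T, u t ≤ A + ∫ s in 0..t, κ s * u s) :
    u T ≤ A * Real.exp (∫ s in 0..T, κ s) := by
  have hΦ : AbsolutelyContinuousOnInterval (fun t => A + ∫ s in 0..t, κ s * u s) 0 T :=
    (LipschitzWith.const A).lipschitzOnWith.absolutelyContinuousOnInterval.add
      (hκu.absolutelyContinuousOnInterval_intervalIntegral left_mem_uIcc)
  have key := le_mul_exp_of_ae_deriv_le hT hΦ
    (hκ.absolutelyContinuousOnInterval_intervalIntegral (c := 0) left_mem_uIcc) (by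
      filter_upwards [hκu.ae_hasDerivAt_integral, hκ.ae_hasDerivAt_integral] with t h₁ h₂ ht
      have ht' : t ∈ uIcc 0 T := by rwa [uIcc_of_le hT]
      rw [((h₁ ht' 0 left_mem_uIcc).const_add A).deriv, (h₂ ht' 0 left_mem_uIcc).deriv]
      exact mul_le_mul_of_nonneg_left (h t ht) (hκ₀ t ht))
  simp only [intervalIntegral.integral_same, add_zero, sub_zero] at key
  exact (h T (right_mem_Icc.2 hT)).trans key

theorem add_mul_integral_le_mul_exp {m : ℝ → ℝ} {A β T t : ℝ} (hβ : 0 ≤ β)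
    (hm : IntervalIntegrable m volume 0 T)
    (h : ∀ r ∈ Icc 0 T, m r ≤ A + β * ∫ s in 0..r, m s) (ht : t ∈ Icc 0 T) :
    A + β * ∫ s in 0..t, m s ≤ A * Real.exp (β * t) := by
  have hsub : uIcc 0 t ⊆ uIcc 0 T := by
    rw [uIcc_of_le ht.1, uIcc_of_le (ht.1.trans ht.2)]; exact Icc_subset_Icc_right ht.2
  have hu : ContinuousOn (fun r => A + β * ∫ s in 0..r, m s) (uIcc 0 t) :=
    continuousOn_const.add (continuousOn_const.mul
      ((intervalIntegral.continuousOn_primitive_interval' hm left_mem_uIcc).mono hsub))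
  have := le_mul_exp_integral (κ := fun _ => β) ht.1 (by simp) (fun _ _ => hβ)
    (hu.intervalIntegrable.const_mul β) (A := A) fun r hr => ?_
  · simpa [mul_comm β] using this
  have hsub' : uIcc 0 r ⊆ uIcc 0 t := by
    rw [uIcc_of_le hr.1, uIcc_of_le ht.1]; exact Icc_subset_Icc_right hr.2
  rw [intervalIntegral.integral_const_mul]
  gcongr
  exact intervalIntegral.integral_mono_on hr.1 (hm.mono_set (hsub'.trans hsub))
    (hu.mono hsub').intervalIntegrable fun s hs => h s ⟨hs.1, hs.2.trans (hr.2.trans ht.2)⟩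

theorem exists_contDiff_deriv_eq {g : ℝ → ℝ} {a b : ℝ} (hg : ContDiff ℝ ∞ g)
    (hgc : HasCompactSupport g) (hgs : tsupport g ⊆ Ioo a b)
    (hg₀ : ∫ x in a..b, g x = 0) :
    ∃ ψ : ℝ → ℝ, ContDiff ℝ ∞ ψ ∧ HasCompactSupport ψ ∧ tsupport ψ ⊆ Ioo a b ∧ deriv ψ = g := by
  set ψ : ℝ → ℝ := fun x => ∫ y in a..x, g y
  have hψ (x : ℝ) : HasDerivAt ψ (g x) x :=
    (hg.continuous.integral_hasStrictDerivAt a x).hasDerivAt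
  have hderiv : deriv ψ = g := funext fun x => (hψ x).deriv
  obtain ⟨α, β, hα, hβ, hsub⟩ : ∃ α β, a < α ∧ β < b ∧ tsupport g ⊆ Icc α β := by
    rcases (tsupport g).eq_empty_or_nonempty with h | h
    · exact ⟨a + 1, b - 1, by linarith, by linarith, h ▸ empty_subset _⟩
    · exact ⟨sInf (tsupport g), sSup (tsupport g), (hgs (hgc.isCompact.sInf_mem h)).1,
        (hgs (hgc.isCompact.sSup_mem h)).2, hgc.isCompact.isBounded.subset_Icc_sInf_sSup⟩
  have hzero {x : ℝ} (hx : x ∉ Icc α β) : g x = 0 :=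
    image_eq_zero_of_notMem_tsupport fun h => hx (hsub h)
  have hsupp : tsupport ψ ⊆ Icc α β := by
    refine closure_minimal (fun x hx => by_contra fun hx' => hx ?_) isClosed_Icc
    rcases not_and_or.1 hx' with h | h
    · refine (intervalIntegral.integral_congr fun y hy => hzero fun hy' => ?_).trans
        intervalIntegral.integral_zero
      exact (hy.2.trans_lt (max_lt hα (not_le.1 h))).not_ge hy'.1
    · have hxb : ∫ y in b..x, g y = 0 := by
        refine (intervalIntegral.integral_congr fun y hy => hzero fun hy' => ?_).trans
          intervalIntegral.integral_zero
        exact (hy'.2.trans_lt (lt_min hβ (not_le.1 h))).not_ge hy.1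
      simp only [ψ]
      rw [← intervalIntegral.integral_add_adjacent_intervals
        (hg.continuous.intervalIntegrable a b) (hg.continuous.intervalIntegrable b x), hg₀, hxb,
        add_zero]
  exact ⟨ψ, contDiff_infty_iff_deriv.2 ⟨fun x => (hψ x).differentiableAt, hderiv ▸ hg⟩,
    isCompact_Icc.of_isClosed_subset (isClosed_tsupport ψ) hsupp,
    hsupp.trans fun x hx => ⟨hα.trans_le hx.1, hx.2.trans_lt hβ⟩, hderiv⟩

theorem exists_contDiff_integral_eq_one {a b : ℝ} (hab : a < b) :
    ∃ ψ : ℝ → ℝ, ContDiff ℝ ∞ ψ ∧ HasCompactSupport ψ ∧ tsupport ψ ⊆ Ioo a b ∧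
      ∫ x in a..b, ψ x = 1 := by
  let k : ContDiffBump ((a + b) / 2) := ⟨(b - a) / 8, (b - a) / 4, by linarith, by linarith⟩
  have hsub : tsupport (k.normed volume) ⊆ Ioo a b := by
    rw [k.tsupport_normed_eq, Real.closedBall_eq_Icc]
    exact Icc_subset_Ioo (by simp only [k]; linarith) (by simp only [k]; linarith)
  refine ⟨k.normed volume, k.contDiff_normed, k.hasCompactSupport_normed, hsub, ?_⟩
  rw [intervalIntegral.integral_eq_integral_of_support_subset
    ((subset_tsupport _).trans (hsub.trans Ioo_subset_Ioc_self)), k.integral_normed]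

theorem exists_eqOn_const_of_forall_integral_deriv_mul_eq_zero {G : ℝ → ℝ} {a b : ℝ} (hab : a < b)
    (hG : ContinuousOn G (Icc a b))
    (h : ∀ ψ : ℝ → ℝ, ContDiff ℝ ∞ ψ → HasCompactSupport ψ → tsupport ψ ⊆ Ioo a b →
      ∫ t in a..b, deriv ψ t * G t = 0) :
    ∃ c, EqOn G (fun _ => c) (Icc a b) := by
  obtain ⟨ψ₀, hψ₀, hψ₀c, hψ₀s, hψ₀1⟩ := exists_contDiff_integral_eq_one hab
  have hmul {g : ℝ → ℝ} (hg : Continuous g) : IntervalIntegrable (fun x => g x * G x) volume a b :=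
    ContinuousOn.intervalIntegrable_of_Icc hab.le (hg.continuousOn.mul hG)
  set c := ∫ x in a..b, ψ₀ x * G x
  have horth (g : ℝ → ℝ) (hg : ContDiff ℝ ∞ g) (hgc : HasCompactSupport g)
      (hgs : tsupport g ⊆ Ioo a b) : ∫ x, g x * (G x - c) = 0 := by
    set I := ∫ x in a..b, g x
    have hgi : IntervalIntegrable g volume a b := hg.continuous.intervalIntegrable a b
    have hψi : IntervalIntegrable (fun x => I * ψ₀ x) volume a b :=
      (hψ₀.continuous.intervalIntegrable a b).const_mul I
    -- `g - I ψ₀` has mean zero, hence is the derivative of a test function.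
    obtain ⟨ψ, hψ, hψc, hψs, hψ'⟩ := exists_contDiff_deriv_eq (g := fun x => g x - I * ψ₀ x)
      (a := a) (b := b) (hg.sub (contDiff_const.mul hψ₀)) (hgc.sub hψ₀c.mul_left)
      ((tsupport_sub g _).trans (union_subset hgs (tsupport_mul_subset_right.trans hψ₀s))) (by
        rw [intervalIntegral.integral_sub hgi hψi, intervalIntegral.integral_const_mul, hψ₀1,
          mul_one, sub_self])
    have hψG : (∫ x in a..b, g x * G x) - I * c = 0 := by
      rw [← h ψ hψ hψc hψs, hψ', ← intervalIntegral.integral_const_mul,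
        ← intervalIntegral.integral_sub (hmul hg.continuous) ((hmul hψ₀.continuous).const_mul I)]
      congr! 2; ring
    rw [← intervalIntegral.integral_eq_integral_of_support_subset
      ((subset_tsupport _).trans ((tsupport_mul_subset_left.trans hgs).trans Ioo_subset_Ioc_self))]
    simp only [mul_sub]
    rw [intervalIntegral.integral_sub (hmul hg.continuous) (hgi.mul_const c),
      intervalIntegral.integral_mul_const, hψG]
  have hae : ∀ᵐ x, x ∈ Ioo a b → G x - c = 0 :=
    isOpen_Ioo.ae_eq_zero_of_integral_contDiff_smul_eq_zero
      (((hG.mono Ioo_subset_Icc_self).sub continuousOn_const).locallyIntegrableOn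
        measurableSet_Ioo) horth
  have hIoo : EqOn G (fun _ => c) (Ioo a b) :=
    Measure.eqOn_open_of_ae_eq (μ := volume) ((ae_restrict_iff' measurableSet_Ioo).2
      (hae.mono fun x hx hx' => sub_eq_zero.1 (hx hx'))) isOpen_Ioo
      (hG.mono Ioo_subset_Icc_self) continuousOn_const
  exact ⟨c, hIoo.of_subset_closure hG continuousOn_const Ioo_subset_Icc_self
    (closure_Ioo hab.ne).ge⟩

theorem sub_eq_integral_of_weak_deriv {F H : ℝ → ℝ} {T : ℝ} (hF : ContinuousOn F (Icc 0 T))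
    (hH : IntervalIntegrable H volume 0 T)
    (h : ∀ ψ : ℝ → ℝ, ContDiff ℝ ∞ ψ → HasCompactSupport ψ → tsupport ψ ⊆ Ioo 0 T →
      ∫ t in 0..T, (deriv ψ t * F t + ψ t * H t) = 0) {t : ℝ} (ht : t ∈ Icc 0 T) :
    F t - F 0 = ∫ s in 0..t, H s := by
  have hT : 0 ≤ T := ht.1.trans ht.2
  rcases hT.eq_or_lt with rfl | hT'
  · obtain rfl : t = 0 := le_antisymm ht.2 ht.1
    simp
  have hAC := hH.absolutelyContinuousOnInterval_intervalIntegral (c := 0) left_mem_uIcc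
  have hcont : ContinuousOn (fun t => ∫ s in 0..t, H s) (Icc 0 T) := by
    simpa only [uIcc_of_le hT] using hAC.continuousOn
  obtain ⟨c, hc⟩ := exists_eqOn_const_of_forall_integral_deriv_mul_eq_zero hT'
    (hF.sub hcont) fun ψ hψ hψc hψs => by
    have hψ0 : ψ 0 = 0 := image_eq_zero_of_notMem_tsupport fun h => lt_irrefl _ (hψs h).1
    have hψT : ψ T = 0 := image_eq_zero_of_notMem_tsupport fun h => lt_irrefl _ (hψs h).2
    have hψAC : AbsolutelyContinuousOnInterval ψ 0 T :=
      (hψ.of_le (mod_cast le_top)).contDiffOn.absolutelyContinuousOnInterval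
    have hψ' : Continuous (deriv ψ) := hψ.continuous_deriv (mod_cast le_top)
    have hparts : ∫ t in 0..T, deriv ψ t * (∫ s in 0..t, H s) = -∫ t in 0..T, ψ t * H t := by
      have := hψAC.integral_mul_deriv_eq_deriv_mul hAC
      rw [hψ0, hψT, zero_mul, zero_mul, sub_zero, zero_sub] at this
      rw [← neg_eq_iff_eq_neg, ← this]
      refine intervalIntegral.integral_congr_ae ?_
      filter_upwards [hH.ae_hasDerivAt_integral] with t ht htm
      rw [(ht (uIoc_subset_uIcc htm) 0 left_mem_uIcc).deriv]
    have hi₁ : IntervalIntegrable (fun t => deriv ψ t * F t) volume 0 T :=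
      (hψ'.continuousOn.mul hF).intervalIntegrable_of_Icc hT
    have hi₂ : IntervalIntegrable (fun t => deriv ψ t * ∫ s in 0..t, H s) volume 0 T :=
      (hψ'.continuousOn.mul hcont).intervalIntegrable_of_Icc hT
    simp only [Pi.sub_apply, mul_sub]
    rw [intervalIntegral.integral_sub hi₁ hi₂, hparts, sub_neg_eq_add,
      ← intervalIntegral.integral_add hi₁ (hH.continuousOn_mul hψ.continuous.continuousOn)]
    exact h ψ hψ hψc hψs
  have h₁ := hc ht
  have h₂ := hc (left_mem_Icc.2 hT)
  simp only [Pi.sub_apply, intervalIntegral.integral_same] at h₁ h₂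
  linarith

end WeakDerivative

section SpaceTime

variable {X : Type*} [MeasurableSpace X] {κ : Kernel ℝ X} {T : ℝ}

/-- The measure `κ t (dx) dt` on `[0, T] × X`. -/
def spaceTime (κ : Kernel ℝ X) (T : ℝ) : Measure (ℝ × X) :=
  (volume.restrict (Ioc 0 T)) ⊗ₘ κ

theorem integrable_comp_fst_mul {ψ : ℝ → ℝ} (hψ : Continuous ψ) (hψc : HasCompactSupport ψ)
    {f : ℝ × X → ℝ} (hf : Integrable f (spaceTime κ T)) :
    Integrable (fun p => ψ p.1 * f p) (spaceTime κ T) := by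
  obtain ⟨B, hB⟩ := hψc.exists_bound_of_continuous hψ
  exact hf.bdd_mul (hψ.measurable.comp measurable_fst).aestronglyMeasurable
    (ae_of_all _ fun p => hB p.1)

variable [IsMarkovKernel κ]

instance : IsFiniteMeasure (spaceTime κ T) := by
  rw [spaceTime]; infer_instance

theorem map_fst_spaceTime : (spaceTime κ T).map Prod.fst = volume.restrict (Ioc 0 T) :=
  Measure.fst_compProd _ _

theorem ae_fst_mem_Ioc : ∀ᵐ p ∂spaceTime κ T, p.1 ∈ Ioc 0 T := by
  refine ae_of_ae_map (p := (· ∈ Ioc 0 T)) measurable_fst.aemeasurable ?_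
  rw [map_fst_spaceTime]
  exact ae_restrict_mem measurableSet_Ioc

theorem integrable_comp_fst_spaceTime {m : ℝ → ℝ} (hm : IntegrableOn m (Ioc 0 T)) :
    Integrable (fun p => m p.1) (spaceTime κ T) := by
  rw [IntegrableOn, ← map_fst_spaceTime (κ := κ)] at hm
  exact hm.comp_measurable measurable_fst

theorem integral_spaceTime (hT : 0 ≤ T) {f : ℝ × X → ℝ} (hf : Integrable f (spaceTime κ T)) :
    ∫ p, f p ∂spaceTime κ T = ∫ t in 0..T, ∫ x, f (t, x) ∂κ t := by
  rw [spaceTime, Measure.integral_compProd hf, intervalIntegral.integral_of_le hT]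

theorem intervalIntegrable_of_integrable_spaceTime (hT : 0 ≤ T) {f : ℝ × X → ℝ}
    (hf : Integrable f (spaceTime κ T)) :
    IntervalIntegrable (fun t => ∫ x, f (t, x) ∂κ t) volume 0 T := by
  rw [intervalIntegrable_iff_integrableOn_Ioc_of_le hT]
  exact Integrable.integral_compProd hf

end SpaceTime

section Cutoff

variable {X : Type*} [NormedAddCommGroup X] [NormedSpace ℝ X] [FiniteDimensional ℝ X]

/-- A smooth cutoff function on `X` which is `1` on the ball of radius `n + 1`. -/
def cutoff (n : ℕ) (x : X) : ℝ :=
  (⟨1, 2, one_pos, one_lt_two⟩ : ContDiffBump (0 : X)) (((n : ℝ) + 1)⁻¹ • x)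

theorem contDiff_cutoff (n : ℕ) : ContDiff ℝ ∞ (cutoff (X := X) n) :=
  (ContDiffBump.contDiff _).comp (contDiff_const_smul _)

theorem cutoff_mem_Icc (n : ℕ) (x : X) : cutoff n x ∈ Icc 0 1 :=
  ⟨ContDiffBump.nonneg _, ContDiffBump.le_one _⟩

theorem hasCompactSupport_cutoff (n : ℕ) : HasCompactSupport (cutoff (X := X) n) :=
  (ContDiffBump.hasCompactSupport _).comp_smul (by positivity)

theorem eventually_cutoff_eventuallyEq_one (x : X) : ∀ᶠ n : ℕ in atTop, cutoff n =ᶠ[𝓝 x] 1 := by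
  filter_upwards [tendsto_natCast_atTop_atTop.eventually_gt_atTop ‖x‖] with n hn
  filter_upwards [continuousAt_id.norm.eventually_lt continuousAt_const hn] with y hy
  refine ContDiffBump.one_of_mem_closedBall _ ?_
  rw [mem_closedBall_zero_iff, norm_smul, norm_inv, Real.norm_of_nonneg (by positivity),
    inv_mul_le_iff₀ (by positivity)]
  simp only [id] at hy
  linarith

theorem exists_abs_fderiv_cutoff_le (X : Type*) [NormedAddCommGroup X] [NormedSpace ℝ X]
    [FiniteDimensional ℝ X] :
    ∃ A, 0 ≤ A ∧ ∀ (n : ℕ) (x v : X), |fderiv ℝ (cutoff n) x v| * (1 + ‖x‖) ≤ A * ‖v‖ := by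
  set χ : ContDiffBump (0 : X) := ⟨1, 2, one_pos, one_lt_two⟩
  have hχ : Continuous fun y => (1 + ‖y‖) • fderiv ℝ χ y :=
    (continuous_const.add continuous_norm).smul (χ.contDiff (n := 1).continuous_fderiv one_ne_zero)
  have hχc : HasCompactSupport fun y => (1 + ‖y‖) • fderiv ℝ χ y :=
    (χ.hasCompactSupport.fderiv ℝ).smul_left (f := fun y => 1 + ‖y‖)
  obtain ⟨A, hA⟩ := hχc.exists_bound_of_continuous hχ
  refine ⟨A, (norm_nonneg _).trans (hA 0), fun n x v => ?_⟩
  set c := ((n : ℝ) + 1)⁻¹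
  have hc : 0 ≤ c := by positivity
  have hc1 : c ≤ 1 := inv_le_one_of_one_le₀ (by linarith [(Nat.cast_nonneg n : (0 : ℝ) ≤ n)])
  have hderiv : fderiv ℝ (cutoff n) x v = c * fderiv ℝ χ (c • x) v := by
    change fderiv ℝ (fun x => χ (c • x)) x v = _
    rw [fderiv_comp_smul]; rfl
  have hle := (hA (c • x))
  rw [norm_smul, norm_smul, Real.norm_of_nonneg (by positivity), Real.norm_of_nonneg hc] at hle
  calc |fderiv ℝ (cutoff n) x v| * (1 + ‖x‖)
      = |fderiv ℝ χ (c • x) v| * (c + c * ‖x‖) := by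
        rw [hderiv, abs_mul, abs_of_nonneg hc]; ring
    _ ≤ ‖fderiv ℝ χ (c • x)‖ * ‖v‖ * (1 + c * ‖x‖) := by
        gcongr; exact (fderiv ℝ χ (c • x)).le_opNorm v
    _ = (1 + c * ‖x‖) * ‖fderiv ℝ χ (c • x)‖ * ‖v‖ := by ring
    _ ≤ A * ‖v‖ := by gcongr

theorem fderiv_mul_cutoff_mul {ψ : ℝ → ℝ} {φ : ℝ × X → ℝ} (hψ : ContDiff ℝ ∞ ψ)
    (hφ : ContDiff ℝ ∞ φ) (n : ℕ) (p : ℝ × X) (v : X) :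
    fderiv ℝ (fun p => ψ p.1 * (cutoff n p.2 * φ p)) p (1, v) =
      cutoff n p.2 * (deriv ψ p.1 * φ p + ψ p.1 * fderiv ℝ φ p (1, v)) +
        ψ p.1 * φ p * fderiv ℝ (cutoff n) p.2 v := by
  have h₁ : HasFDerivAt (fun p : ℝ × X => ψ p.1) _ p :=
    ((hψ.differentiable (by simp)).differentiableAt.hasFDerivAt (x := p.1)).comp p hasFDerivAt_fst
  have h₂ : HasFDerivAt (fun p : ℝ × X => cutoff n p.2) _ p :=
    (((contDiff_cutoff n).differentiable (by simp)).differentiableAt.hasFDerivAt (x := p.2)).comp p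
      hasFDerivAt_snd
  have h₃ := ((hφ.differentiable (by simp)) p).hasFDerivAt
  have h₄ : HasFDerivAt (fun p : ℝ × X => ψ p.1 * (cutoff n p.2 * φ p)) _ p := h₁.mul (h₂.mul h₃)
  rw [h₄.fderiv]
  simp
  ring

theorem contDiff_mul_cutoff_mul {ψ : ℝ → ℝ} {φ : ℝ × X → ℝ} (hψ : ContDiff ℝ ∞ ψ)
    (hφ : ContDiff ℝ ∞ φ) (n : ℕ) :
    ContDiff ℝ ∞ fun p : ℝ × X => ψ p.1 * (cutoff n p.2 * φ p) :=
  (hψ.comp contDiff_fst).mul (((contDiff_cutoff n).comp contDiff_snd).mul hφ)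

theorem tsupport_mul_cutoff_mul_subset (ψ : ℝ → ℝ) (φ : ℝ × X → ℝ) (n : ℕ) :
    tsupport (fun p : ℝ × X => ψ p.1 * (cutoff n p.2 * φ p)) ⊆
      tsupport ψ ×ˢ tsupport (cutoff (X := X) n) := by
  refine closure_minimal (fun p hp => ?_) ((isClosed_tsupport _).prod (isClosed_tsupport _))
  rw [Function.mem_support] at hp
  exact ⟨subset_tsupport _ (left_ne_zero_of_mul hp),
    subset_tsupport _ (left_ne_zero_of_mul (right_ne_zero_of_mul hp))⟩

end Cutoff

section Transport

variable {X : Type*} [NormedAddCommGroup X] [NormedSpace ℝ X] [MeasurableSpace X]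

/-- A narrowly continuous weak solution of the continuity equation `∂_t κ_t + ∇ · (V_t κ_t) = 0` on
`[0, T]`, for a velocity field `V` of linear growth. -/
structure IsTransport (κ : Kernel ℝ X) (V : ℝ → X → X) (T : ℝ) : Prop where
  continuousOn : ∀ φ : X →ᵇ ℝ, ContinuousOn (fun t => ∫ x, φ x ∂κ t) (Icc 0 T)
  aestronglyMeasurable : AEStronglyMeasurable (Function.uncurry V) (spaceTime κ T)
  growth : ∃ m : ℝ → ℝ, IntegrableOn m (Ioc 0 T) ∧
    ∀ᵐ p ∂spaceTime κ T, ‖V p.1 p.2‖ ≤ m p.1 * (1 + ‖p.2‖)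
  weak : ∀ η : ℝ × X → ℝ, ContDiff ℝ ∞ η → HasCompactSupport η → tsupport η ⊆ Ioo 0 T ×ˢ univ →
    ∫ p, fderiv ℝ η p (1, V p.1 p.2) ∂spaceTime κ T = 0

variable {κ : Kernel ℝ X} {V : ℝ → X → X} {T : ℝ}

namespace IsTransport

theorem congr {V' : ℝ → X → X} (h : IsTransport κ V T)
    (hV : Function.uncurry V =ᵐ[spaceTime κ T] Function.uncurry V') : IsTransport κ V' T where
  continuousOn := h.continuousOn
  aestronglyMeasurable := h.aestronglyMeasurable.congr hV
  growth := by
    obtain ⟨m, hm, hVm⟩ := h.growth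
    refine ⟨m, hm, ?_⟩
    filter_upwards [hVm, hV] with p hp hVp
    simp only [Function.uncurry_def] at hVp
    rwa [← hVp]
  weak η hη hηc hηs := by
    rw [← h.weak η hη hηc hηs]
    refine integral_congr_ae ?_
    filter_upwards [hV] with p hp
    simp only [Function.uncurry_def] at hp
    rw [hp]

theorem continuousOn_integral_of_lipschitz_left [BorelSpace X] [IsMarkovKernel κ]
    (h : IsTransport κ V T) {φ : ℝ → X → ℝ} {C K : ℝ} (hφ : ∀ t, Continuous (φ t))
    (hC : ∀ t x, |φ t x| ≤ C)
    (hK : ∀ s ∈ Icc 0 T, ∀ t ∈ Icc 0 T, ∀ x, |φ s x - φ t x| ≤ K * |s - t|) :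
    ContinuousOn (fun t => ∫ x, φ t x ∂κ t) (Icc 0 T) := by
  intro t ht
  let φt : X →ᵇ ℝ := .ofNormedAddCommGroup (φ t) (hφ t) C (hC t)
  have hint (s r : ℝ) : Integrable (φ s) (κ r) :=
    .of_bound (hφ s).aestronglyMeasurable C (ae_of_all _ (hC s))
  refine tendsto_iff_dist_tendsto_zero.2 (squeeze_zero' (.of_forall fun _ => dist_nonneg)
    (g := fun s => K * |s - t| + dist (∫ x, φt x ∂κ s) (∫ x, φt x ∂κ t)) ?_ ?_)
  · filter_upwards [self_mem_nhdsWithin] with s hs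
    refine (dist_triangle _ (∫ x, φ t x ∂κ s) _).trans (add_le_add ?_ le_rfl)
    rw [Real.dist_eq, ← integral_sub (hint s s) (hint t s), ← Real.norm_eq_abs]
    simpa using norm_integral_le_of_norm_le_const (μ := κ s) (f := fun x => φ s x - φ t x)
      (ae_of_all _ (hK s hs t ht))
  · have h₁ : Tendsto (fun s => K * |s - t|) (𝓝[Icc 0 T] t) (𝓝 (K * |t - t|)) :=
      ((by fun_prop : Continuous fun s => K * |s - t|).tendsto t).mono_left nhdsWithin_le_nhds
    simpa using h₁.add (tendsto_iff_dist_tendsto_zero.1 (h.continuousOn φt t ht))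

variable [FiniteDimensional ℝ X]

theorem exists_integrableOn_abs_fderiv_cutoff_le (h : IsTransport κ V T) :
    ∃ m : ℝ → ℝ, IntegrableOn m (Ioc 0 T) ∧ ∀ n, ∀ᵐ p ∂spaceTime κ T,
      |fderiv ℝ (cutoff n) p.2 (V p.1 p.2)| ≤ m p.1 := by
  obtain ⟨m, hm, hVm⟩ := h.growth
  obtain ⟨A, hA₀, hA⟩ := exists_abs_fderiv_cutoff_le X
  refine ⟨fun t => A * m t, hm.const_mul A, fun n => ?_⟩
  filter_upwards [hVm] with p hp
  have hx : 0 < 1 + ‖p.2‖ := by positivity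
  refine le_of_mul_le_mul_right ((hA n p.2 _).trans ?_) hx
  rw [mul_assoc]
  exact mul_le_mul_of_nonneg_left hp hA₀

theorem integral_cutoff_mul_eq_zero (h : IsTransport κ V T) {φ : ℝ × X → ℝ} (hφ : ContDiff ℝ ∞ φ)
    {ψ : ℝ → ℝ} (hψ : ContDiff ℝ ∞ ψ) (hψc : HasCompactSupport ψ) (hψs : tsupport ψ ⊆ Ioo 0 T)
    (n : ℕ) :
    ∫ p, (cutoff n p.2 * (deriv ψ p.1 * φ p + ψ p.1 * fderiv ℝ φ p (1, V p.1 p.2)) +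
      ψ p.1 * φ p * fderiv ℝ (cutoff n) p.2 (V p.1 p.2)) ∂spaceTime κ T = 0 := by
  simp_rw [← fderiv_mul_cutoff_mul hψ hφ]
  have hsub := tsupport_mul_cutoff_mul_subset ψ φ n
  exact h.weak _ (contDiff_mul_cutoff_mul hψ hφ n)
    ((hψc.prod (hasCompactSupport_cutoff n)).of_isClosed_subset (isClosed_tsupport _) hsub)
    (hsub.trans (prod_mono hψs (subset_univ _)))

variable [BorelSpace X]

theorem aestronglyMeasurable_fderiv_apply (h : IsTransport κ V T) {u : X → ℝ}
    (hu : ContDiff ℝ 1 u) :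
    AEStronglyMeasurable (fun p => fderiv ℝ u p.2 (V p.1 p.2)) (spaceTime κ T) := by
  have hu' : Continuous fun q : X × X => fderiv ℝ u q.1 q.2 :=
    ((hu.continuous_fderiv (by simp)).comp continuous_fst).clm_apply continuous_snd
  exact hu'.comp_aestronglyMeasurable
    (continuous_snd.aestronglyMeasurable.prodMk h.aestronglyMeasurable)

variable [IsMarkovKernel κ]

theorem integral_deriv_mul_add_mul_fderiv_eq_zero (h : IsTransport κ V T) {φ : ℝ × X → ℝ}
    (hφ : ContDiff ℝ ∞ φ) {C : ℝ} (hC : ∀ p, |φ p| ≤ C)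
    (hder : Integrable (fun p => fderiv ℝ φ p (1, V p.1 p.2)) (spaceTime κ T)) {ψ : ℝ → ℝ}
    (hψ : ContDiff ℝ ∞ ψ) (hψc : HasCompactSupport ψ) (hψs : tsupport ψ ⊆ Ioo 0 T) :
    ∫ p, (deriv ψ p.1 * φ p + ψ p.1 * fderiv ℝ φ p (1, V p.1 p.2)) ∂spaceTime κ T = 0 := by
  obtain ⟨m, hm, hcut⟩ := h.exists_integrableOn_abs_fderiv_cutoff_le
  obtain ⟨B, hB⟩ := hψc.exists_bound_of_continuous hψ.continuous
  have hmain : Integrable (fun p => deriv ψ p.1 * φ p + ψ p.1 * fderiv ℝ φ p (1, V p.1 p.2))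
      (spaceTime κ T) := by
    have hφi : Integrable φ (spaceTime κ T) :=
      .of_bound hφ.continuous.aestronglyMeasurable C (ae_of_all _ hC)
    exact (integrable_comp_fst_mul (hψ.continuous_deriv (by simp)) hψc.deriv hφi).add
      (integrable_comp_fst_mul hψ.continuous hψc hder)
  refine tendsto_nhds_unique (tendsto_integral_of_dominated_convergence (F := fun n p =>
    cutoff n p.2 * (deriv ψ p.1 * φ p + ψ p.1 * fderiv ℝ φ p (1, V p.1 p.2)) +
      ψ p.1 * φ p * fderiv ℝ (cutoff n) p.2 (V p.1 p.2)) (fun p =>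
    |deriv ψ p.1 * φ p + ψ p.1 * fderiv ℝ φ p (1, V p.1 p.2)| + B * C * m p.1)
    (fun n => ?_) ?_ (fun n => ?_) (ae_of_all _ fun p => ?_)) ?_
  · refine (((contDiff_cutoff n).continuous.comp continuous_snd).aestronglyMeasurable.mul
      hmain.aestronglyMeasurable).add (((hψ.continuous.comp continuous_fst).mul
        hφ.continuous).aestronglyMeasurable.mul ?_)
    exact h.aestronglyMeasurable_fderiv_apply ((contDiff_cutoff n).of_le (by simp))
  · exact hmain.abs.add ((integrable_comp_fst_spaceTime hm).const_mul (B * C))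
  · filter_upwards [hcut n] with p hp
    refine (norm_add_le _ _).trans (add_le_add ?_ ?_)
    · rw [norm_mul, Real.norm_of_nonneg (cutoff_mem_Icc n p.2).1]
      exact mul_le_of_le_one_left (abs_nonneg _) (cutoff_mem_Icc n p.2).2
    · rw [norm_mul, norm_mul]
      have hB₀ : 0 ≤ B := (norm_nonneg _).trans (hB 0)
      have hC₀ : 0 ≤ C := (abs_nonneg _).trans (hC 0)
      exact mul_le_mul (mul_le_mul (hB p.1) (hC p) (norm_nonneg _) hB₀) hp (norm_nonneg _)
        (mul_nonneg hB₀ hC₀)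
  · refine tendsto_const_nhds.congr' ?_
    filter_upwards [eventually_cutoff_eventuallyEq_one p.2] with n hn
    rw [hn.eq_of_nhds, hn.fderiv_eq]
    simp
  · simp_rw [h.integral_cutoff_mul_eq_zero hφ hψ hψc hψs]
    exact tendsto_const_nhds

theorem integral_sub_integral_eq (h : IsTransport κ V T) {φ : ℝ × X → ℝ} (hφ : ContDiff ℝ ∞ φ)
    {C : ℝ} (hC : ∀ p, |φ p| ≤ C)
    (hder : Integrable (fun p => fderiv ℝ φ p (1, V p.1 p.2)) (spaceTime κ T))
    (hcont : ContinuousOn (fun t => ∫ x, φ (t, x) ∂κ t) (Icc 0 T)) {t : ℝ} (ht : t ∈ Icc 0 T) :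
    ∫ x, φ (t, x) ∂κ t - ∫ x, φ (0, x) ∂κ 0 =
      ∫ s in 0..t, ∫ x, fderiv ℝ φ (s, x) (1, V s x) ∂κ s := by
  have hT : 0 ≤ T := ht.1.trans ht.2
  refine sub_eq_integral_of_weak_deriv hcont (intervalIntegrable_of_integrable_spaceTime hT hder)
    (fun ψ hψ hψc hψs => ?_) ht
  have hψi := h.integral_deriv_mul_add_mul_fderiv_eq_zero hφ hC hder hψ hψc hψs
  have hφi : Integrable φ (spaceTime κ T) :=
    .of_bound hφ.continuous.aestronglyMeasurable C (ae_of_all _ hC)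
  have h₁ := integrable_comp_fst_mul (hψ.continuous_deriv (by simp)) hψc.deriv hφi
  have h₂ := integrable_comp_fst_mul hψ.continuous hψc hder
  rw [integral_add h₁ h₂, integral_spaceTime hT h₁, integral_spaceTime hT h₂,
    ← intervalIntegral.integral_add (intervalIntegrable_of_integrable_spaceTime hT h₁)
      (intervalIntegrable_of_integrable_spaceTime hT h₂)] at hψi
  simpa only [integral_const_mul] using hψi

end IsTransport

end Transport

section Mollify

open scoped Convolution

variable {Y : Type*} [NormedAddCommGroup Y] [NormedSpace ℝ Y] [FiniteDimensional ℝ Y]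
  [MeasurableSpace Y] [BorelSpace Y]

/-- The mollification of `u` by the normalized bump function `χ`. -/
def mollify (χ : ContDiffBump (0 : Y)) (u : Y → ℝ) : Y → ℝ :=
  χ.normed Measure.addHaar ⋆[ContinuousLinearMap.lsmul ℝ ℝ, Measure.addHaar] u

variable (χ : ContDiffBump (0 : Y)) {u : Y → ℝ}

theorem contDiff_mollify (hu : Continuous u) : ContDiff ℝ ∞ (mollify χ u) :=
  χ.hasCompactSupport_normed.contDiff_convolution_left _ χ.contDiff_normed hu.locallyIntegrable

theorem abs_mollify_le (hu : Continuous u) {C : ℝ} (hC : ∀ q, |u q| ≤ C) (p : Y) :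
    |mollify χ u p| ≤ C := by
  rw [← sub_zero (mollify χ u p), ← Real.dist_eq]
  exact dist_convolution_le ((abs_nonneg _).trans (hC 0)) χ.support_normed_eq.subset
    χ.nonneg_normed χ.integral_normed hu.aestronglyMeasurable
    fun q _ => by simpa [Real.dist_eq] using hC q

theorem abs_mollify_sub_le (hu : Continuous u) {p : Y} {B : ℝ}
    (hB : ∀ q ∈ Metric.ball p χ.rOut, |u q - u p| ≤ B) : |mollify χ u p - u p| ≤ B :=
  χ.dist_normed_convolution_le hu.aestronglyMeasurable hB

theorem abs_mollify_sub_mollify_le (hu : Continuous u) {p p' : Y} {B : ℝ}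
    (hB : ∀ q ∈ Metric.ball 0 χ.rOut, |u (p - q) - u (p' - q)| ≤ B) :
    |mollify χ u p - mollify χ u p'| ≤ B := by
  have hint (p : Y) : Integrable (fun q => χ.normed Measure.addHaar q • u (p - q))
      Measure.addHaar :=
    (χ.continuous_normed.smul (hu.comp (continuous_sub_left p))).integrable_of_hasCompactSupport
      χ.hasCompactSupport_normed.smul_right
  have hsub : mollify χ u p - mollify χ u p' =
      ∫ q, χ.normed Measure.addHaar q • (u (p - q) - u (p' - q)) ∂Measure.addHaar := by
    simp_rw [smul_sub]
    exact (integral_sub (hint p) (hint p')).symm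
  rw [hsub, ← Real.norm_eq_abs, ← mul_one B, ← χ.integral_normed (μ := Measure.addHaar),
    ← integral_const_mul]
  refine norm_integral_le_of_norm_le (χ.integrable_normed.const_mul B) (ae_of_all _ fun q => ?_)
  rw [norm_smul, Real.norm_of_nonneg (χ.nonneg_normed q), mul_comm]
  by_cases hq : q ∈ Metric.ball 0 χ.rOut
  · exact mul_le_mul_of_nonneg_right (hB q hq) (χ.nonneg_normed q)
  · rw [← χ.support_normed_eq (μ := Measure.addHaar), Function.notMem_support] at hq
    simp [hq]

end Mollify

section Representation

variable {X : Type*} [NormedAddCommGroup X] [NormedSpace ℝ X] {v : ℝ → X → X} {M L K : ℝ≥0}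
  {φ : X → ℝ} {t : ℝ}

/-- The solution of the transport equation `∂_s u + ∇u · v_s = 0` which is `φ` at time `t`. -/
def pullback (v : ℝ → X → X) (φ : X → ℝ) (t : ℝ) (p : ℝ × X) : ℝ :=
  φ (flow v p.1 p.2 t)

variable [CompleteSpace X]

namespace IsRegularField

theorem pullback_flow (hv : IsRegularField v M L) (φ : X → ℝ) (t s r : ℝ) (x : X) :
    pullback v φ t (r, flow v s x r) = pullback v φ t (s, x) :=
  congrArg (fun α : ℝ → X => φ (α t)) (hv.flow_flow r s x)

theorem abs_pullback_sub_le (hv : IsRegularField v M L) (hφ : LipschitzWith K φ) {s' R : ℝ}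
    (hs' : |t - s'| ≤ R) (s : ℝ) (x x' : X) :
    |pullback v φ t (s, x) - pullback v φ t (s', x')| ≤
      K * Real.exp (L * R) * (M * |s - s'| + ‖x - x'‖) := by
  have hflow : dist (flow v s x s') x' ≤ M * |s - s'| + ‖x - x'‖ := by
    refine (dist_triangle _ x _).trans (add_le_add ?_ (dist_eq_norm x x').le)
    have := hv.norm_flow_sub_flow_le s x s' s
    rwa [hv.flow_self, abs_sub_comm, ← dist_eq_norm] at this
  calc |pullback v φ t (s, x) - pullback v φ t (s', x')|
      ≤ K * dist (flow v s' (flow v s x s') t) (flow v s' x' t) := by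
        rw [← hv.pullback_flow φ t s s' x]; exact hφ.dist_le_mul _ _
    _ ≤ K * (dist (flow v s x s') x' * Real.exp (L * |t - s'|)) := by
        gcongr; exact hv.dist_flow_le _ _ _ _
    _ ≤ K * ((M * |s - s'| + ‖x - x'‖) * Real.exp (L * R)) := by gcongr
    _ = _ := by ring

theorem continuous_pullback (hv : IsRegularField v M L) (hφ : LipschitzWith K φ) (t : ℝ) :
    Continuous (pullback v φ t) := by
  refine continuous_iff_continuousAt.2 fun p => ?_
  refine tendsto_iff_dist_tendsto_zero.2 (squeeze_zero (fun _ => dist_nonneg)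
    (fun q => hv.abs_pullback_sub_le hφ le_rfl q.1 q.2 p.2) ?_)
  refine (Continuous.tendsto' (by fun_prop) p _ ?_)
  simp

theorem norm_flow_sub_add_smul_le (hv : IsRegularField v M L) {s h δ : ℝ} {x w : X}
    (hδ : ∀ r ∈ uIcc s (s + h), ‖v r (flow v s x r) - w‖ ≤ δ) :
    ‖flow v s x (s + h) - (x + h • w)‖ ≤ δ * |h| := by
  have hderiv (r : ℝ) : HasDerivAt (fun r => flow v s x r - (r - s) • w)
      (v r (flow v s x r) - w) r := by
    have hlin : HasDerivAt (fun r => (r - s) • w) w r := by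
      simpa using ((hasDerivAt_id r).sub_const s).smul_const w
    exact (hv.isIntegralCurve_flow s x r).sub hlin
  have := (convex_uIcc s (s + h)).norm_image_sub_le_of_norm_hasDerivWithin_le
    (fun r _ => (hderiv r).hasDerivWithinAt) hδ left_mem_uIcc right_mem_uIcc
  simp only [hv.flow_self, add_sub_cancel_left, sub_self, zero_smul, sub_zero,
    Real.norm_eq_abs] at this
  rwa [sub_add_eq_sub_sub_swap]

theorem dist_prodMk_flow_le (hv : IsRegularField v M L) (s : ℝ) (x : X) (r : ℝ) :
    dist (r, flow v s x r) (s, x) ≤ (1 + M) * |r - s| := by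
  have hflow := hv.norm_flow_sub_flow_le s x r s
  rw [hv.flow_self, ← dist_eq_norm] at hflow
  have := abs_nonneg (r - s)
  have : 0 ≤ M * |r - s| := by positivity
  rw [Prod.dist_eq, Real.dist_eq]
  exact max_le (by linarith) (by linarith)

theorem abs_pullback_add_smul_sub_pullback_le (hv : IsRegularField v M L) (hφ : LipschitzWith K φ)
    {R δ ε₀ : ℝ} (hδ : ∀ p q : ℝ × X, dist p q < ε₀ → ‖v p.1 p.2 - v q.1 q.2‖ ≤ δ)
    {p q : ℝ × X} (hp : |t - p.1| ≤ R) (hq : dist q p < ε₀ / 2) (hq1 : dist q p < 1) {h : ℝ}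
    (hh1 : |h| ≤ 1) (hh : (1 + M) * |h| ≤ ε₀ / 2) :
    |pullback v φ t (q.1 + h, q.2 + h • v p.1 p.2) - pullback v φ t q| ≤
      K * Real.exp (L * (R + 2)) * δ * |h| := by
  obtain ⟨s, x⟩ := q
  have hfield : ∀ r ∈ uIcc s (s + h), ‖v r (flow v s x r) - v p.1 p.2‖ ≤ δ := fun r hr => by
    refine hδ (r, flow v s x r) p ((dist_triangle _ (s, x) _).trans_lt ?_)
    have hr : |r - s| ≤ |h| := by simpa using abs_sub_left_of_mem_uIcc hr
    have := (hv.dist_prodMk_flow_le s x r).trans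
      (mul_le_mul_of_nonneg_left hr (by positivity))
    linarith
  have hs : |s - p.1| < 1 := (le_max_left _ _).trans_lt hq1
  have hth : |t - (s + h)| ≤ R + 2 :=
    calc |t - (s + h)| = |(t - p.1) - (s - p.1) - h| := by ring_nf
      _ ≤ |t - p.1| + |s - p.1| + |h| :=
        (abs_sub _ _).trans (by gcongr; exact abs_sub _ _)
      _ ≤ R + 2 := by linarith
  rw [← hv.pullback_flow φ t s (s + h) x]
  calc _ ≤ K * Real.exp (L * (R + 2)) * (M * |s + h - (s + h)| +
        ‖x + h • v p.1 p.2 - flow v s x (s + h)‖) := hv.abs_pullback_sub_le hφ hth _ _ _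
    _ ≤ K * Real.exp (L * (R + 2)) * δ * |h| := by
        rw [sub_self, abs_zero, mul_zero, zero_add, norm_sub_rev, mul_assoc _ δ]
        gcongr
        exact hv.norm_flow_sub_add_smul_le hfield

variable [FiniteDimensional ℝ X] [MeasurableSpace X] [BorelSpace X]

theorem abs_fderiv_mollify_pullback_le (hv : IsRegularField v M L) (hφ : LipschitzWith K φ)
    {R δ ε₀ : ℝ} (hε₀ : 0 < ε₀) (hδ : ∀ p q : ℝ × X, dist p q < ε₀ → ‖v p.1 p.2 - v q.1 q.2‖ ≤ δ)
    (χ : ContDiffBump (0 : ℝ × X)) (hχ : χ.rOut ≤ ε₀ / 2) (hχ1 : χ.rOut ≤ 1) {p : ℝ × X}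
    (hp : |t - p.1| ≤ R) :
    |fderiv ℝ (mollify χ (pullback v φ t)) p (1, v p.1 p.2)| ≤
      K * Real.exp (L * (R + 2)) * δ := by
  have hu := hv.continuous_pullback hφ t
  have hδ₀ : 0 ≤ δ := (norm_nonneg _).trans (hδ p p (by simpa using hε₀))
  have hline : HasDerivAt (fun h : ℝ => mollify χ (pullback v φ t) (p + h • (1, v p.1 p.2)))
      (fderiv ℝ (mollify χ (pullback v φ t)) p (1, v p.1 p.2)) 0 := by
    have := ((contDiff_mollify χ hu).differentiable (by simp) p).hasFDerivAt
    exact this.hasLineDerivAt _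
  refine hline.le_of_lip' (by positivity) ?_
  obtain ⟨ε₁, hε₁, hM⟩ : ∃ ε₁ > 0, (1 + M) * ε₁ ≤ ε₀ / 2 :=
    ⟨ε₀ / 2 / (1 + M), by positivity, by field_simp; rfl⟩
  filter_upwards [Metric.ball_mem_nhds (0 : ℝ) (lt_min hε₁ one_pos)] with h hh
  rw [mem_ball_zero_iff, lt_min_iff, Real.norm_eq_abs] at hh
  simp only [zero_smul, add_zero, sub_zero, Real.norm_eq_abs]
  refine abs_mollify_sub_mollify_le χ hu fun q hq => ?_
  have hq' : dist (p - q) p < χ.rOut := by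
    rwa [dist_eq_norm, sub_sub_cancel_left, norm_neg, ← mem_ball_zero_iff]
  have hphq : p + h • (1, v p.1 p.2) - q =
      ((p - q).1 + h, (p - q).2 + h • v p.1 p.2) := by
    ext <;> simp <;> abel
  rw [hphq]
  exact hv.abs_pullback_add_smul_sub_pullback_le hφ hδ hp (hq'.trans_le hχ) (hq'.trans_le hχ1)
    hh.2.le ((mul_le_mul_of_nonneg_left hh.1.le (by positivity)).trans hM)

theorem abs_mollify_pullback_sub_le (hv : IsRegularField v M L) (hφ : LipschitzWith K φ)
    {R : ℝ} (χ : ContDiffBump (0 : ℝ × X)) {p : ℝ × X} (hp : |t - p.1| ≤ R) :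
    |mollify χ (pullback v φ t) p - pullback v φ t p| ≤
      K * Real.exp (L * R) * ((M + 1) * χ.rOut) := by
  refine abs_mollify_sub_le χ (hv.continuous_pullback hφ t) fun q hq => ?_
  refine (hv.abs_pullback_sub_le hφ hp q.1 q.2 p.2).trans ?_
  obtain ⟨hq₁, hq₂⟩ := max_lt_iff.1 (Metric.mem_ball.1 hq)
  rw [Real.dist_eq] at hq₁
  rw [dist_eq_norm] at hq₂
  rw [add_one_mul]
  gcongr

theorem abs_mollify_pullback_sub_mollify_pullback_le (hv : IsRegularField v M L)
    (hφ : LipschitzWith K φ) {R : ℝ} (χ : ContDiffBump (0 : ℝ × X)) (hχ : χ.rOut ≤ 1) (s : ℝ)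
    {s' : ℝ} (hs' : |t - s'| ≤ R) (x : X) :
    |mollify χ (pullback v φ t) (s, x) - mollify χ (pullback v φ t) (s', x)| ≤
      K * Real.exp (L * (R + 1)) * M * |s - s'| := by
  refine abs_mollify_sub_mollify_le χ (hv.continuous_pullback hφ t) fun q hq => ?_
  have hq₁ : |q.1| < χ.rOut := (le_max_left _ _).trans_lt (mem_ball_zero_iff.1 hq)
  have hR : |t - (s' - q.1)| ≤ R + 1 := by
    rw [sub_sub_eq_add_sub, add_sub_right_comm]
    exact (abs_add_le _ _).trans (by linarith)
  refine (hv.abs_pullback_sub_le hφ hR (s - q.1) (x - q.2) (x - q.2)).trans ?_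
  simp [mul_assoc]

end IsRegularField

variable [FiniteDimensional ℝ X] [MeasurableSpace X] [BorelSpace X] {κ : Kernel ℝ X}
  [IsMarkovKernel κ] {T : ℝ}

namespace IsTransport

theorem abs_integral_mollify_pullback_sub_le (h : IsTransport κ v T) (hv : IsRegularField v M L)
    (hφ : LipschitzWith K φ) {C : ℝ} (hC : ∀ x, |φ x| ≤ C) (ht : t ∈ Icc 0 T) {δ ε₀ : ℝ}
    (hε₀ : 0 < ε₀) (hδ : ∀ p q : ℝ × X, dist p q < ε₀ → ‖v p.1 p.2 - v q.1 q.2‖ ≤ δ)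
    (χ : ContDiffBump (0 : ℝ × X)) (hχ : χ.rOut ≤ ε₀ / 2) (hχ1 : χ.rOut ≤ 1) :
    |∫ x, mollify χ (pullback v φ t) (t, x) ∂κ t - ∫ x, mollify χ (pullback v φ t) (0, x) ∂κ 0| ≤
      K * Real.exp (L * (T + 2)) * δ * T := by
  have hdist {s : ℝ} (hs : s ∈ Icc 0 T) : |t - s| ≤ T :=
    abs_le.2 ⟨by linarith [ht.1, hs.2], by linarith [ht.2, hs.1]⟩
  have hu := hv.continuous_pullback hφ t
  have hsmooth := contDiff_mollify χ hu
  have hbound := abs_mollify_le χ hu (C := C) fun q => hC _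
  have hle {s : ℝ} (hs : s ∈ Icc 0 T) (x : X) :
      ‖fderiv ℝ (mollify χ (pullback v φ t)) (s, x) (1, v s x)‖ ≤
        K * Real.exp (L * (T + 2)) * δ :=
    hv.abs_fderiv_mollify_pullback_le hφ hε₀ hδ χ hχ hχ1 (hdist hs)
  have hder : Integrable (fun p => fderiv ℝ (mollify χ (pullback v φ t)) p (1, v p.1 p.2))
      (spaceTime κ T) := by
    refine .of_bound ?_ (K * Real.exp (L * (T + 2)) * δ) ?_
    · exact ((hsmooth.continuous_fderiv (by simp)).clm_apply
        (continuous_const.prodMk hv.uniformContinuous.continuous)).aestronglyMeasurable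
    · have hmem : ∀ᵐ p ∂spaceTime κ T, p.1 ∈ Ioc 0 T := ae_fst_mem_Ioc
      filter_upwards [hmem] with p hp
      exact hle (Ioc_subset_Icc_self hp) p.2
  rw [h.integral_sub_integral_eq hsmooth hbound hder
    (h.continuousOn_integral_of_lipschitz_left (fun s => hsmooth.continuous.comp
      (Continuous.prodMk_right s)) (fun s x => hbound (s, x)) fun s _ s' hs' x =>
        hv.abs_mollify_pullback_sub_mollify_pullback_le hφ χ hχ1 s (hdist hs') x) ht]
  have hint : ∀ s ∈ uIoc 0 t, ‖∫ x, fderiv ℝ (mollify χ (pullback v φ t)) (s, x) (1, v s x) ∂κ s‖ ≤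
      K * Real.exp (L * (T + 2)) * δ := fun s hs => by
    rw [uIoc_of_le ht.1] at hs
    simpa using norm_integral_le_of_norm_le_const (μ := κ s)
      (ae_of_all _ (hle ⟨hs.1.le, hs.2.trans ht.2⟩))
  have hδ₀ : 0 ≤ δ := (norm_nonneg _).trans (hδ 0 0 (by simpa using hε₀))
  refine (intervalIntegral.norm_integral_le_of_norm_le_const hint).trans ?_
  rw [sub_zero, abs_of_nonneg ht.1]
  exact mul_le_mul_of_nonneg_left ht.2 (by positivity)

theorem abs_integral_sub_integral_flow_le (h : IsTransport κ v T) (hv : IsRegularField v M L)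
    (hφ : LipschitzWith K φ) {C : ℝ} (hC : ∀ x, |φ x| ≤ C) (ht : t ∈ Icc 0 T) {δ ε₀ : ℝ}
    (hε₀ : 0 < ε₀) (hδ : ∀ p q : ℝ × X, dist p q < ε₀ → ‖v p.1 p.2 - v q.1 q.2‖ ≤ δ)
    (χ : ContDiffBump (0 : ℝ × X)) (hχ : χ.rOut ≤ ε₀ / 2) (hχ1 : χ.rOut ≤ 1) :
    |∫ x, φ x ∂κ t - ∫ x, φ (flow v 0 x t) ∂κ 0| ≤
      K * Real.exp (L * (T + 2)) * δ * T +
        2 * (K * Real.exp (L * T) * ((M + 1) * χ.rOut)) := by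
  have hu := hv.continuous_pullback hφ t
  have hclose {s : ℝ} (hs : |t - s| ≤ T) :
      |∫ x, mollify χ (pullback v φ t) (s, x) ∂κ s - ∫ x, pullback v φ t (s, x) ∂κ s| ≤
        K * Real.exp (L * T) * ((M + 1) * χ.rOut) := by
    have hint {g : ℝ × X → ℝ} (hg : Continuous g) (hgC : ∀ p, |g p| ≤ C) :
        Integrable (fun x => g (s, x)) (κ s) :=
      .of_bound (hg.comp (Continuous.prodMk_right s)).aestronglyMeasurable C
        (ae_of_all _ fun x => hgC _)
    rw [← integral_sub (hint (contDiff_mollify χ hu).continuous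
      (abs_mollify_le χ hu fun q => hC _)) (hint hu fun q => hC _), ← Real.norm_eq_abs]
    simpa using norm_integral_le_of_norm_le_const (μ := κ s)
      (f := fun x => mollify χ (pullback v φ t) (s, x) - pullback v φ t (s, x))
      (ae_of_all _ fun x => hv.abs_mollify_pullback_sub_le hφ χ (p := (s, x)) hs)
  have h₀ := hclose (s := 0) (by rw [sub_zero, abs_of_nonneg ht.1]; exact ht.2)
  have h₁ := hclose (s := t) (by rw [sub_self, abs_zero]; exact ht.1.trans ht.2)
  have h₂ := h.abs_integral_mollify_pullback_sub_le hv hφ hC ht hε₀ hδ χ hχ hχ1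
  simp only [pullback, hv.flow_self] at h₀ h₁ h₂ ⊢
  rw [abs_le] at *
  constructor <;> linarith [h₀.1, h₀.2, h₁.1, h₁.2, h₂.1, h₂.2]

theorem integral_eq_integral_flow (h : IsTransport κ v T) (hv : IsRegularField v M L)
    (hφ : LipschitzWith K φ) {C : ℝ} (hC : ∀ x, |φ x| ≤ C) (ht : t ∈ Icc 0 T) :
    ∫ x, φ x ∂κ t = ∫ x, φ (flow v 0 x t) ∂κ 0 := by
  obtain ⟨B, hB₀, hB⟩ : ∃ B > 0, ∀ δ > 0,
      |∫ x, φ x ∂κ t - ∫ x, φ (flow v 0 x t) ∂κ 0| ≤ B * δ := by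
    refine ⟨K * Real.exp (L * (T + 2)) * T + 2 * (K * Real.exp (L * T) * (M + 1)) + 1, ?_,
      fun δ hδ => ?_⟩
    · have := ht.1.trans ht.2
      positivity
    obtain ⟨ε₀, hε₀, hδv⟩ := Metric.uniformContinuous_iff.1 hv.uniformContinuous δ hδ
    set ε := min (ε₀ / 2) (min 1 δ)
    have hε : 0 < ε := by positivity
    let χ : ContDiffBump (0 : ℝ × X) := ⟨ε / 2, ε, half_pos hε, half_lt_self hε⟩
    have hχ : χ.rOut ≤ δ := (min_le_right _ _).trans (min_le_right _ _)
    refine (h.abs_integral_sub_integral_flow_le hv hφ hC ht hε₀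
      (fun p q hpq => ((dist_eq_norm _ _).symm.trans_lt (hδv hpq)).le) χ (min_le_left _ _)
      ((min_le_right _ _).trans (min_le_left _ _))).trans ?_
    calc _ ≤ K * Real.exp (L * (T + 2)) * δ * T +
          2 * (K * Real.exp (L * T) * ((M + 1) * δ)) + δ := by
          refine le_add_of_le_of_nonneg ?_ hδ.le
          gcongr
      _ = _ := by ring
  refine eq_of_forall_dist_le fun ε hε => (hB (ε / B) (by positivity)).trans_eq ?_
  field_simp

theorem eq_map_flow (h : IsTransport κ v T) (hv : IsRegularField v M L) (ht : t ∈ Icc 0 T) :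
    κ t = (κ 0).map fun x => flow v 0 x t := by
  have hflow : Measurable fun x => flow v 0 x t := (hv.lipschitzWith_flow 0 t).continuous.measurable
  let μ : ProbabilityMeasure X := ⟨κ t, inferInstance⟩
  let ν : ProbabilityMeasure X :=
    ⟨(κ 0).map fun x => flow v 0 x t, Measure.isProbabilityMeasure_map hflow.aemeasurable⟩
  suffices hlim : Tendsto (fun _ : ℕ => μ) atTop (𝓝 ν) by
    have hμν : μ = ν := tendsto_nhds_unique tendsto_const_nhds hlim
    exact congrArg ProbabilityMeasure.toMeasure hμν
  refine tendsto_iff_forall_lipschitz_integral_tendsto.2 fun φ ⟨C, hC⟩ ⟨K, hK⟩ => ?_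
  have hφ (x : X) : |φ x| ≤ C + |φ 0| := by
    have := hC x 0
    rw [Real.dist_eq] at this
    linarith [abs_sub_abs_le_abs_sub (φ x) (φ 0)]
  change Tendsto (fun _ => ∫ x, φ x ∂κ t) _ (𝓝 (∫ x, φ x ∂(κ 0).map fun x => flow v 0 x t))
  rw [h.integral_eq_integral_flow hv hK hφ ht,
    integral_map hflow.aemeasurable hK.continuous.aestronglyMeasurable]
  exact tendsto_const_nhds

end IsTransport

end Representation

/-! ### Gaussian averages of ridge functions -/

theorem lpNorm_mul_le {α : Type*} [MeasurableSpace α] {μ : Measure α} {p q r : ℝ≥0∞}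
    [ENNReal.HolderTriple p q r] {f g : α → ℝ} (hf : MemLp f p μ) (hg : MemLp g q μ) :
    lpNorm (fun x => f x * g x) r μ ≤ lpNorm f p μ * lpNorm g q μ := by
  have h : eLpNorm (f • g) r μ ≤ eLpNorm f p μ * eLpNorm g q μ :=
    eLpNorm_smul_le_mul_eLpNorm hg.1 hf.1
  rw [← toReal_eLpNorm hf.1, ← toReal_eLpNorm hg.1, ← ENNReal.toReal_mul,
    ← toReal_eLpNorm (f := fun x => f x * g x) (hf.1.mul hg.1)]
  exact ENNReal.toReal_mono (ENNReal.mul_ne_top hf.eLpNorm_ne_top hg.eLpNorm_ne_top) h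

theorem abs_integral_mul_le_lpNorm_mul_lpNorm {α : Type*} [MeasurableSpace α] {μ : Measure α}
    {b c g : α → ℝ} (hb : MemLp b 2 μ) (hg : MemLp g 2 μ) (hc : ∀ x, |c x| ≤ b x) :
    |∫ x, c x * g x ∂μ| ≤ lpNorm b 2 μ * lpNorm g 2 μ := by
  have hbg : Integrable (fun x => b x * g x) μ := hb.integrable_mul hg
  calc |∫ x, c x * g x ∂μ| ≤ ∫ x, ‖b x * g x‖ ∂μ := by
        rw [← Real.norm_eq_abs]
        refine norm_integral_le_of_norm_le hbg.norm (.of_forall fun x => ?_)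
        rw [norm_mul, norm_mul]
        gcongr
        exact (hc x).trans (le_abs_self _)
    _ = lpNorm (fun x => b x * g x) 1 μ := (lpNorm_one_eq_integral_norm hbg.1).symm
    _ ≤ lpNorm b 2 μ * lpNorm g 2 μ := lpNorm_mul_le hb hg

theorem norm_integral_smul_smul_id_le {E : Type*} [NormedAddCommGroup E] [InnerProductSpace ℝ E]
    [CompleteSpace E] [MeasurableSpace E] {μ : Measure E} {c g : E → ℝ} {C : ℝ} (hC : 0 ≤ C)
    (hc : Integrable (fun x => c x • g x • x) μ)
    (h : ∀ v : E, |∫ x, c x * inner ℝ v x * g x ∂μ| ≤ C * ‖v‖) :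
    ‖∫ x, c x • g x • x ∂μ‖ ≤ C := by
  rw [← innerSL_apply_norm ℝ]
  refine ContinuousLinearMap.opNorm_le_bound _ hC fun v => ?_
  rw [innerSL_apply_apply, real_inner_comm, ← integral_inner hc, Real.norm_eq_abs]
  refine le_of_eq_of_le (congrArg _ (integral_congr_ae (.of_forall fun x => ?_))) (h v)
  simp only [inner_smul_right]
  ring

section Gaussian

variable {E : Type*} [NormedAddCommGroup E] [InnerProductSpace ℝ E] [FiniteDimensional ℝ E]
  [MeasurableSpace E] [BorelSpace E]

theorem map_inner_stdGaussian (u : E) :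
    (stdGaussian E).map (fun x => inner ℝ u x) = (gaussianReal 0 1).map (fun y => ‖u‖ * y) := by
  have h := IsGaussian.map_eq_gaussianReal (μ := stdGaussian E) (innerSL ℝ u)
  rw [integral_strongDual_stdGaussian, variance_dual_stdGaussian, innerSL_apply_norm] at h
  rw [gaussianReal_map_const_mul, mul_zero]
  refine h.trans (congrArg _ ?_)
  ext
  simp [Real.coe_toNNReal _ (sq_nonneg ‖u‖)]

theorem memLp_inner_stdGaussian (u : E) {q : ℝ≥0∞} (hq : q ≠ ⊤) :
    MemLp (fun x => inner ℝ u x) q (stdGaussian E) :=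
  IsGaussian.memLp_dual _ (innerSL ℝ u) q hq

theorem lpNorm_inner_stdGaussian (u : E) (q : ℝ≥0∞) :
    lpNorm (fun x => inner ℝ u x) q (stdGaussian E) = ‖u‖ * lpNorm id q (gaussianReal 0 1) := by
  have h : eLpNorm (fun x => inner ℝ u x) q (stdGaussian E)
      = eLpNorm (‖u‖ • (id : ℝ → ℝ)) q (gaussianReal 0 1) := by
    rw [show (fun x => inner ℝ u x) = id ∘ fun x => inner ℝ u x from rfl,
      ← eLpNorm_map_measure (by fun_prop) (by fun_prop), map_inner_stdGaussian,
      eLpNorm_map_measure (by fun_prop) (by fun_prop)]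
    rfl
  rw [← toReal_eLpNorm (by fun_prop), h, toReal_eLpNorm (by fun_prop), lpNorm_const_smul]
  simp

theorem lpNorm_two_id_gaussianReal : lpNorm id 2 (gaussianReal 0 1) = 1 := by
  have h := variance_id_gaussianReal (μ := 0) (v := 1)
  rw [variance_eq_integral (by fun_prop)] at h
  rw [lpNorm_eq_integral_norm_rpow_toReal (by simp) (by simp) (by fun_prop)]
  simp only [id_eq, integral_id_gaussianReal, sub_zero] at h
  simp [h]

/-- `√(E[y⁴])` for a standard normal variable `y`. -/
def sqrtFourthMoment : ℝ := lpNorm id 4 (gaussianReal 0 1) ^ 2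

theorem sqrtFourthMoment_nonneg : 0 ≤ sqrtFourthMoment := sq_nonneg _

instance : ENNReal.HolderTriple 4 4 2 := ⟨by
  rw [show (4 : ℝ≥0∞) = 2 * 2 by norm_num, ENNReal.mul_inv (by simp) (by simp), ← mul_add,
    ENNReal.inv_two_add_inv_two, mul_one]⟩

theorem memLp_inner_mul_inner_stdGaussian (u v : E) :
    MemLp (fun x => inner ℝ u x * inner ℝ v x) 2 (stdGaussian E) :=
  MemLp.mul' (memLp_inner_stdGaussian v (q := 4) (by simp))
    (memLp_inner_stdGaussian u (q := 4) (by simp))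

theorem lpNorm_inner_mul_inner_stdGaussian_le (u v : E) :
    lpNorm (fun x => inner ℝ u x * inner ℝ v x) 2 (stdGaussian E)
      ≤ sqrtFourthMoment * (‖u‖ * ‖v‖) := by
  refine (lpNorm_mul_le (p := 4) (q := 4) (memLp_inner_stdGaussian u (by simp))
    (memLp_inner_stdGaussian v (by simp))).trans_eq ?_
  rw [lpNorm_inner_stdGaussian, lpNorm_inner_stdGaussian, sqrtFourthMoment]
  ring

/-- The Gaussian average `E_x[s(wᵀx) G(x)]`, as a function of `w`. -/
def ridge {F : Type*} [NormedAddCommGroup F] [NormedSpace ℝ F] (s : ℝ → ℝ) (G : E → F) (w : E) :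
    F :=
  ∫ x, s (inner ℝ w x) • G x ∂stdGaussian E

theorem integrable_ridge {F : Type*} [NormedAddCommGroup F] [NormedSpace ℝ F] {s : ℝ → ℝ} {K : ℝ}
    (hs : Continuous s) (hK : ∀ r, |s r| ≤ K) {G : E → F} (hG : Integrable G (stdGaussian E))
    (w : E) : Integrable (fun x => s (inner ℝ w x) • G x) (stdGaussian E) :=
  hG.bdd_smul K (hs.comp (by fun_prop)).aestronglyMeasurable (.of_forall fun _ => hK _)

variable {s : ℝ → ℝ} {K : ℝ} {L : ℝ≥0} {g g' : E → ℝ}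

theorem integrable_norm_mul_norm_stdGaussian (hg : MemLp g 2 (stdGaussian E)) :
    Integrable (fun x => ‖x‖ * ‖g x‖) (stdGaussian E) :=
  (IsGaussian.memLp_id (stdGaussian E) 2 (by simp)).norm.integrable_mul hg.norm

theorem integrable_smul_id_stdGaussian (hg : MemLp g 2 (stdGaussian E)) :
    Integrable (fun x => g x • x) (stdGaussian E) := by
  refine (integrable_norm_mul_norm_stdGaussian hg).mono' (hg.1.smul (by fun_prop))
    (.of_forall fun x => ?_)
  rw [norm_smul, mul_comm]

theorem ridge_sub (hs : Continuous s) (hK : ∀ r, |s r| ≤ K) (hg : MemLp g 2 (stdGaussian E))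
    (hg' : MemLp g' 2 (stdGaussian E)) (w : E) :
    ridge s g w - ridge s g' w = ridge s (g - g') w := by
  simp only [ridge, Pi.sub_apply, smul_sub]
  exact (integral_sub (integrable_ridge hs hK (hg.integrable one_le_two) w)
    (integrable_ridge hs hK (hg'.integrable one_le_two) w)).symm

theorem ridge_smul_id_sub (hs : Continuous s) (hK : ∀ r, |s r| ≤ K)
    (hg : MemLp g 2 (stdGaussian E)) (hg' : MemLp g' 2 (stdGaussian E)) (w : E) :
    ridge s (fun x => g x • x) w - ridge s (fun x => g' x • x) w
      = ridge s (fun x => (g - g') x • x) w := by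
  simp only [ridge, Pi.sub_apply, sub_smul, smul_sub]
  exact (integral_sub (integrable_ridge hs hK (integrable_smul_id_stdGaussian hg) w)
    (integrable_ridge hs hK (integrable_smul_id_stdGaussian hg') w)).symm

theorem abs_ridge_le (hK : ∀ r, |s r| ≤ K) (hg : MemLp g 2 (stdGaussian E)) (w : E) :
    |ridge s g w| ≤ K * lpNorm g 2 (stdGaussian E) := by
  have hK₀ : 0 ≤ K := (abs_nonneg _).trans (hK 0)
  refine (abs_integral_mul_le_lpNorm_mul_lpNorm (memLp_const K) hg fun x => hK _).trans_eq ?_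
  rw [lpNorm_const' (by simp) (by simp)]
  simp [abs_of_nonneg hK₀]

theorem abs_ridge_sub_ridge_le (hs : Continuous s) (hK : ∀ r, |s r| ≤ K) (hL : LipschitzWith L s)
    (hg : MemLp g 2 (stdGaussian E)) (w w' : E) :
    |ridge s g w - ridge s g w'| ≤ L * lpNorm g 2 (stdGaussian E) * ‖w - w'‖ := by
  have hsub : ridge s g w - ridge s g w'
      = ∫ x, (s (inner ℝ w x) - s (inner ℝ w' x)) * g x ∂stdGaussian E := by
    simp only [sub_mul]
    exact (integral_sub (integrable_ridge hs hK (hg.integrable one_le_two) w)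
      (integrable_ridge hs hK (hg.integrable one_le_two) w')).symm
  have hb := ((memLp_inner_stdGaussian (w - w') (q := 2) (by simp)).norm).const_smul (L : ℝ)
  rw [hsub]
  refine (abs_integral_mul_le_lpNorm_mul_lpNorm hb hg fun x => ?_).trans_eq ?_
  · simpa [inner_sub_left, Real.dist_eq] using hL.dist_le_mul (inner ℝ w x) (inner ℝ w' x)
  · rw [lpNorm_const_smul, lpNorm_norm (by fun_prop), lpNorm_inner_stdGaussian,
      lpNorm_two_id_gaussianReal]
    simp only [Real.norm_eq_abs, NNReal.abs_eq, coe_nnnorm]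
    ring

theorem norm_ridge_smul_id_le (hs : Continuous s) (hK : ∀ r, |s r| ≤ K)
    (hg : MemLp g 2 (stdGaussian E)) (w : E) :
    ‖ridge s (fun x => g x • x) w‖ ≤ K * lpNorm g 2 (stdGaussian E) := by
  have hK₀ : 0 ≤ K := (abs_nonneg _).trans (hK 0)
  have hint := integrable_ridge hs hK (integrable_smul_id_stdGaussian hg) w
  refine norm_integral_smul_smul_id_le (mul_nonneg hK₀ lpNorm_nonneg) hint fun v => ?_
  have hb := ((memLp_inner_stdGaussian v (q := 2) (by simp)).norm).const_smul K
  refine (abs_integral_mul_le_lpNorm_mul_lpNorm hb hg fun x => ?_).trans_eq ?_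
  · rw [abs_mul]
    exact mul_le_mul_of_nonneg_right (hK _) (abs_nonneg _)
  · rw [lpNorm_const_smul, lpNorm_norm (by fun_prop), lpNorm_inner_stdGaussian,
      lpNorm_two_id_gaussianReal]
    simp only [coe_nnnorm, Real.norm_eq_abs, abs_of_nonneg hK₀]
    ring

theorem norm_ridge_smul_id_sub_ridge_smul_id_le (hs : Continuous s) (hK : ∀ r, |s r| ≤ K)
    (hL : LipschitzWith L s) (hg : MemLp g 2 (stdGaussian E)) (w w' : E) :
    ‖ridge s (fun x => g x • x) w - ridge s (fun x => g x • x) w'‖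
      ≤ L * sqrtFourthMoment * lpNorm g 2 (stdGaussian E) * ‖w - w'‖ := by
  have hint := fun w => integrable_ridge hs hK (integrable_smul_id_stdGaussian hg) w
  have hsub : ridge s (fun x => g x • x) w - ridge s (fun x => g x • x) w'
      = ∫ x, (s (inner ℝ w x) - s (inner ℝ w' x)) • g x • x ∂stdGaussian E := by
    rw [ridge, ridge, ← integral_sub (hint w) (hint w')]
    simp only [sub_smul]
  have hint' : Integrable (fun x => (s (inner ℝ w x) - s (inner ℝ w' x)) • g x • x)
      (stdGaussian E) := by
    simp_rw [sub_smul]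
    exact (hint w).sub (hint w')
  have hm := sqrtFourthMoment_nonneg
  rw [hsub]
  refine norm_integral_smul_smul_id_le
    (mul_nonneg (mul_nonneg (by positivity) lpNorm_nonneg) (norm_nonneg _)) hint' fun v => ?_
  have hb := ((memLp_inner_mul_inner_stdGaussian (w - w') v).norm).const_smul (L : ℝ)
  refine (abs_integral_mul_le_lpNorm_mul_lpNorm hb hg fun x => ?_).trans ?_
  · rw [abs_mul]
    have := hL.dist_le_mul (inner ℝ w x) (inner ℝ w' x)
    rw [Real.dist_eq, Real.dist_eq, ← inner_sub_left] at this
    simpa [mul_assoc] using mul_le_mul_of_nonneg_right this (abs_nonneg (inner ℝ v x))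
  · rw [lpNorm_const_smul, lpNorm_norm (by fun_prop)]
    simp only [coe_nnnorm, Real.norm_eq_abs, NNReal.abs_eq]
    calc L * lpNorm (fun x => inner ℝ (w - w') x * inner ℝ v x) 2 (stdGaussian E)
          * lpNorm g 2 (stdGaussian E)
        ≤ L * (sqrtFourthMoment * (‖w - w'‖ * ‖v‖)) * lpNorm g 2 (stdGaussian E) := by
          gcongr
          · exact lpNorm_nonneg
          · exact lpNorm_inner_mul_inner_stdGaussian_le _ _
      _ = _ := by ring

theorem hasGradientAt_ridge {K' : ℝ} (hs : ContDiff ℝ 1 s) (hK : ∀ r, |s r| ≤ K)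
    (hK' : ∀ r, |deriv s r| ≤ K') (hg : MemLp g 2 (stdGaussian E)) (w : E) :
    HasGradientAt (ridge s g) (ridge (deriv s) (fun x => g x • x) w) w := by
  have hs' := hs.continuous_deriv le_rfl
  have hder : ∀ x v, HasFDerivAt (fun v => s (inner ℝ v x) • g x)
      (innerSL ℝ (deriv s (inner ℝ v x) • g x • x)) v := fun x v => by
    have hinner : HasFDerivAt (fun v : E => inner ℝ v x) (innerSL ℝ x) v := by
      simp_rw [real_inner_comm x]
      exact (innerSL ℝ x).hasFDerivAt
    refine (((hs.differentiable one_ne_zero _).hasDerivAt.comp_hasFDerivAt v hinner).smul_const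
      (g x)).congr_fderiv ?_
    ext u
    simp
    ring
  have hint := integrable_ridge hs' hK' (integrable_smul_id_stdGaussian hg) w
  have hmain : HasFDerivAt (ridge s g)
      (∫ x, innerSL ℝ (deriv s (inner ℝ w x) • g x • x) ∂stdGaussian E) w := by
    refine hasFDerivAt_integral_of_dominated_of_fderiv_le (𝕜 := ℝ)
      (bound := fun x => K' * (‖x‖ * ‖g x‖)) univ_mem
      (.of_forall fun v =>
        (integrable_ridge hs.continuous hK (hg.integrable one_le_two) v).aestronglyMeasurable)
      (integrable_ridge hs.continuous hK (hg.integrable one_le_two) w)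
      ((innerSL ℝ).continuous.comp_aestronglyMeasurable hint.1) (.of_forall fun x v _ => ?_)
      ((integrable_norm_mul_norm_stdGaussian hg).const_mul K') (.of_forall fun x v _ => hder x v)
    rw [innerSL_apply_norm, norm_smul, norm_smul, mul_comm ‖x‖]
    exact mul_le_mul_of_nonneg_right (hK' _) (by positivity)
  rw [hasGradientAt_iff_hasFDerivAt]
  refine hmain.congr_fderiv ?_
  exact ContinuousLinearMap.integral_comp_comm (innerSL ℝ : E →L[ℝ] E →L[ℝ] ℝ) hint

end Gaussian

/-! ### Propagation of almost sure bounds -/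

theorem sigmoid_le_exp (x : ℝ) : Real.sigmoid x ≤ Real.exp x := by
  have h := Real.sigmoid_mul_rexp_neg (-x)
  rw [neg_neg] at h
  rw [← h]
  exact mul_le_of_le_one_left (Real.exp_pos x).le (Real.sigmoid_le_one _)

section AlmostSureBounds

variable {X : Type*} [NormedAddCommGroup X] [NormedSpace ℝ X] [FiniteDimensional ℝ X]
  [MeasurableSpace X] [BorelSpace X] {κ : Kernel ℝ X} [IsMarkovKernel κ] {V : ℝ → X → X}
  {T R t : ℝ} {ℓ : X →L[ℝ] ℝ} {c : ℝ → ℝ}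

namespace IsTransport

theorem integral_comp_sub_integral_comp_eq (h : IsTransport κ V T) {u : X → ℝ}
    (hu : ContDiff ℝ ∞ u) {C : ℝ} (hC : ∀ x, |u x| ≤ C)
    (hder : Integrable (fun p => fderiv ℝ u p.2 (V p.1 p.2)) (spaceTime κ T))
    (ht : t ∈ Icc 0 T) :
    ∫ x, u x ∂κ t - ∫ x, u x ∂κ 0 = ∫ s in 0..t, ∫ x, fderiv ℝ u x (V s x) ∂κ s := by
  have hfderiv (p : ℝ × X) (v : X) :
      fderiv ℝ (fun p : ℝ × X => u p.2) p (1, v) = fderiv ℝ u p.2 v := by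
    have := ((hu.differentiable (by simp) p.2).hasFDerivAt.comp p hasFDerivAt_snd).fderiv
    simp [Function.comp_def] at this
    simp [this]
  have := h.integral_sub_integral_eq (φ := fun p => u p.2) (hu.comp contDiff_snd)
    (fun p => hC p.2) (by simpa only [hfderiv] using hder)
    (h.continuousOn (.ofNormedAddCommGroup u hu.continuous C hC)) ht
  simpa only [hfderiv] using this

theorem integral_le_mul_exp_integral (h : IsTransport κ V T) {u : X → ℝ}
    (hu : ContDiff ℝ ∞ u) (hu₀ : ∀ x, 0 ≤ u x) {C : ℝ} (hC : ∀ x, u x ≤ C)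
    (hc : IntegrableOn c (Ioc 0 T)) (hc₀ : ∀ t, 0 ≤ c t)
    (hV : ∀ᵐ p ∂spaceTime κ T, |fderiv ℝ u p.2 (V p.1 p.2)| ≤ c p.1 * u p.2)
    (ht : t ∈ Icc 0 T) :
    ∫ x, u x ∂κ t ≤ (∫ x, u x ∂κ 0) * Real.exp (∫ s in 0..t, c s) := by
  have hT : 0 ≤ T := ht.1.trans ht.2
  have huC : ∀ x, |u x| ≤ C := fun x => by rw [abs_of_nonneg (hu₀ x)]; exact hC x
  have hcu : Integrable (fun p => c p.1 * u p.2) (spaceTime κ T) :=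
    (integrable_comp_fst_spaceTime hc).mul_bdd
      (hu.continuous.comp continuous_snd).aestronglyMeasurable (c := C)
      (.of_forall fun p => huC p.2)
  have hder : Integrable (fun p => fderiv ℝ u p.2 (V p.1 p.2)) (spaceTime κ T) :=
    hcu.mono' (h.aestronglyMeasurable_fderiv_apply (hu.of_le (by simp))) hV
  have hle : ∀ᵐ s ∂volume.restrict (Ioc 0 T),
      ∫ x, fderiv ℝ u x (V s x) ∂κ s ≤ c s * ∫ x, u x ∂κ s := by
    filter_upwards [Measure.ae_ae_of_ae_compProd hV] with s hs
    have hint : Integrable u (κ s) :=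
      .of_bound hu.continuous.aestronglyMeasurable C (.of_forall huC)
    rw [← integral_const_mul]
    exact (Real.le_norm_self _).trans (norm_integral_le_of_norm_le (hint.const_mul (c s)) hs)
  have hF : ContinuousOn (fun t => ∫ x, u x ∂κ t) (Icc 0 T) :=
    h.continuousOn (.ofNormedAddCommGroup u hu.continuous C huC)
  have hcF : IntervalIntegrable (fun t => c t * ∫ x, u x ∂κ t) volume 0 T :=
    ((intervalIntegrable_iff_integrableOn_Ioc_of_le hT).2 hc).mul_continuousOn
      (by rwa [uIcc_of_le hT])
  have hsub : ∀ r ∈ Icc 0 t, uIcc 0 r ⊆ uIcc 0 T := fun r hr => by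
    rw [uIcc_of_le hr.1, uIcc_of_le hT]
    exact Icc_subset_Icc_right (hr.2.trans ht.2)
  refine le_mul_exp_integral ht.1
    (((intervalIntegrable_iff_integrableOn_Ioc_of_le hT).2 hc).mono_set (hsub t ⟨ht.1, le_rfl⟩))
    (fun s _ => hc₀ s) (hcF.mono_set (hsub t ⟨ht.1, le_rfl⟩)) fun r hr => ?_
  have heq := h.integral_comp_sub_integral_comp_eq hu huC hder ⟨hr.1, hr.2.trans ht.2⟩
  have hmono := intervalIntegral.integral_mono_ae_restrict hr.1
    ((intervalIntegrable_of_integrable_spaceTime hT hder).mono_set (hsub r hr))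
    (hcF.mono_set (hsub r hr)) ?_
  · simp only at hmono
    linarith
  · rw [Measure.restrict_congr_set Ioc_ae_eq_Icc.symm]
    exact ae_restrict_of_ae_restrict_of_subset (Ioc_subset_Ioc_right (hr.2.trans ht.2)) hle

theorem integral_sigmoid_le (h : IsTransport κ V T) (hc : IntegrableOn c (Ioc 0 T))
    (hc₀ : ∀ t, 0 ≤ c t) (hV : ∀ᵐ p ∂spaceTime κ T, |ℓ (V p.1 p.2)| ≤ c p.1) {r : ℝ}
    (hr : 0 ≤ r) (R : ℝ) (ht : t ∈ Icc 0 T) :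
    ∫ x, Real.sigmoid (r * (ℓ x - R)) ∂κ t
      ≤ (∫ x, Real.sigmoid (r * (ℓ x - R)) ∂κ 0) * Real.exp (r * ∫ s in 0..t, c s) := by
  have hder (x : X) : HasFDerivAt (fun x => Real.sigmoid (r * (ℓ x - R)))
      ((Real.sigmoid (r * (ℓ x - R)) * (1 - Real.sigmoid (r * (ℓ x - R)))) • r • ℓ) x :=
    (Real.hasDerivAt_sigmoid _).comp_hasFDerivAt x ((ℓ.hasFDerivAt.sub_const R).const_smul r)
  -- The logistic function replaces `exp (r (ℓ - R))`: it is bounded, and its derivative is still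
  -- bounded by `r` times the function itself.
  rw [← intervalIntegral.integral_const_mul]
  refine h.integral_le_mul_exp_integral ((contDiff_sigmoid.of_le le_top).comp (by fun_prop))
    (fun x => Real.sigmoid_nonneg _) (fun x => Real.sigmoid_le_one _) (hc.const_mul r)
    (fun t => mul_nonneg hr (hc₀ t)) ?_ ht
  filter_upwards [hV] with p hp
  have h₀ := Real.sigmoid_nonneg (r * (ℓ p.2 - R))
  have h₁ := Real.sigmoid_le_one (r * (ℓ p.2 - R))
  rw [(hder p.2).fderiv]
  simp only [smul_apply, smul_eq_mul, abs_mul, abs_of_nonneg hr,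
    abs_of_nonneg h₀, abs_of_nonneg (sub_nonneg.2 h₁)]
  calc Real.sigmoid (r * (ℓ p.2 - R)) * (1 - Real.sigmoid (r * (ℓ p.2 - R)))
          * (r * |ℓ (V p.1 p.2)|)
      ≤ Real.sigmoid (r * (ℓ p.2 - R)) * 1 * (r * c p.1) := by gcongr; linarith
    _ = r * c p.1 * Real.sigmoid (r * (ℓ p.2 - R)) := by ring

theorem ae_le_add_integral (h : IsTransport κ V T) (hc : IntegrableOn c (Ioc 0 T))
    (hc₀ : ∀ t, 0 ≤ c t) (hV : ∀ᵐ p ∂spaceTime κ T, |ℓ (V p.1 p.2)| ≤ c p.1)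
    (hR : ∀ᵐ x ∂κ 0, ℓ x ≤ R) (ht : t ∈ Icc 0 T) :
    ∀ᵐ x ∂κ t, ℓ x ≤ R + ∫ s in 0..t, c s := by
  rw [ae_le_const_iff_forall_gt_measure_zero]
  intro b hb
  set I := ∫ s in 0..t, c s
  have hle (n : ℕ) : (κ t).real {x | b ≤ ℓ x} ≤ 2 * Real.exp (n * (R + I - b)) := by
    have hsig (s : ℝ) : Integrable (fun x => Real.sigmoid (n * (ℓ x - b))) (κ s) :=
      .of_bound (continuous_sigmoid.comp (by fun_prop)).aestronglyMeasurable 1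
        (.of_forall fun x => by
          rw [Real.norm_of_nonneg (Real.sigmoid_nonneg _)]; exact Real.sigmoid_le_one _)
    have hinit : ∫ x, Real.sigmoid (n * (ℓ x - b)) ∂κ 0 ≤ Real.exp (n * (R - b)) := by
      refine (integral_mono_ae (hsig 0)
        (integrable_const (Real.exp (n * (R - b)))) (hR.mono fun x hx => ?_)).trans_eq
        (by simp)
      exact (Real.sigmoid_le (by gcongr)).trans (sigmoid_le_exp _)
    have hmarkov : 2⁻¹ * (κ t).real {x | b ≤ ℓ x} ≤ ∫ x, Real.sigmoid (n * (ℓ x - b)) ∂κ t := by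
      have hsub : {x | b ≤ ℓ x} ⊆ {x | 2⁻¹ ≤ Real.sigmoid (n * (ℓ x - b))} := fun x hx => by
        rw [mem_ofPred_eq, ← Real.sigmoid_zero]
        exact Real.sigmoid_le (mul_nonneg n.cast_nonneg (sub_nonneg.2 hx))
      have := mul_meas_ge_le_integral_of_nonneg
        (.of_forall fun x => Real.sigmoid_nonneg _) (hsig t) 2⁻¹
      exact (mul_le_mul_of_nonneg_left (measureReal_mono hsub) (by norm_num)).trans this
    have hgrowth := h.integral_sigmoid_le hc hc₀ hV n.cast_nonneg b ht
    calc (κ t).real {x | b ≤ ℓ x} ≤ 2 * ∫ x, Real.sigmoid (n * (ℓ x - b)) ∂κ t := by linarith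
      _ ≤ 2 * (Real.exp (n * (R - b)) * Real.exp (n * I)) := by
          gcongr
          exact hgrowth.trans (by gcongr)
      _ = 2 * Real.exp (n * (R + I - b)) := by rw [← Real.exp_add]; ring_nf
  have hlim : Tendsto (fun n : ℕ => 2 * Real.exp (n * (R + I - b))) atTop (𝓝 (2 * 0)) := by
    refine (Real.tendsto_exp_atBot.comp ?_).const_mul 2
    exact tendsto_natCast_atTop_atTop.atTop_mul_const_of_neg (by linarith)
  rw [mul_zero] at hlim
  exact (measureReal_eq_zero_iff).1
    (le_antisymm (ge_of_tendsto' hlim hle) measureReal_nonneg)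

theorem ae_abs_le_add_integral (h : IsTransport κ V T) (hc : IntegrableOn c (Ioc 0 T))
    (hc₀ : ∀ t, 0 ≤ c t) (hV : ∀ᵐ p ∂spaceTime κ T, |ℓ (V p.1 p.2)| ≤ c p.1)
    (hR : ∀ᵐ x ∂κ 0, |ℓ x| ≤ R) (ht : t ∈ Icc 0 T) :
    ∀ᵐ x ∂κ t, |ℓ x| ≤ R + ∫ s in 0..t, c s := by
  have hpos := h.ae_le_add_integral hc hc₀ hV (hR.mono fun x hx => (abs_le.1 hx).2) ht
  have hneg := h.ae_le_add_integral (ℓ := -ℓ) (R := R) hc hc₀ (by simpa using hV)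
    (hR.mono fun x hx => neg_le.1 (abs_le.1 hx).1) ht
  filter_upwards [hpos, hneg] with x hx hx'
  exact abs_le.2 ⟨neg_le.1 hx', hx⟩

theorem ae_abs_le_mul_exp (h : IsTransport κ V T) {α β : ℝ} (hα : 0 ≤ α) (hβ : 0 ≤ β)
    (hint : IntegrableOn (fun t => ∫ x, |ℓ x| ∂κ t) (Ioc 0 T))
    (hV : ∀ᵐ p ∂spaceTime κ T, |ℓ (V p.1 p.2)| ≤ α + β * ∫ x, |ℓ x| ∂κ p.1)
    (hR : ∀ᵐ x ∂κ 0, |ℓ x| ≤ R) (ht : t ∈ Icc 0 T) :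
    ∀ᵐ x ∂κ t, |ℓ x| ≤ (R + α * T) * Real.exp (β * T) := by
  have hT : 0 ≤ T := ht.1.trans ht.2
  have hR₀ : 0 ≤ R := by
    obtain ⟨x, hx⟩ := hR.exists
    exact (abs_nonneg _).trans hx
  set m : ℝ → ℝ := fun t => ∫ x, |ℓ x| ∂κ t
  have hm₀ : ∀ t, 0 ≤ m t := fun t => integral_nonneg fun x => abs_nonneg _
  have hm : IntervalIntegrable m volume 0 T :=
    (intervalIntegrable_iff_integrableOn_Ioc_of_le hT).2 hint
  have hbound : ∀ r ∈ Icc 0 T, ∀ᵐ x ∂κ r, |ℓ x| ≤ R + α * T + β * ∫ s in 0..r, m s := by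
    intro r hr
    have hmr : IntervalIntegrable m volume 0 r := hm.mono_set (by
      rw [uIcc_of_le hr.1, uIcc_of_le hT]; exact Icc_subset_Icc_right hr.2)
    filter_upwards [h.ae_abs_le_add_integral (c := fun t => α + β * m t)
      ((integrable_const _).add (hint.const_mul β))
      (fun t => add_nonneg hα (mul_nonneg hβ (hm₀ t))) hV hR hr] with x hx
    rw [intervalIntegral.integral_add (by simp) (hmr.const_mul β), intervalIntegral.integral_const,
      intervalIntegral.integral_const_mul, smul_eq_mul, sub_zero] at hx
    nlinarith [mul_le_mul_of_nonneg_left hr.2 hα]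
  have hmr : ∀ r ∈ Icc 0 T, m r ≤ R + α * T + β * ∫ s in 0..r, m s := fun r hr => by
    have hℓ : Integrable ℓ (κ r) := .of_bound ℓ.continuous.aestronglyMeasurable _ (hbound r hr)
    simpa using integral_mono_ae hℓ.abs (integrable_const _) (hbound r hr)
  have hgronwall := add_mul_integral_le_mul_exp hβ hm hmr ht
  filter_upwards [hbound t ht] with x hx
  refine (hx.trans hgronwall).trans ?_
  gcongr
  exact ht.2

end IsTransport

end AlmostSureBounds

/-! ### The velocity field of the mean-field equation -/

section Activation

variable {σ : ℝ → ℝ} {K : ℝ} (hσ : IsActivation σ K)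

include hσ

theorem _root_.IsActivation.nonneg : 0 ≤ K := (abs_nonneg _).trans (hσ.bound 0)

theorem _root_.IsActivation.lipschitzWith : LipschitzWith K.toNNReal σ :=
  lipschitzWith_of_nnnorm_deriv_le (hσ.contDiff.differentiable (by simp)) fun x => by
    rw [← NNReal.coe_le_coe, Real.coe_toNNReal _ hσ.nonneg]
    exact hσ.bound_deriv x

theorem _root_.IsActivation.continuous_deriv : Continuous (deriv σ) :=
  hσ.contDiff.continuous_deriv (by simp)

theorem _root_.IsActivation.lipschitzWith_deriv : LipschitzWith K.toNNReal (deriv σ) :=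
  lipschitzWith_of_nnnorm_deriv_le
    ((hσ.contDiff.deriv' (n := 1)).differentiable (by simp)) fun x => by
    rw [← NNReal.coe_le_coe, Real.coe_toNNReal _ hσ.nonneg]
    exact hσ.bound_deriv_two x

end Activation

section Velocity

variable {E : Type*} [NormedAddCommGroup E] [InnerProductSpace ℝ E] [FiniteDimensional ℝ E]
  [MeasurableSpace E]

/-- The velocity `-(ξ_a ∂_a Φ, ξ_w ∇_w Φ)` of a neuron `θ = (a, w)` for the learning rates
`ξ = (ξ_a, ξ_w)` and the residual `g`, where `Φ(a, w) = a E_x[g(x) σ(wᵀx)]`. -/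
def velocity (σ : ℝ → ℝ) (ξ : ℝ × ℝ) (g : E → ℝ) (θ : ℝ × E) : ℝ × E :=
  -(ξ.1 * ridge σ g θ.2, ξ.2 • θ.1 • ridge (deriv σ) (fun x => g x • x) θ.2)

theorem velocity_sub_learningRate (σ : ℝ → ℝ) (ξ ξ' : ℝ × ℝ) (g : E → ℝ) (θ : ℝ × E) :
    velocity σ ξ g θ - velocity σ ξ' g θ = velocity σ (ξ - ξ') g θ := by
  ext1
  · simp only [velocity, Prod.fst_sub, Prod.fst_neg]
    ring
  · simp only [velocity, Prod.snd_sub, Prod.snd_neg]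
    module

theorem velocity_congr_ae {σ : ℝ → ℝ} {g g' : E → ℝ} (h : g =ᵐ[stdGaussian E] g')
    (ξ : ℝ × ℝ) (θ : ℝ × E) : velocity σ ξ g θ = velocity σ ξ g' θ := by
  have h₁ : ridge σ g θ.2 = ridge σ g' θ.2 :=
    integral_congr_ae (h.mono fun x hx => by simp only [hx])
  have h₂ : ridge (deriv σ) (fun x => g x • x) θ.2 = ridge (deriv σ) (fun x => g' x • x) θ.2 :=
    integral_congr_ae (h.mono fun x hx => by simp only [hx])
  rw [velocity, velocity, h₁, h₂]

variable [BorelSpace E] {σ : ℝ → ℝ} {K : ℝ} {g g' : E → ℝ} (hσ : IsActivation σ K)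

include hσ

theorem velocity_sub_residual (ξ : ℝ × ℝ) (hg : MemLp g 2 (stdGaussian E))
    (hg' : MemLp g' 2 (stdGaussian E)) (θ : ℝ × E) :
    velocity σ ξ g θ - velocity σ ξ g' θ = velocity σ ξ (g - g') θ := by
  have h₁ := ridge_sub hσ.contDiff.continuous hσ.bound hg hg' θ.2
  have h₂ := ridge_smul_id_sub hσ.continuous_deriv hσ.bound_deriv hg hg' θ.2
  ext1
  · simp only [velocity, Prod.fst_sub, Prod.fst_neg, ← h₁]
    ring
  · simp only [velocity, Prod.snd_sub, Prod.snd_neg, ← h₂]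
    module

theorem abs_velocity_fst_le (ξ : ℝ × ℝ) (hg : MemLp g 2 (stdGaussian E)) (θ : ℝ × E) :
    |(velocity σ ξ g θ).1| ≤ ‖ξ‖ * (K * lpNorm g 2 (stdGaussian E)) := by
  simp only [velocity, Prod.fst_neg, abs_neg, abs_mul]
  exact mul_le_mul (norm_fst_le ξ) (abs_ridge_le hσ.bound hg θ.2) (abs_nonneg _) (norm_nonneg _)

theorem norm_velocity_le (ξ : ℝ × ℝ) (hg : MemLp g 2 (stdGaussian E)) (θ : ℝ × E) :
    ‖velocity σ ξ g θ‖ ≤ ‖ξ‖ * (K * lpNorm g 2 (stdGaussian E)) * (1 + |θ.1|) := by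
  have hKg : 0 ≤ K * lpNorm g 2 (stdGaussian E) :=
    mul_nonneg hσ.nonneg lpNorm_nonneg
  refine max_le ?_ ?_
  · exact (abs_velocity_fst_le hσ ξ hg θ).trans
      (le_mul_of_one_le_right (by positivity) (by linarith [abs_nonneg θ.1]))
  · have hw := norm_ridge_smul_id_le hσ.continuous_deriv hσ.bound_deriv hg θ.2
    simp only [velocity, Prod.snd_neg, norm_neg, norm_smul]
    calc ‖ξ.2‖ * (‖θ.1‖ * ‖ridge (deriv σ) (fun x => g x • x) θ.2‖)
        ≤ ‖ξ‖ * ((1 + |θ.1|) * (K * lpNorm g 2 (stdGaussian E))) := by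
          gcongr
          · exact norm_snd_le ξ
          · simp
      _ = _ := by ring

theorem abs_velocity_fst_sub_velocity_fst_le (ξ : ℝ × ℝ) (hg : MemLp g 2 (stdGaussian E))
    (θ θ' : ℝ × E) :
    |(velocity σ ξ g θ).1 - (velocity σ ξ g θ').1|
      ≤ ‖ξ‖ * (K * lpNorm g 2 (stdGaussian E)) * ‖θ - θ'‖ := by
  have hridge := abs_ridge_sub_ridge_le hσ.contDiff.continuous hσ.bound hσ.lipschitzWith hg θ'.2 θ.2
  rw [Real.coe_toNNReal _ hσ.nonneg, norm_sub_rev] at hridge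
  have hKg : 0 ≤ K * lpNorm g 2 (stdGaussian E) := mul_nonneg hσ.nonneg lpNorm_nonneg
  calc |(velocity σ ξ g θ).1 - (velocity σ ξ g θ').1|
      = ‖ξ.1‖ * |ridge σ g θ'.2 - ridge σ g θ.2| := by
        simp only [velocity, Prod.fst_neg]
        rw [Real.norm_eq_abs, ← abs_mul]
        ring_nf
    _ ≤ ‖ξ‖ * (K * lpNorm g 2 (stdGaussian E) * ‖θ - θ'‖) := by
        gcongr
        · exact norm_fst_le ξ
        · exact hridge.trans (by gcongr; exact norm_snd_le (θ - θ'))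
    _ = _ := by ring

theorem norm_velocity_snd_sub_velocity_snd_le (ξ : ℝ × ℝ) (hg : MemLp g 2 (stdGaussian E)) {R : ℝ}
    (θ θ' : ℝ × E) (hθ : |θ.1| ≤ R) :
    ‖(velocity σ ξ g θ).2 - (velocity σ ξ g θ').2‖
      ≤ ‖ξ‖ * (K * lpNorm g 2 (stdGaussian E)) * (1 + R * sqrtFourthMoment) * ‖θ - θ'‖ := by
  have hK := hσ.nonneg
  have hR : 0 ≤ R := (abs_nonneg _).trans hθ
  have hm := sqrtFourthMoment_nonneg
  have hg₀ : 0 ≤ lpNorm g 2 (stdGaussian E) := lpNorm_nonneg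
  have hsnd : ‖θ.2 - θ'.2‖ ≤ ‖θ - θ'‖ := norm_snd_le (θ - θ')
  have hβ := norm_ridge_smul_id_le hσ.continuous_deriv hσ.bound_deriv hg θ'.2
  have hβ' := norm_ridge_smul_id_sub_ridge_smul_id_le hσ.continuous_deriv
    hσ.bound_deriv hσ.lipschitzWith_deriv hg θ.2 θ'.2
  rw [Real.coe_toNNReal _ hK] at hβ'
  set β := ridge (deriv σ) fun x => g x • x
  calc ‖(velocity σ ξ g θ).2 - (velocity σ ξ g θ').2‖
      = ‖ξ.2‖ * ‖θ.1 • (β θ.2 - β θ'.2) + (θ.1 - θ'.1) • β θ'.2‖ := by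
        rw [← norm_smul, ← norm_neg]
        simp only [velocity, Prod.snd_neg]
        congr 1
        module
    _ ≤ ‖ξ‖ * (R * (K * sqrtFourthMoment * lpNorm g 2 (stdGaussian E) * ‖θ - θ'‖)
          + ‖θ - θ'‖ * (K * lpNorm g 2 (stdGaussian E))) := by
        gcongr
        · exact norm_snd_le ξ
        · refine (norm_add_le _ _).trans ?_
          rw [norm_smul, norm_smul]
          gcongr
          · exact hθ
          · exact hβ'.trans (by gcongr)
          · exact norm_fst_le (θ - θ')
    _ = _ := by ring

theorem norm_velocity_sub_velocity_le (ξ : ℝ × ℝ) (hg : MemLp g 2 (stdGaussian E)) {R : ℝ}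
    (θ θ' : ℝ × E) (hθ : |θ.1| ≤ R) :
    ‖velocity σ ξ g θ - velocity σ ξ g θ'‖
      ≤ ‖ξ‖ * (K * lpNorm g 2 (stdGaussian E)) * (1 + R * sqrtFourthMoment) * ‖θ - θ'‖ := by
  have hK := hσ.nonneg
  have hg₀ : 0 ≤ lpNorm g 2 (stdGaussian E) := lpNorm_nonneg
  have hm : 0 ≤ R * sqrtFourthMoment :=
    mul_nonneg ((abs_nonneg _).trans hθ) sqrtFourthMoment_nonneg
  refine max_le ((abs_velocity_fst_sub_velocity_fst_le hσ ξ hg θ θ').trans ?_)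
    (norm_velocity_snd_sub_velocity_snd_le hσ ξ hg θ θ' hθ)
  exact mul_le_mul_of_nonneg_right (le_mul_of_one_le_right (by positivity) (by linarith))
    (norm_nonneg _)

end Velocity

/-- The projection of a neuron to the region `|a| ≤ R`. -/
def clip {E : Type*} {R : ℝ} (hR : 0 ≤ R) (θ : ℝ × E) : ℝ × E :=
  (projIcc (-R) R (neg_le_self hR) θ.1, θ.2)

section Clip

variable {E : Type*} {R : ℝ} (hR : 0 ≤ R)

theorem abs_clip_fst_le (θ : ℝ × E) : |(clip hR θ).1| ≤ R :=
  abs_le.2 (projIcc (-R) R (neg_le_self hR) θ.1).2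

theorem clip_eq_self {θ : ℝ × E} (hθ : |θ.1| ≤ R) : clip hR θ = θ := by
  rw [clip, projIcc_of_mem _ (abs_le.1 hθ)]

theorem lipschitzWith_clip [NormedAddCommGroup E] : LipschitzWith 1 (clip (E := E) hR) := by
  have h := (LipschitzWith.subtype_val _).comp
    ((LipschitzWith.projIcc (neg_le_self hR)).comp (LipschitzWith.prod_fst (β := E)))
  exact (h.prodMk LipschitzWith.prod_snd).weaken (by simp)

end Clip

theorem dist_toLp_toLp {α F : Type*} {m : MeasurableSpace α} [NormedAddCommGroup F] {μ : Measure α}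
    {p : ℝ≥0∞} {f g : α → F} (hf : MemLp f p μ) (hg : MemLp g p μ) :
    dist (hf.toLp f) (hg.toLp g) = lpNorm (f - g) p μ := by
  rw [Lp.dist_edist, Lp.edist_toLp_toLp, toReal_eLpNorm (hf.1.sub hg.1)]

section RegularVelocity

variable {E : Type*} [NormedAddCommGroup E] [InnerProductSpace ℝ E] [FiniteDimensional ℝ E]
  [MeasurableSpace E] [BorelSpace E] {σ : ℝ → ℝ} {K : ℝ} (hσ : IsActivation σ K)
  {ξ : ℝ → ℝ × ℝ} {g : ℝ → E → ℝ} {C N R : ℝ}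

include hσ

theorem norm_velocity_clip_sub_velocity_clip_le (ξ ξ' : ℝ × ℝ) {g g' : E → ℝ}
    (hg : MemLp g 2 (stdGaussian E)) (hg' : MemLp g' 2 (stdGaussian E)) (hR : 0 ≤ R)
    (θ θ' : ℝ × E) :
    ‖velocity σ ξ g (clip hR θ) - velocity σ ξ' g' (clip hR θ')‖
      ≤ ‖ξ‖ * (K * lpNorm g 2 (stdGaussian E)) * (1 + R * sqrtFourthMoment) * ‖θ - θ'‖
        + ‖ξ - ξ'‖ * (K * lpNorm g 2 (stdGaussian E)) * (1 + R)
        + ‖ξ'‖ * (K * lpNorm (g - g') 2 (stdGaussian E)) * (1 + R) := by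
  have hK := hσ.nonneg
  have hm := sqrtFourthMoment_nonneg
  have hKg (f : E → ℝ) : 0 ≤ K * lpNorm f 2 (stdGaussian E) := mul_nonneg hK lpNorm_nonneg
  have hspace := norm_velocity_sub_velocity_le hσ ξ hg (clip hR θ) (clip hR θ')
    (abs_clip_fst_le hR θ)
  have hrate := norm_velocity_le hσ (ξ - ξ') hg (clip hR θ')
  have hresidual := norm_velocity_le hσ ξ' (hg.sub hg') (clip hR θ')
  rw [← velocity_sub_learningRate] at hrate
  rw [← velocity_sub_residual hσ _ hg hg'] at hresidual
  refine (norm_sub_le_norm_sub_add_norm_sub _ (velocity σ ξ g (clip hR θ')) _).trans ?_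
  rw [add_assoc]
  refine add_le_add (hspace.trans ?_)
    ((norm_sub_le_norm_sub_add_norm_sub _ (velocity σ ξ' g (clip hR θ')) _).trans
      (add_le_add (hrate.trans ?_) (hresidual.trans ?_)))
  · have hdist : ‖clip hR θ - clip hR θ'‖ ≤ ‖θ - θ'‖ := by
      simpa [dist_eq_norm] using (lipschitzWith_clip hR).dist_le_mul θ θ'
    have := hKg g
    gcongr
  · have := hKg g
    gcongr
    exact abs_clip_fst_le hR θ'
  · have := hKg (g - g')
    gcongr
    exact abs_clip_fst_le hR θ'

theorem uniformContinuous_velocity_clip (hξ : UniformContinuous ξ) (hC : ∀ t, ‖ξ t‖ ≤ C)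
    (hg : ∀ t, MemLp (g t) 2 (stdGaussian E)) (hN : ∀ t, lpNorm (g t) 2 (stdGaussian E) ≤ N)
    (hg' : UniformContinuous fun t => (hg t).toLp (g t)) (hR : 0 ≤ R) :
    UniformContinuous (Function.uncurry fun t θ => velocity σ (ξ t) (g t) (clip hR θ)) := by
  have hK := hσ.nonneg
  have hC₀ : 0 ≤ C := (norm_nonneg _).trans (hC 0)
  have : 0 ≤ N := lpNorm_nonneg.trans (hN 0)
  have hKg (t : ℝ) : 0 ≤ K * lpNorm (g t) 2 (stdGaussian E) := mul_nonneg hK lpNorm_nonneg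
  have hfst : UniformContinuous (Prod.fst : ℝ × ℝ × E → ℝ) := uniformContinuous_fst
  have hξ' := tendsto_uniformity_iff_dist_tendsto_zero.1 (hξ.comp hfst)
  have hg'' := tendsto_uniformity_iff_dist_tendsto_zero.1 (hg'.comp hfst)
  have hθ' := tendsto_uniformity_iff_dist_tendsto_zero.1
    (uniformContinuous_snd : UniformContinuous (Prod.snd : ℝ × ℝ × E → ℝ × E))
  have hlim := ((hθ'.const_mul (C * (K * N) * (1 + R * sqrtFourthMoment))).add
    ((hξ'.mul_const (K * N)).mul_const (1 + R))).add
    (((hg''.const_mul K).const_mul C).mul_const (1 + R))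
  simp only [mul_zero, zero_mul, add_zero] at hlim
  refine tendsto_uniformity_iff_dist_tendsto_zero.2
    (squeeze_zero (fun _ => dist_nonneg) (fun ⟨⟨t, θ⟩, t', θ'⟩ => ?_) hlim)
  have hm := sqrtFourthMoment_nonneg
  rw [Function.uncurry_apply_pair, Function.uncurry_apply_pair, dist_eq_norm]
  refine (norm_velocity_clip_sub_velocity_clip_le hσ (ξ t) (ξ t') (hg t) (hg t') hR θ θ').trans ?_
  rw [← dist_toLp_toLp (hg t) (hg t'), ← dist_eq_norm, ← dist_eq_norm]
  simp only [Function.comp_apply]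
  gcongr
  exacts [hKg t, hC t, hN t, hN t, hC t']

theorem isRegularField_velocity_clip (hξ : UniformContinuous ξ) (hC : ∀ t, ‖ξ t‖ ≤ C)
    (hg : ∀ t, MemLp (g t) 2 (stdGaussian E)) (hN : ∀ t, lpNorm (g t) 2 (stdGaussian E) ≤ N)
    (hg' : UniformContinuous fun t => (hg t).toLp (g t)) (hR : 0 ≤ R) :
    IsRegularField (fun t θ => velocity σ (ξ t) (g t) (clip hR θ))
      (C * (K * N) * (1 + R)).toNNReal (C * (K * N) * (1 + R * sqrtFourthMoment)).toNNReal := by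
  have hK := hσ.nonneg
  have hC₀ : 0 ≤ C := (norm_nonneg _).trans (hC 0)
  have hN₀ : 0 ≤ N := lpNorm_nonneg.trans (hN 0)
  have hKg (t : ℝ) : 0 ≤ K * lpNorm (g t) 2 (stdGaussian E) := mul_nonneg hK lpNorm_nonneg
  have hm := sqrtFourthMoment_nonneg
  refine ⟨fun t θ => ?_, fun t => LipschitzWith.of_dist_le_mul fun θ θ' => ?_,
    uniformContinuous_velocity_clip hσ hξ hC hg hN hg' hR⟩
  · rw [Real.coe_toNNReal _ (by positivity)]
    refine (norm_velocity_le hσ (ξ t) (hg t) _).trans ?_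
    gcongr
    exacts [hKg t, hC t, hN t, abs_clip_fst_le hR θ]
  · rw [Real.coe_toNNReal _ (by positivity), dist_eq_norm]
    have hdist : ‖clip hR θ - clip hR θ'‖ ≤ dist θ θ' := by
      simpa [dist_eq_norm] using (lipschitzWith_clip hR).dist_le_mul θ θ'
    refine (norm_velocity_sub_velocity_le hσ (ξ t) (hg t) _ _ (abs_clip_fst_le hR θ)).trans ?_
    gcongr
    exacts [hKg t, hC t, hN t]

end RegularVelocity

section Network

variable {d : ℕ} {σ : ℝ → ℝ} {K : ℝ} {μ : Measure (Param d)}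

theorem abs_fNN_le (hσ : IsActivation σ K) (hμ : Integrable Prod.fst μ)
    (x : EuclideanSpace ℝ (Fin d)) : |fNN σ μ x| ≤ K * ∫ θ, |θ.1| ∂μ := by
  rw [← integral_const_mul, ← Real.norm_eq_abs]
  refine norm_integral_le_of_norm_le (hμ.abs.const_mul K) (.of_forall fun θ => ?_)
  rw [norm_mul, mul_comm]
  exact mul_le_mul_of_nonneg_right (hσ.bound _) (abs_nonneg _)

theorem stronglyMeasurable_fNN_kernel {α : Type*} [MeasurableSpace α] (hσ : Continuous σ)
    (κ : Kernel α (Param d)) [IsSFiniteKernel κ] :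
    StronglyMeasurable (Function.uncurry fun t x => fNN σ (κ t) x) :=
  StronglyMeasurable.integral_kernel_prod_right'
    (κ := κ.prodMkRight (EuclideanSpace ℝ (Fin d)))
    (f := fun y : (α × EuclideanSpace ℝ (Fin d)) × Param d => y.2.1 * σ (inner ℝ y.2.2 y.1.2))
    (Measurable.stronglyMeasurable (by fun_prop))

theorem memLp_fNN [SFinite μ] (hσ : IsActivation σ K) (hμ : Integrable Prod.fst μ) :
    MemLp (fNN σ μ) 2 (stdGaussian _) := by
  have hmeas := stronglyMeasurable_fNN_kernel hσ.contDiff.continuous (Kernel.const Unit μ)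
  refine MemLp.of_bound (C := K * ∫ θ, |θ.1| ∂μ) ?_ (.of_forall fun x => abs_fNN_le hσ hμ x)
  exact (hmeas.comp_measurable (measurable_prodMk_left (x := ()))).aestronglyMeasurable

theorem lpNorm_le_of_forall_abs_le {α : Type*} [MeasurableSpace α] {ν : Measure α}
    [IsProbabilityMeasure ν] {f : α → ℝ} {C : ℝ} (hf : ∀ x, |f x| ≤ C) {p : ℝ≥0∞} (hp : p ≠ 0) :
    lpNorm f p ν ≤ C := by
  obtain ⟨x⟩ := ν.nonempty_of_neZero
  have hC : 0 ≤ C := (abs_nonneg _).trans (hf x)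
  refine (lpNorm_mono_real (memLp_const C) hf).trans_eq ?_
  simp [lpNorm_const hp (NeZero.ne ν), abs_of_nonneg hC]

theorem lpNorm_residual_le [SFinite μ] (hσ : IsActivation σ K) (hμ : Integrable Prod.fst μ)
    {fstar : EuclideanSpace ℝ (Fin d) → ℝ} :
    lpNorm (fNN σ μ - fstar) 2 (stdGaussian _)
      ≤ K * ∫ θ, |θ.1| ∂μ + lpNorm fstar 2 (stdGaussian _) := by
  refine (lpNorm_sub_le (memLp_fNN hσ hμ) one_le_two).trans (add_le_add ?_ le_rfl)
  exact lpNorm_le_of_forall_abs_le (abs_fNN_le hσ hμ) two_ne_zero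

theorem potential_eq (fstar : EuclideanSpace ℝ (Fin d) → ℝ) (θ : Param d) :
    potential σ fstar μ θ = θ.1 * ridge σ (fNN σ μ - fstar) θ.2 := by
  simp only [potential, gaussExp, ridge, smul_eq_mul, Pi.sub_apply, mul_comm]

theorem deriv_potential (fstar : EuclideanSpace ℝ (Fin d) → ℝ) (θ : Param d) :
    deriv (fun a => potential σ fstar μ (a, θ.2)) θ.1 = ridge σ (fNN σ μ - fstar) θ.2 := by
  simp [potential_eq]

theorem gradient_potential [SFinite μ] (hσ : IsActivation σ K) (hμ : Integrable Prod.fst μ)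
    {fstar : EuclideanSpace ℝ (Fin d) → ℝ} (hf : MemLp fstar 2 (stdGaussian _)) (θ : Param d) :
    gradient (fun w => potential σ fstar μ (θ.1, w)) θ.2
      = θ.1 • ridge (deriv σ) (fun x => (fNN σ μ - fstar) x • x) θ.2 := by
  simp only [potential_eq]
  have h := hasGradientAt_ridge (hσ.contDiff.of_le one_le_two) hσ.bound hσ.bound_deriv
    ((memLp_fNN hσ hμ).sub hf) θ.2
  refine HasGradientAt.gradient ?_
  rw [hasGradientAt_iff_hasFDerivAt, map_smul]
  exact h.hasFDerivAt.const_mul θ.1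

theorem weakIntegrand_comp_swap [SFinite μ] (hσ : IsActivation σ K) (hμ : Integrable Prod.fst μ)
    {fstar : EuclideanSpace ℝ (Fin d) → ℝ} (hf : MemLp fstar 2 (stdGaussian _)) (ξa ξw : ℝ → ℝ)
    {η : ℝ × Param d → ℝ} {θ : Param d} {t : ℝ} (hη : DifferentiableAt ℝ η (t, θ)) :
    weakIntegrand σ fstar ξa ξw μ (η ∘ Prod.swap) θ t
      = -fderiv ℝ η (t, θ) (1, velocity σ (ξa t, ξw t) (fNN σ μ - fstar) θ) := by
  have hη' := hη.hasFDerivAt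
  have htime : HasDerivAt (fun s => (η ∘ Prod.swap) (θ, s)) (fderiv ℝ η (t, θ) (1, 0)) t :=
    hη'.comp_hasDerivAt t ((hasDerivAt_id t).prodMk (hasDerivAt_const t θ))
  have hfst : HasDerivAt (fun a => (η ∘ Prod.swap) ((a, θ.2), t))
      (fderiv ℝ η (t, θ) (0, 1, 0)) θ.1 :=
    hη'.comp_hasDerivAt θ.1
      ((hasDerivAt_const _ t).prodMk ((hasDerivAt_id _).prodMk (hasDerivAt_const _ θ.2)))
  have hsnd : HasFDerivAt (fun w => (η ∘ Prod.swap) ((θ.1, w), t)) _ θ.2 :=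
    hη'.comp (f := fun w => (t, θ.1, w)) θ.2
      ((hasFDerivAt_const t _).prodMk ((hasFDerivAt_const θ.1 _).prodMk (hasFDerivAt_id θ.2)))
  rw [weakIntegrand, htime.deriv, hfst.deriv, hsnd.hasGradientAt.gradient, deriv_potential,
    gradient_potential hσ hμ hf, InnerProductSpace.toDual_symm_apply]
  set α := ridge σ (fNN σ μ - fstar) θ.2
  set β := ridge (deriv σ) (fun x => (fNN σ μ - fstar) x • x) θ.2
  have hsplit : ((1, velocity σ (ξa t, ξw t) (fNN σ μ - fstar) θ) : ℝ × Param d)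
      = (1, 0) - (ξa t * α) • (0, 1, 0) - (ξw t * θ.1) • (0, 0, β) := by
    simp [velocity, mul_smul, α, β]
  simp [hsplit, -Prod.smul_mk]
  ring

end Network

theorem stronglyMeasurable_ridge {α E F : Type*} [MeasurableSpace α] [NormedAddCommGroup E]
    [InnerProductSpace ℝ E] [FiniteDimensional ℝ E] [MeasurableSpace E] [BorelSpace E]
    [NormedAddCommGroup F] [NormedSpace ℝ F] {s : ℝ → ℝ} (hs : Continuous s) {G : α → E → F}
    (hG : StronglyMeasurable (Function.uncurry G)) :
    StronglyMeasurable fun z : α × E => ridge s (G z.1) z.2 := by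
  refine StronglyMeasurable.integral_prod_right
    (f := fun (z : α × E) (x : E) => s (inner ℝ z.2 x) • G z.1 x) ?_
  exact (Measurable.stronglyMeasurable (by fun_prop)).smul
    (hG.comp_measurable (g := fun q : (α × E) × E => (q.1.1, q.2)) (by fun_prop))

theorem stronglyMeasurable_velocity {α E : Type*} [MeasurableSpace α] [NormedAddCommGroup E]
    [InnerProductSpace ℝ E] [FiniteDimensional ℝ E] [MeasurableSpace E] [BorelSpace E]
    {σ : ℝ → ℝ} {K : ℝ} (hσ : IsActivation σ K) {ξ : α → ℝ × ℝ} (hξ : Measurable ξ) {g : α → E → ℝ}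
    (hg : StronglyMeasurable (Function.uncurry g)) :
    StronglyMeasurable (Function.uncurry fun t θ => velocity σ (ξ t) (g t) θ) := by
  have hpair : Measurable fun z : α × ℝ × E => (z.1, z.2.2) := by fun_prop
  have hfst := (stronglyMeasurable_ridge hσ.contDiff.continuous hg).comp_measurable hpair
  have hsnd := (stronglyMeasurable_ridge (G := fun t x => g t x • x) hσ.continuous_deriv
    (hg.smul (Measurable.stronglyMeasurable measurable_snd))).comp_measurable hpair
  have hξ₁ : StronglyMeasurable fun z : α × ℝ × E => (ξ z.1).1 :=
    Measurable.stronglyMeasurable (by fun_prop)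
  have hξ₂ : StronglyMeasurable fun z : α × ℝ × E => (ξ z.1).2 :=
    Measurable.stronglyMeasurable (by fun_prop)
  have ha : StronglyMeasurable fun z : α × ℝ × E => z.2.1 :=
    Measurable.stronglyMeasurable (by fun_prop)
  exact ((hξ₁.mul hfst).prodMk (hξ₂.smul (ha.smul hsnd))).neg

section ClampTime

variable {T : ℝ}

/-- The projection of a time to `[0, T]`. Composing with it turns the data of a flow, which are
controlled on `[0, T]` only, into functions that are controlled on the whole line. -/
def clampTime (T t : ℝ) : ℝ := max 0 (min T t)

theorem clampTime_nonneg (T t : ℝ) : 0 ≤ clampTime T t := le_max_left _ _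

theorem clampTime_of_mem {t : ℝ} (ht : t ∈ Icc 0 T) : clampTime T t = t := by
  rw [clampTime, min_eq_right ht.2, max_eq_right ht.1]

theorem clampTime_mem (hT : 0 ≤ T) (t : ℝ) : clampTime T t ∈ Icc 0 T :=
  ⟨clampTime_nonneg T t, max_le hT (min_le_left _ _)⟩

theorem continuous_clampTime (T : ℝ) : Continuous (clampTime T) := by
  unfold clampTime
  fun_prop

theorem uniformContinuous_comp_clampTime {Y : Type*} [UniformSpace Y] {f : ℝ → Y} (hT : 0 ≤ T)
    (hf : ContinuousOn f (Icc 0 T)) : UniformContinuous fun t => f (clampTime T t) :=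
  (CompactSpace.uniformContinuous_of_continuous hf.domRestrict).comp
    (LipschitzWith.projIcc hT).uniformContinuous

end ClampTime

theorem measurable_of_continuous_probabilityMeasure {α Ω : Type*} [TopologicalSpace α]
    [MeasurableSpace α] [OpensMeasurableSpace α] [TopologicalSpace Ω] [MeasurableSpace Ω]
    [BorelSpace Ω] [HasOuterApproxClosed Ω] {f : α → ProbabilityMeasure Ω} (hf : Continuous f) :
    Measurable fun t => (f t : Measure Ω) := by
  refine Measurable.measure_of_isPiSystem_of_isProbabilityMeasure
    (BorelSpace.measurable_eq.trans rfl) isPiSystem_isOpen fun U hU => ?_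
  refine LowerSemicontinuous.measurable fun t y hy => ?_
  have h := ProbabilityMeasure.le_liminf_measure_open_of_tendsto (hf.tendsto t) hU
  exact eventually_lt_of_lt_liminf (hy.trans_le h)

theorem integrable_fderiv_spaceTime {X : Type*} [NormedAddCommGroup X] [NormedSpace ℝ X]
    [FiniteDimensional ℝ X] [MeasurableSpace X] [BorelSpace X] {κ : Kernel ℝ X} [IsMarkovKernel κ]
    {V : ℝ → X → X} {T : ℝ} {m : ℝ → ℝ}
    (hV : AEStronglyMeasurable (Function.uncurry V) (spaceTime κ T))
    (hm : IntegrableOn m (Ioc 0 T)) (hVm : ∀ᵐ p ∂spaceTime κ T, ‖V p.1 p.2‖ ≤ m p.1 * (1 + ‖p.2‖))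
    {η : ℝ × X → ℝ} (hη : ContDiff ℝ 1 η) (hηc : HasCompactSupport η) :
    Integrable (fun p => fderiv ℝ η p (1, V p.1 p.2)) (spaceTime κ T) := by
  have hη' : Continuous (fderiv ℝ η) := hη.continuous_fderiv one_ne_zero
  obtain ⟨A, hA⟩ := ((hηc.fderiv ℝ).smul_left (f := fun p => 1 + ‖p‖)).exists_bound_of_continuous
    (by fun_prop)
  refine (((integrable_const 1).add (integrable_comp_fst_spaceTime hm)).const_mul A).mono' ?_ ?_
  · exact isBoundedBilinearMap_apply.continuous.comp_aestronglyMeasurable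
      (hη'.aestronglyMeasurable.prodMk (aestronglyMeasurable_const.prodMk hV))
  filter_upwards [hVm] with p hp
  have hm₀ : 0 ≤ m p.1 :=
    nonneg_of_mul_nonneg_left ((norm_nonneg _).trans hp) (by positivity)
  have hp₂ : ‖p.2‖ ≤ ‖p‖ := norm_snd_le p
  have hvec : ‖((1, V p.1 p.2) : ℝ × X)‖ ≤ (1 + ‖p‖) * (1 + m p.1) := by
    refine max_le ?_ (hp.trans ?_)
    · rw [norm_one]
      nlinarith [norm_nonneg p, mul_nonneg (norm_nonneg p) hm₀]
    · nlinarith [norm_nonneg p, mul_nonneg (norm_nonneg p) hm₀, norm_nonneg p.2]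
  have hAp : ‖fderiv ℝ η p‖ * (1 + ‖p‖) ≤ A := by
    have := hA p
    rwa [Pi.smul_apply', norm_smul, Real.norm_of_nonneg (by positivity), mul_comm] at this
  calc _ ≤ ‖fderiv ℝ η p‖ * ((1 + ‖p‖) * (1 + m p.1)) :=
        (ContinuousLinearMap.le_opNorm _ _).trans (by gcongr)
    _ ≤ A * (1 + m p.1) := by rw [← mul_assoc]; gcongr

section MeanFieldFlow

variable {d : ℕ} {σ : ℝ → ℝ} {K : ℝ} {fstar : EuclideanSpace ℝ (Fin d) → ℝ} {ξ : ℝ → ℝ × ℝ}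
  {ρ : ℝ → ProbabilityMeasure (Param d)} {T : ℝ}

/-- The laws of a curve of probability measures, frozen outside `[0, T]`, as a kernel in time. -/
def timeKernel (hρ : ContinuousOn ρ (Ici 0)) (T : ℝ) : Kernel ℝ (Param d) where
  toFun t := ρ (clampTime T t)
  measurable' := measurable_of_continuous_probabilityMeasure
    (hρ.comp_continuous (continuous_clampTime T) (clampTime_nonneg T))

instance (hρ : ContinuousOn ρ (Ici 0)) : IsMarkovKernel (timeKernel hρ T) :=
  ⟨fun t => inferInstanceAs (IsProbabilityMeasure (ρ (clampTime T t) : Measure (Param d)))⟩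

theorem timeKernel_apply (hρ : ContinuousOn ρ (Ici 0)) {t : ℝ} (ht : t ∈ Icc 0 T) :
    timeKernel hρ T t = ρ t := by
  change (ρ (clampTime T t) : Measure (Param d)) = ρ t
  rw [clampTime_of_mem ht]

theorem continuous_integral_timeKernel (hρ : ContinuousOn ρ (Ici 0)) (φ : Param d →ᵇ ℝ) :
    Continuous fun t => ∫ θ, φ θ ∂timeKernel hρ T t := by
  have h := hρ.comp_continuous (continuous_clampTime T) (clampTime_nonneg T)
  exact continuous_iff_continuousAt.2 fun t =>
    ProbabilityMeasure.tendsto_iff_forall_integral_tendsto.1 (h.tendsto t) φ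

/-- The velocity field of the flow `ρ` with learning rates `ξ`, frozen outside `[0, T]`. -/
def flowVelocity (σ : ℝ → ℝ) (fstar : EuclideanSpace ℝ (Fin d) → ℝ) (ξ : ℝ → ℝ × ℝ)
    (ρ : ℝ → ProbabilityMeasure (Param d)) (T t : ℝ) : Param d → Param d :=
  velocity σ (ξ (clampTime T t)) (fNN σ (ρ (clampTime T t)) - fstar)

theorem stronglyMeasurable_flowVelocity (hσ : IsActivation σ K)
    (hf : MemLp fstar 2 (stdGaussian _)) (hξ : ContinuousOn ξ (Ici 0))
    (hρ : ContinuousOn ρ (Ici 0)) :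
    StronglyMeasurable (Function.uncurry (flowVelocity σ fstar ξ ρ T)) := by
  have hξ' : Continuous fun t => ξ (clampTime T t) :=
    hξ.comp_continuous (continuous_clampTime T) (clampTime_nonneg T)
  have h := stronglyMeasurable_velocity hσ hξ'.measurable
    (g := fun t => fNN σ (timeKernel hρ T t) - hf.1.mk fstar)
    ((stronglyMeasurable_fNN_kernel hσ.contDiff.continuous (timeKernel hρ T)).sub
      (hf.1.stronglyMeasurable_mk.comp_measurable measurable_snd))
  convert h using 2
  funext t θ
  exact velocity_congr_ae (hf.1.ae_eq_mk.mono fun x hx => by simp only [Pi.sub_apply, hx]; rfl) _ _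

theorem _root_.IsMeanFieldFlow.integrable_fst {ξa ξw : ℝ → ℝ}
    (hρ : IsMeanFieldFlow σ fstar ξa ξw ρ) {t : ℝ} (ht : 0 ≤ t) :
    Integrable Prod.fst (ρ t : Measure (Param d)) :=
  ⟨measurable_fst.aestronglyMeasurable, hρ.moment_lt_top t ht⟩

theorem _root_.IsMeanFieldFlow.integrableOn_integral_abs_fst {ξa ξw : ℝ → ℝ}
    (hρ : IsMeanFieldFlow σ fstar ξa ξw ρ) (hT : 0 < T) :
    IntegrableOn (fun t => ∫ θ, |θ.1| ∂timeKernel hρ.continuousOn T t) (Ioc 0 T) := by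
  refine IntegrableOn.mono_set ⟨?_, ?_⟩ Ioc_subset_Icc_self
  · exact (StronglyMeasurable.integral_kernel_prod_right' (κ := timeKernel hρ.continuousOn T)
      (f := fun z : ℝ × Param d => |z.2.1|)
      (Continuous.stronglyMeasurable (by fun_prop))).aestronglyMeasurable
  · refine (setLIntegral_mono' measurableSet_Icc fun t ht => ?_).trans_lt
      (hρ.moment_integrable T hT)
    simp only [timeKernel_apply _ ht]
    exact (enorm_integral_le_lintegral_enorm _).trans_eq (by simp)

variable {C Q : ℝ}

theorem abs_flowVelocity_fst_le (hσ : IsActivation σ K) (hf : MemLp fstar 2 (stdGaussian _))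
    (hQ : lpNorm fstar 2 (stdGaussian _) ≤ Q) (hC : ∀ t, 0 ≤ t → ‖ξ t‖ ≤ C)
    (hρ : IsMeanFieldFlow σ fstar (fun t => (ξ t).1) (fun t => (ξ t).2) ρ) (t : ℝ) (θ : Param d) :
    |(flowVelocity σ fstar ξ ρ T t θ).1|
      ≤ C * (K * (K * ∫ θ, |θ.1| ∂timeKernel hρ.continuousOn T t + Q)) := by
  have hK := hσ.nonneg
  have ht := clampTime_nonneg T t
  have hC₀ : 0 ≤ C := (norm_nonneg _).trans (hC _ ht)
  refine (abs_velocity_fst_le hσ _ ((memLp_fNN hσ (hρ.integrable_fst ht)).sub hf) θ).trans ?_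
  have hres := (lpNorm_residual_le hσ (hρ.integrable_fst ht) (fstar := fstar)).trans
    (add_le_add_right hQ _)
  exact mul_le_mul (hC _ ht) (mul_le_mul_of_nonneg_left hres hK) (mul_nonneg hK lpNorm_nonneg) hC₀

theorem norm_flowVelocity_le (hσ : IsActivation σ K) (hf : MemLp fstar 2 (stdGaussian _))
    (hQ : lpNorm fstar 2 (stdGaussian _) ≤ Q) (hC : ∀ t, 0 ≤ t → ‖ξ t‖ ≤ C)
    (hρ : IsMeanFieldFlow σ fstar (fun t => (ξ t).1) (fun t => (ξ t).2) ρ) (t : ℝ) (θ : Param d) :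
    ‖flowVelocity σ fstar ξ ρ T t θ‖
      ≤ C * (K * (K * ∫ θ, |θ.1| ∂timeKernel hρ.continuousOn T t + Q)) * (1 + ‖θ‖) := by
  have hK := hσ.nonneg
  have ht := clampTime_nonneg T t
  have hC₀ : 0 ≤ C := (norm_nonneg _).trans (hC _ ht)
  refine (norm_velocity_le hσ _ ((memLp_fNN hσ (hρ.integrable_fst ht)).sub hf) θ).trans ?_
  have hres := (lpNorm_residual_le hσ (hρ.integrable_fst ht) (fstar := fstar)).trans
    (add_le_add_right hQ _)
  exact mul_le_mul
    (mul_le_mul (hC _ ht) (mul_le_mul_of_nonneg_left hres hK) (mul_nonneg hK lpNorm_nonneg) hC₀)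
    (add_le_add_right (norm_fst_le θ) 1) (by positivity)
    (mul_nonneg hC₀ (mul_nonneg hK (lpNorm_nonneg.trans hres)))

theorem _root_.IsMeanFieldFlow.integral_fderiv_flowVelocity (hσ : IsActivation σ K)
    (hf : MemLp fstar 2 (stdGaussian _))
    (hρ : IsMeanFieldFlow σ fstar (fun t => (ξ t).1) (fun t => (ξ t).2) ρ) {η : ℝ × Param d → ℝ}
    (hη : ContDiff ℝ ∞ η) (hηc : HasCompactSupport η) (hηs : tsupport η ⊆ Ioo 0 T ×ˢ univ) :
    ∫ t in Ioc 0 T, ∫ θ, fderiv ℝ η (t, θ) (1, flowVelocity σ fstar ξ ρ T t θ)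
      ∂timeKernel hρ.continuousOn T t = 0 := by
  have hweak := hρ.weak (η ∘ Prod.swap) (hη.comp (contDiff_snd.prodMk contDiff_fst))
    (hηc.comp_homeomorph (Homeomorph.prodComm _ _)) fun p hp =>
      ⟨mem_univ _, (hηs (tsupport_comp_subset_preimage η continuous_swap hp)).1.1⟩
  have hderiv {t : ℝ} (ht : 0 ≤ t) (θ : Param d) := weakIntegrand_comp_swap hσ
    (hρ.integrable_fst ht) hf (fun t => (ξ t).1) (fun t => (ξ t).2) (θ := θ)
    (hη.differentiable (by simp) (t, θ))
  rw [setIntegral_eq_of_subset_of_forall_sdiff_eq_zero measurableSet_Ioi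
    (Ioc_subset_Ioi_self (a := T) (b := 0))] at hweak
  · rw [← neg_eq_zero, ← integral_neg]
    refine (setIntegral_congr_fun measurableSet_Ioc fun t ht => ?_).trans hweak
    have ht' : t ∈ Icc 0 T := Ioc_subset_Icc_self ht
    simp only [timeKernel_apply _ ht', flowVelocity, clampTime_of_mem ht', ← integral_neg]
    exact integral_congr_ae (.of_forall fun θ => (hderiv ht'.1 θ).symm)
  · intro t ht
    refine integral_eq_zero_of_ae (.of_forall fun θ => (hderiv (le_of_lt ht.1) θ).trans ?_)
    rw [fderiv_of_notMem_tsupport ℝ fun h : (t, θ) ∈ _ => ht.2 (Ioo_subset_Ioc_self (hηs h).1)]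
    simp

theorem _root_.IsMeanFieldFlow.isTransport (hσ : IsActivation σ K)
    (hf : MemLp fstar 2 (stdGaussian _)) (hξ : ContinuousOn ξ (Ici 0))
    (hC : ∀ t, 0 ≤ t → ‖ξ t‖ ≤ C)
    (hρ : IsMeanFieldFlow σ fstar (fun t => (ξ t).1) (fun t => (ξ t).2) ρ) (hT : 0 < T) :
    IsTransport (timeKernel hρ.continuousOn T) (flowVelocity σ fstar ξ ρ T) T where
  continuousOn φ := (continuous_integral_timeKernel hρ.continuousOn φ).continuousOn
  aestronglyMeasurable :=
    (stronglyMeasurable_flowVelocity hσ hf hξ hρ.continuousOn).aestronglyMeasurable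
  growth := ⟨_, (((hρ.integrableOn_integral_abs_fst hT).const_mul K).add
      (integrable_const _)).const_mul K |>.const_mul C,
    .of_forall fun p => norm_flowVelocity_le hσ hf le_rfl hC hρ p.1 p.2⟩
  weak η hη hηc hηs := by
    have hm := (((hρ.integrableOn_integral_abs_fst hT).const_mul K).add
      (integrable_const (lpNorm fstar 2 (stdGaussian _)))).const_mul K |>.const_mul C
    rw [integral_spaceTime hT.le (integrable_fderiv_spaceTime
        (stronglyMeasurable_flowVelocity hσ hf hξ hρ.continuousOn).aestronglyMeasurable hm
        (.of_forall fun p => norm_flowVelocity_le hσ hf le_rfl hC hρ p.1 p.2)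
        (hη.of_le (by simp)) hηc), intervalIntegral.integral_of_le hT.le]
    exact hρ.integral_fderiv_flowVelocity hσ hf hη hηc hηs

end MeanFieldFlow

theorem lpNorm_two_eq_sqrt {α E : Type*} [MeasurableSpace α] [NormedAddCommGroup E] {μ : Measure α}
    {f : α → E} (hf : AEStronglyMeasurable f μ) : lpNorm f 2 μ = √(∫ x, ‖f x‖ ^ 2 ∂μ) := by
  rw [lpNorm_eq_integral_norm_rpow_toReal two_ne_zero ENNReal.ofNat_ne_top hf, Real.sqrt_eq_rpow]
  simp

theorem lpNorm_two_sq {α : Type*} [MeasurableSpace α] {μ : Measure α} {f : α → ℝ}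
    (hf : AEStronglyMeasurable f μ) : lpNorm f 2 μ ^ 2 = ∫ x, f x ^ 2 ∂μ := by
  rw [lpNorm_two_eq_sqrt hf, Real.sq_sqrt (integral_nonneg fun _ => sq_nonneg _)]
  simp only [Real.norm_eq_abs, sq_abs]

theorem tendsto_lpNorm_two_sub {α ι : Type*} [MeasurableSpace α] {μ : Measure α}
    [IsFiniteMeasure μ] {l : Filter ι} [l.IsCountablyGenerated] {f : ι → α → ℝ} {g : α → ℝ} {C : ℝ}
    (hf : ∀ i, AEStronglyMeasurable (f i) μ) (hg : AEStronglyMeasurable g μ)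
    (hfC : ∀ i x, |f i x| ≤ C) (hgC : ∀ x, |g x| ≤ C)
    (hlim : ∀ x, Tendsto (fun i => f i x) l (𝓝 (g x))) :
    Tendsto (fun i => lpNorm (f i - g) 2 μ) l (𝓝 0) := by
  simp only [lpNorm_two_eq_sqrt ((hf _).sub hg), Pi.sub_apply]
  suffices Tendsto (fun i => ∫ x, ‖f i x - g x‖ ^ 2 ∂μ) l (𝓝 0) by
    rw [← Real.sqrt_zero]
    exact (Real.continuous_sqrt.tendsto 0).comp this
  rw [← integral_zero α ℝ (μ := μ)]
  refine tendsto_integral_filter_of_dominated_convergence (fun _ => (C + C) ^ 2) ?_ ?_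
    (integrable_const _) (.of_forall fun x => ?_)
  · exact .of_forall fun i => ((hf i).sub hg).norm.pow 2
  · refine .of_forall fun i => .of_forall fun x => ?_
    rw [norm_pow, norm_norm]
    exact pow_le_pow_left₀ (norm_nonneg _) ((abs_sub _ _).trans (add_le_add (hfC i x) (hgC x))) 2
  · simpa using (((hlim x).sub_const (g x)).norm.pow 2)

section BoundedWeights

variable {d : ℕ} {σ : ℝ → ℝ} {K : ℝ} {fstar : EuclideanSpace ℝ (Fin d) → ℝ} {ξ : ℝ → ℝ × ℝ}
  {ρ : ℝ → ProbabilityMeasure (Param d)} {C Q R T : ℝ}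

/-- The a priori bound on the output weights up to time `T` when they are initially at most `R`:
the weights move at speed at most `C * K * (K * 𝔼|a| + Q)`. -/
def outputWeightBound (C K Q R T : ℝ) : ℝ := (R + C * (K * Q) * T) * Real.exp (C * (K * K) * T)

theorem _root_.IsMeanFieldFlow.ae_abs_fst_le (hσ : IsActivation σ K)
    (hf : MemLp fstar 2 (stdGaussian _)) (hQ : lpNorm fstar 2 (stdGaussian _) ≤ Q)
    (hξ : ContinuousOn ξ (Ici 0)) (hC : ∀ t, 0 ≤ t → ‖ξ t‖ ≤ C)
    (hρ : IsMeanFieldFlow σ fstar (fun t => (ξ t).1) (fun t => (ξ t).2) ρ) (hT : 0 < T)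
    (h₀ : ∀ᵐ θ ∂(ρ 0 : Measure (Param d)), |θ.1| ≤ R) {t : ℝ} (ht : t ∈ Icc 0 T) :
    ∀ᵐ θ ∂(ρ t : Measure (Param d)), |θ.1| ≤ outputWeightBound C K Q R T := by
  have hK := hσ.nonneg
  have hC₀ : 0 ≤ C := (norm_nonneg _).trans (hC 0 le_rfl)
  have hQ₀ : 0 ≤ Q := lpNorm_nonneg.trans hQ
  rw [← timeKernel_apply hρ.continuousOn ht]
  rw [← timeKernel_apply hρ.continuousOn (left_mem_Icc.2 hT.le)] at h₀
  refine (hρ.isTransport hσ hf hξ hC hT).ae_abs_le_mul_exp (ℓ := .fst ℝ ℝ _)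
    (α := C * (K * Q)) (β := C * (K * K)) (by positivity) (by positivity)
    (hρ.integrableOn_integral_abs_fst hT) (.of_forall fun p => ?_) h₀ ht
  refine (abs_flowVelocity_fst_le hσ hf hQ hC hρ p.1 p.2).trans_eq ?_
  simp only [ContinuousLinearMap.coe_fst']
  ring

theorem abs_fNN_le_of_ae {μ : Measure (Param d)} [IsProbabilityMeasure μ] (hσ : IsActivation σ K)
    (hR : ∀ᵐ θ ∂μ, |θ.1| ≤ R) (x : EuclideanSpace ℝ (Fin d)) : |fNN σ μ x| ≤ K * R := by
  have hint : Integrable (fun θ : Param d => θ.1) μ :=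
    .of_bound measurable_fst.aestronglyMeasurable R hR
  refine (abs_fNN_le hσ hint x).trans (mul_le_mul_of_nonneg_left ?_ hσ.nonneg)
  simpa using integral_mono_ae hint.abs (integrable_const R) hR

/-- The velocity of a neuron with its output weight clipped to `[-R, R]`. It is globally bounded and
Lipschitz, and is the velocity of the flow as long as the output weights stay in `[-R, R]`. -/
def clippedVelocity (σ : ℝ → ℝ) (fstar : EuclideanSpace ℝ (Fin d) → ℝ) (ξ : ℝ → ℝ × ℝ)
    (ρ : ℝ → ProbabilityMeasure (Param d)) (T : ℝ) (hR₀ : 0 ≤ R) (t : ℝ) (θ : Param d) : Param d :=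
  flowVelocity σ fstar ξ ρ T t (clip hR₀ θ)

/-- The Lipschitz constant of `clippedVelocity` in `θ`. -/
def velocityLipschitzConstant (C K Q R : ℝ) : ℝ :=
  C * (K * (K * R + Q)) * (1 + R * sqrtFourthMoment)

variable (hσ : IsActivation σ K) (hf : MemLp fstar 2 (stdGaussian _))
  (hρ : ContinuousOn ρ (Ici 0)) (hT : 0 ≤ T)
  (hR : ∀ t ∈ Icc 0 T, ∀ᵐ θ ∂(ρ t : Measure (Param d)), |θ.1| ≤ R)

include hσ hρ hR

include hT in
theorem continuous_fNN_clampTime (x : EuclideanSpace ℝ (Fin d)) :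
    Continuous fun t => fNN σ (ρ (clampTime T t) : Measure (Param d)) x := by
  have hR₀ : 0 ≤ R := by
    obtain ⟨θ, hθ⟩ := (hR 0 (left_mem_Icc.2 hT)).exists
    exact (abs_nonneg _).trans hθ
  have hcont := hσ.contDiff.continuous
  have := (lipschitzWith_clip (E := EuclideanSpace ℝ (Fin d)) hR₀).continuous
  let φ : Param d →ᵇ ℝ := .ofNormedAddCommGroup
    (fun θ => (clip hR₀ θ).1 * σ (inner ℝ θ.2 x)) (by fun_prop) (R * K) fun θ => by
      rw [norm_mul]
      exact mul_le_mul (abs_clip_fst_le hR₀ θ) (hσ.bound _) (abs_nonneg _) hR₀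
  convert continuous_integral_timeKernel (T := T) hρ φ using 2 with t
  refine integral_congr_ae ((hR _ (clampTime_mem hT t)).mono fun θ hθ => ?_)
  simp [φ, clip_eq_self hR₀ hθ]

include hf in
theorem isRegularField_clippedVelocity (hT : 0 ≤ T) (hQ : lpNorm fstar 2 (stdGaussian _) ≤ Q)
    (hξ : ContinuousOn ξ (Ici 0)) (hC : ∀ t, 0 ≤ t → ‖ξ t‖ ≤ C) (hR₀ : 0 ≤ R) :
    IsRegularField (clippedVelocity σ fstar ξ ρ T hR₀)
      (C * (K * (K * R + Q)) * (1 + R)).toNNReal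
      (velocityLipschitzConstant C K Q R).toNNReal := by
  have hbound (t : ℝ) := abs_fNN_le_of_ae hσ (hR _ (clampTime_mem hT t))
  have hint (t : ℝ) : Integrable Prod.fst (ρ (clampTime T t) : Measure (Param d)) :=
    .of_bound measurable_fst.aestronglyMeasurable R (hR _ (clampTime_mem hT t))
  have hmem (t : ℝ) := memLp_fNN hσ (hint t)
  have hg (t : ℝ) := (hmem t).sub hf
  refine isRegularField_velocity_clip hσ
    (uniformContinuous_comp_clampTime hT (hξ.mono Icc_subset_Ici_self))
    (fun t => hC _ (clampTime_nonneg T t)) hg (fun t => ?_) ?_ hR₀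
  · exact (lpNorm_sub_le (hmem t) one_le_two).trans
      (add_le_add (lpNorm_le_of_forall_abs_le (hbound t) two_ne_zero) hQ)
  have hcont : Continuous fun t => (hg t).toLp _ := by
    refine continuous_iff_continuousAt.2 fun t => tendsto_iff_dist_tendsto_zero.2 ?_
    simp only [dist_toLp_toLp, sub_sub_sub_cancel_right]
    exact tendsto_lpNorm_two_sub (fun s => (hmem s).1) (hmem t).1 hbound (hbound t)
      fun x => (continuous_fNN_clampTime hσ hρ hT hR x).tendsto t
  convert uniformContinuous_comp_clampTime hT hcont.continuousOn using 4 with t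
  rw [clampTime_of_mem (clampTime_mem hT t)]

end BoundedWeights

/-! ### Stability of flows and networks along couplings -/

theorem le_mul_exp_of_le_add_integral {u : ℝ → ℝ} {A c T : ℝ} (hT : 0 ≤ T) (hc : 0 ≤ c)
    (hu : Continuous u) (h : ∀ t ∈ Icc 0 T, u t ≤ A + ∫ s in 0..t, c * u s) :
    u T ≤ A * Real.exp (c * T) := by
  refine (le_mul_exp_integral (κ := fun _ => c) hT intervalIntegrable_const (fun _ _ => hc)
    ((hu.const_mul c).intervalIntegrable 0 T) h).trans_eq ?_
  simp [mul_comm]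

section Coupling

variable {X : Type*} [NormedAddCommGroup X] [NormedSpace ℝ X] [CompleteSpace X]
  {v v' : ℝ → X → X} {M L M' L' : ℝ≥0}

theorem norm_flow_sub_flow_le_mul_exp {δ : ℝ → ℝ} {T : ℝ} (hv : IsRegularField v M L)
    (hv' : IsRegularField v' M' L') (hδ : Continuous δ) (hT : 0 ≤ T)
    (h : ∀ t ∈ Icc 0 T, ∀ x, ‖v t x - v' t x‖ ≤ δ t) (x y : X) :
    ‖flow v 0 x T - flow v' 0 y T‖ ≤ (‖x - y‖ + ∫ s in 0..T, δ s) * Real.exp (L * T) := by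
  have hu : Continuous fun s => ‖flow v 0 x s - flow v' 0 y s‖ :=
    ((hv.continuous_flow 0 x).sub (hv'.continuous_flow 0 y)).norm
  refine le_mul_exp_of_le_add_integral hT L.coe_nonneg hu fun t ht => ?_
  have hsub : flow v 0 x t - flow v' 0 y t
      = x - y + ∫ s in 0..t, (v s (flow v 0 x s) - v' s (flow v' 0 y s)) := by
    rw [intervalIntegral.integral_sub
      ((hv.continuous_velocity_flow 0 x).intervalIntegrable 0 t)
      ((hv'.continuous_velocity_flow 0 y).intervalIntegrable 0 t),
      hv.integral_velocity_flow, hv'.integral_velocity_flow]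
    abel
  have hle : ∀ s ∈ Icc 0 t, ‖v s (flow v 0 x s) - v' s (flow v' 0 y s)‖
      ≤ L * ‖flow v 0 x s - flow v' 0 y s‖ + δ s := fun s hs =>
    (norm_sub_le_norm_sub_add_norm_sub _ (v s (flow v' 0 y s)) _).trans
      (add_le_add ((hv.lipschitz s).norm_sub_le _ _) (h s ⟨hs.1, hs.2.trans ht.2⟩ _))
  have hmono : ∫ s in 0..t, δ s ≤ ∫ s in 0..T, δ s :=
    intervalIntegral.integral_mono_interval le_rfl ht.1 ht.2
      ((ae_restrict_mem measurableSet_Ioc).mono fun s hs =>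
        (norm_nonneg _).trans (h s (Ioc_subset_Icc_self hs) 0)) (hδ.intervalIntegrable 0 T)
  calc ‖flow v 0 x t - flow v' 0 y t‖
      ≤ ‖x - y‖ + ∫ s in 0..t, (L * ‖flow v 0 x s - flow v' 0 y s‖ + δ s) := by
        rw [hsub]
        refine (norm_add_le _ _).trans (add_le_add le_rfl ?_)
        exact intervalIntegral.norm_integral_le_of_norm_le ht.1
          (.of_forall fun s hs => hle s (Ioc_subset_Icc_self hs))
          (((hu.const_mul _).add hδ).intervalIntegrable 0 t)
    _ = ‖x - y‖ + (∫ s in 0..t, δ s) + ∫ s in 0..t, L * ‖flow v 0 x s - flow v' 0 y s‖ := by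
        rw [intervalIntegral.integral_add ((hu.const_mul _).intervalIntegrable 0 t)
          (hδ.intervalIntegrable 0 t)]
        ring
    _ ≤ _ := by gcongr

variable [MeasurableSpace X] [BorelSpace X] [SecondCountableTopology X] {γ : Measure (X × X)}
  [IsProbabilityMeasure γ]

theorem integrable_norm_flow_sub_flow (hv : IsRegularField v M L) (hv' : IsRegularField v' M' L')
    (hγ : Integrable (fun z => ‖z.1 - z.2‖) γ) (t : ℝ) :
    Integrable (fun z => ‖flow v 0 z.1 t - flow v' 0 z.2 t‖) γ := by
  have hx := (hv.lipschitzWith_flow 0 t).continuous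
  have hy := (hv'.lipschitzWith_flow 0 t).continuous
  refine (hγ.add (integrable_const (M * |t| + M' * |t|))).mono'
    (Continuous.aestronglyMeasurable (by fun_prop)) (.of_forall fun z => ?_)
  have h₁ := hv.norm_flow_sub_flow_le 0 z.1 t 0
  have h₂ := hv'.norm_flow_sub_flow_le 0 z.2 t 0
  rw [hv.flow_self, sub_zero] at h₁
  rw [hv'.flow_self, sub_zero] at h₂
  have h₃ : flow v 0 z.1 t - flow v' 0 z.2 t
      = z.1 - z.2 + (flow v 0 z.1 t - z.1) - (flow v' 0 z.2 t - z.2) := by abel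
  rw [norm_norm, h₃]
  exact (norm_sub_le _ _).trans (by
    have := norm_add_le (z.1 - z.2) (flow v 0 z.1 t - z.1)
    simp only [Pi.add_apply]
    linarith)

theorem continuous_integral_norm_flow_sub_flow (hv : IsRegularField v M L)
    (hv' : IsRegularField v' M' L') (hγ : Integrable (fun z => ‖z.1 - z.2‖) γ) :
    Continuous fun t => ∫ z, ‖flow v 0 z.1 t - flow v' 0 z.2 t‖ ∂γ := by
  have hint := integrable_norm_flow_sub_flow hv hv' hγ
  refine (LipschitzWith.of_dist_le_mul (K := M + M') fun t t' => ?_).continuous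
  rw [dist_eq_norm, ← integral_sub (hint t) (hint t')]
  refine (norm_integral_le_of_norm_le_const (C := (M + M') * |t - t'|)
    (.of_forall fun z => ?_)).trans_eq (by simp [Real.dist_eq])
  calc ‖‖flow v 0 z.1 t - flow v' 0 z.2 t‖ - ‖flow v 0 z.1 t' - flow v' 0 z.2 t'‖‖
      ≤ ‖flow v 0 z.1 t - flow v' 0 z.2 t - (flow v 0 z.1 t' - flow v' 0 z.2 t')‖ :=
        abs_norm_sub_norm_le _ _
    _ ≤ ‖flow v 0 z.1 t - flow v 0 z.1 t'‖ + ‖flow v' 0 z.2 t - flow v' 0 z.2 t'‖ := by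
        rw [sub_sub_sub_comm]
        exact norm_sub_le _ _
    _ ≤ (M + M') * |t - t'| := by
        rw [add_mul]
        exact add_le_add (hv.norm_flow_sub_flow_le 0 z.1 t t')
          (hv'.norm_flow_sub_flow_le 0 z.2 t t')

theorem integral_norm_flow_sub_flow_le {B T : ℝ} (hv : IsRegularField v M L)
    (hv' : IsRegularField v' M' L') (hγ : Integrable (fun z => ‖z.1 - z.2‖) γ) (hB : 0 ≤ B)
    (h : ∀ t ∈ Icc 0 T, ∀ x,
      ‖v t x - v' t x‖ ≤ B * ∫ z, ‖flow v 0 z.1 t - flow v' 0 z.2 t‖ ∂γ)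
    {t : ℝ} (ht : t ∈ Icc 0 T) :
    ∫ z, ‖flow v 0 z.1 t - flow v' 0 z.2 t‖ ∂γ
      ≤ (∫ z, ‖z.1 - z.2‖ ∂γ) * Real.exp ((L + B * Real.exp (L * T)) * T) := by
  set D : ℝ → ℝ := fun t => ∫ z, ‖flow v 0 z.1 t - flow v' 0 z.2 t‖ ∂γ
  have hD : Continuous D := continuous_integral_norm_flow_sub_flow hv hv' hγ
  have : 0 ≤ T := ht.1.trans ht.2
  have hD_le : ∀ r ∈ Icc 0 t, D r ≤ (∫ z, ‖z.1 - z.2‖ ∂γ) * Real.exp (L * T)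
      + ∫ s in 0..r, B * Real.exp (L * T) * D s := fun r hr => by
    have hD₀ : 0 ≤ ∫ s in 0..r, B * D s := intervalIntegral.integral_nonneg hr.1 fun s _ =>
      mul_nonneg hB (integral_nonneg fun _ => norm_nonneg _)
    calc D r ≤ ∫ z, (‖z.1 - z.2‖ + ∫ s in 0..r, B * D s) * Real.exp (L * T) ∂γ := by
          refine integral_mono (integrable_norm_flow_sub_flow hv hv' hγ r)
            ((hγ.add (integrable_const _)).mul_const _) fun z => ?_
          refine (norm_flow_sub_flow_le_mul_exp hv hv' (hD.const_mul B) hr.1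
            (fun s hs => h s ⟨hs.1, hs.2.trans (hr.2.trans ht.2)⟩) z.1 z.2).trans ?_
          gcongr
          exact hr.2.trans ht.2
      _ = _ := by
          rw [integral_mul_const, integral_add hγ (integrable_const _)]
          simp only [integral_const, probReal_univ, one_smul, add_mul,
            ← intervalIntegral.integral_mul_const, mul_right_comm B]
  refine (le_mul_exp_of_le_add_integral ht.1 (by positivity) hD hD_le).trans ?_
  rw [mul_assoc, ← Real.exp_add, add_mul]
  gcongr
  exact ht.2

end Coupling

section Network

variable {d : ℕ} {σ : ℝ → ℝ} {K R : ℝ} {g : EuclideanSpace ℝ (Fin d) → ℝ}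

theorem integral_mul_fNN {μ : Measure (Param d)} [SFinite μ] (hσ : IsActivation σ K)
    (hμ : Integrable Prod.fst μ) (hg : Integrable g (stdGaussian _)) :
    ∫ x, g x * fNN σ μ x ∂stdGaussian _ = ∫ θ, θ.1 * ridge σ g θ.2 ∂μ := by
  have hcont := hσ.contDiff.continuous
  have hprod : Integrable (fun z : Param d × EuclideanSpace ℝ (Fin d) =>
      σ (inner ℝ z.1.2 z.2) * (z.1.1 * g z.2)) (μ.prod (stdGaussian _)) :=
    (hμ.mul_prod hg).bdd_mul (c := K) (Continuous.aestronglyMeasurable (by fun_prop))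
      (.of_forall fun z => hσ.bound _)
  calc ∫ x, g x * fNN σ μ x ∂stdGaussian _
      = ∫ x, ∫ θ : Param d, σ (inner ℝ θ.2 x) * (θ.1 * g x) ∂μ ∂stdGaussian _ := by
        simp only [fNN, ← integral_const_mul, mul_comm, mul_left_comm, mul_assoc]
    _ = ∫ θ : Param d, ∫ x, σ (inner ℝ θ.2 x) * (θ.1 * g x) ∂stdGaussian _ ∂μ :=
        (integral_integral_swap hprod).symm
    _ = ∫ θ, θ.1 * ridge σ g θ.2 ∂μ := by
        simp only [ridge, ← integral_const_mul, smul_eq_mul, mul_left_comm]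

theorem abs_mul_ridge_sub_mul_ridge_le (hσ : IsActivation σ K) (hg : MemLp g 2 (stdGaussian _))
    {θ θ' : Param d} (hθ' : |θ'.1| ≤ R) :
    |θ.1 * ridge σ g θ.2 - θ'.1 * ridge σ g θ'.2|
      ≤ K * (1 + R) * lpNorm g 2 (stdGaussian _) * ‖θ - θ'‖ := by
  have hN : 0 ≤ lpNorm g 2 (stdGaussian _) := lpNorm_nonneg
  have hK := hσ.nonneg
  have hR : 0 ≤ R := (abs_nonneg _).trans hθ'
  have h₁ := abs_ridge_le hσ.bound hg θ.2
  have h₂ := abs_ridge_sub_ridge_le hσ.contDiff.continuous hσ.bound hσ.lipschitzWith hg θ.2 θ'.2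
  rw [Real.coe_toNNReal K hK] at h₂
  calc |θ.1 * ridge σ g θ.2 - θ'.1 * ridge σ g θ'.2|
      = |(θ.1 - θ'.1) * ridge σ g θ.2 + θ'.1 * (ridge σ g θ.2 - ridge σ g θ'.2)| := by
        congr 1; ring
    _ ≤ |θ.1 - θ'.1| * |ridge σ g θ.2| + |θ'.1| * |ridge σ g θ.2 - ridge σ g θ'.2| := by
        simpa only [abs_mul] using
          abs_add_le ((θ.1 - θ'.1) * ridge σ g θ.2) (θ'.1 * (ridge σ g θ.2 - ridge σ g θ'.2))
    _ ≤ ‖θ - θ'‖ * (K * lpNorm g 2 (stdGaussian _))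
          + R * (K * lpNorm g 2 (stdGaussian _) * ‖θ - θ'‖) := by
        gcongr
        · exact norm_fst_le (θ - θ')
        · refine h₂.trans ?_
          gcongr
          exact norm_snd_le (θ - θ')
    _ = K * (1 + R) * lpNorm g 2 (stdGaussian _) * ‖θ - θ'‖ := by ring

theorem integrable_mul_ridge {μ : Measure (Param d)} (hσ : IsActivation σ K)
    (hμ : Integrable Prod.fst μ) (hg : MemLp g 2 (stdGaussian _)) :
    Integrable (fun θ => θ.1 * ridge σ g θ.2) μ := by
  have hridge : Continuous (ridge σ g) := continuous_iff_continuousAt.2 fun w =>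
    (hasGradientAt_ridge (hσ.contDiff.of_le one_le_two) hσ.bound hσ.bound_deriv hg w).continuousAt
  exact hμ.mul_bdd (c := K * lpNorm g 2 (stdGaussian _))
    (Continuous.aestronglyMeasurable (by fun_prop)) (.of_forall fun θ => abs_ridge_le hσ.bound hg _)

theorem integral_mul_fNN_sub_fNN {γ : Measure (Param d × Param d)} [SFinite γ]
    (hσ : IsActivation σ K) (h₁ : Integrable Prod.fst (γ.map Prod.fst))
    (h₂ : Integrable Prod.fst (γ.map Prod.snd)) (hg : MemLp g 2 (stdGaussian _)) :
    ∫ x, g x * (fNN σ (γ.map Prod.fst) x - fNN σ (γ.map Prod.snd) x) ∂stdGaussian _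
      = ∫ z, (z.1.1 * ridge σ g z.1.2 - z.2.1 * ridge σ g z.2.2) ∂γ := by
  have hr₁ := integrable_mul_ridge hσ h₁ hg
  have hr₂ := integrable_mul_ridge hσ h₂ hg
  simp only [mul_sub]
  calc ∫ x, (g x * fNN σ (γ.map Prod.fst) x - g x * fNN σ (γ.map Prod.snd) x) ∂stdGaussian _
      = ∫ θ, θ.1 * ridge σ g θ.2 ∂γ.map Prod.fst - ∫ θ, θ.1 * ridge σ g θ.2 ∂γ.map Prod.snd := by
        rw [← integral_mul_fNN hσ h₁ (hg.integrable one_le_two),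
          ← integral_mul_fNN hσ h₂ (hg.integrable one_le_two)]
        exact integral_sub (hg.integrable_mul (memLp_fNN hσ h₁))
          (hg.integrable_mul (memLp_fNN hσ h₂))
    _ = _ := by
        rw [integral_map (by fun_prop) hr₁.1, integral_map (by fun_prop) hr₂.1]
        exact (integral_sub (hr₁.comp_measurable measurable_fst)
          (hr₂.comp_measurable measurable_snd)).symm

theorem lpNorm_fNN_sub_fNN_le {γ : Measure (Param d × Param d)} [IsProbabilityMeasure γ]
    (hσ : IsActivation σ K) (hR₁ : ∀ᵐ z ∂γ, |z.1.1| ≤ R) (hR₂ : ∀ᵐ z ∂γ, |z.2.1| ≤ R)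
    (hγ : Integrable (fun z => ‖z.1 - z.2‖) γ) :
    lpNorm (fNN σ (γ.map Prod.fst) - fNN σ (γ.map Prod.snd)) 2 (stdGaussian _)
      ≤ K * (1 + R) * ∫ z, ‖z.1 - z.2‖ ∂γ := by
  have h₁ : Integrable Prod.fst (γ.map Prod.fst) :=
    (integrable_map_measure (by fun_prop) (by fun_prop)).2 (.of_bound (by fun_prop) R hR₁)
  have h₂ : Integrable Prod.fst (γ.map Prod.snd) :=
    (integrable_map_measure (by fun_prop) (by fun_prop)).2 (.of_bound (by fun_prop) R hR₂)
  set g := fNN σ (γ.map Prod.fst) - fNN σ (γ.map Prod.snd)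
  have hg : MemLp g 2 (stdGaussian _) := (memLp_fNN hσ h₁).sub (memLp_fNN hσ h₂)
  set N := lpNorm g 2 (stdGaussian _)
  have hN : N * N ≤ K * (1 + R) * (∫ z, ‖z.1 - z.2‖ ∂γ) * N := by
    calc N * N
        = ∫ z, (z.1.1 * ridge σ g z.1.2 - z.2.1 * ridge σ g z.2.2) ∂γ := by
          rw [← integral_mul_fNN_sub_fNN hσ h₁ h₂ hg, ← sq, lpNorm_two_sq hg.1]
          simp only [g, Pi.sub_apply, sq]
      _ ≤ ∫ z, K * (1 + R) * N * ‖z.1 - z.2‖ ∂γ :=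
          (Real.le_norm_self _).trans (norm_integral_le_of_norm_le (hγ.const_mul _)
            (hR₂.mono fun z hz => abs_mul_ridge_sub_mul_ridge_le hσ hg hz))
      _ = K * (1 + R) * (∫ z, ‖z.1 - z.2‖ ∂γ) * N := by
          rw [integral_const_mul, mul_right_comm]
  rcases (lpNorm_nonneg : 0 ≤ N).eq_or_lt' with hN₀ | hN₀
  · obtain ⟨z, hz⟩ := hR₂.exists
    have hR : 0 ≤ R := (abs_nonneg _).trans hz
    have hK := hσ.nonneg
    exact hN₀.trans_le (by positivity)
  · exact le_of_mul_le_mul_right hN hN₀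

end Network

section Stability

variable {d : ℕ} {σ : ℝ → ℝ} {K : ℝ} {fstar : EuclideanSpace ℝ (Fin d) → ℝ} {ξ : ℝ → ℝ × ℝ}
  {ρ ρ' : ℝ → ProbabilityMeasure (Param d)} {C Q R T : ℝ}

theorem _root_.IsMeanFieldFlow.eq_map_flow (hσ : IsActivation σ K)
    (hf : MemLp fstar 2 (stdGaussian _)) (hξ : ContinuousOn ξ (Ici 0))
    (hC : ∀ t, 0 ≤ t → ‖ξ t‖ ≤ C)
    (hρ : IsMeanFieldFlow σ fstar (fun t => (ξ t).1) (fun t => (ξ t).2) ρ)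
    (hR : ∀ t ∈ Icc 0 T, ∀ᵐ θ ∂(ρ t : Measure (Param d)), |θ.1| ≤ R) (hR₀ : 0 ≤ R) (hT : 0 < T)
    {t : ℝ} (ht : t ∈ Icc 0 T) :
    (ρ t : Measure (Param d))
      = (ρ 0 : Measure (Param d)).map fun θ => flow (clippedVelocity σ fstar ξ ρ T hR₀) 0 θ t := by
  have hv := isRegularField_clippedVelocity hσ hf hρ.continuousOn hR hT.le le_rfl hξ hC hR₀
  have hbound : ∀ᵐ p ∂spaceTime (timeKernel hρ.continuousOn T) T, |p.2.1| ≤ R := by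
    refine Measure.ae_compProd_of_ae_ae (measurableSet_le (by fun_prop) (by fun_prop)) ?_
    refine (ae_restrict_mem measurableSet_Ioc).mono fun s hs => ?_
    rw [timeKernel_apply hρ.continuousOn (Ioc_subset_Icc_self hs)]
    exact hR s (Ioc_subset_Icc_self hs)
  have hclip : Function.uncurry (flowVelocity σ fstar ξ ρ T)
      =ᵐ[spaceTime (timeKernel hρ.continuousOn T) T]
        Function.uncurry (clippedVelocity σ fstar ξ ρ T hR₀) :=
    hbound.mono fun p hp =>
      congrArg (flowVelocity σ fstar ξ ρ T p.1) (clip_eq_self hR₀ hp).symm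
  have h := ((hρ.isTransport hσ hf hξ hC hT).congr hclip).eq_map_flow hv ht
  rwa [timeKernel_apply _ ht, timeKernel_apply _ (left_mem_Icc.2 hT.le)] at h

theorem norm_clippedVelocity_sub_clippedVelocity_le (hσ : IsActivation σ K)
    (hf : MemLp fstar 2 (stdGaussian _)) (hC : ∀ t, 0 ≤ t → ‖ξ t‖ ≤ C) {t : ℝ} (ht : t ∈ Icc 0 T)
    (hρ : Integrable Prod.fst (ρ t : Measure (Param d)))
    (hρ' : Integrable Prod.fst (ρ' t : Measure (Param d))) (hR₀ : 0 ≤ R) (θ : Param d) :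
    ‖clippedVelocity σ fstar ξ ρ T hR₀ t θ - clippedVelocity σ fstar ξ ρ' T hR₀ t θ‖
      ≤ C * (K * lpNorm (fNN σ (ρ t : Measure (Param d)) - fNN σ (ρ' t : Measure (Param d))) 2
        (stdGaussian _)) * (1 + R) := by
  have hm := memLp_fNN hσ hρ
  have hm' := memLp_fNN hσ hρ'
  have hK := hσ.nonneg
  have hC₀ : 0 ≤ C := (norm_nonneg _).trans (hC t ht.1)
  rw [clippedVelocity, clippedVelocity, flowVelocity, flowVelocity, clampTime_of_mem ht,
    velocity_sub_residual hσ _ (hm.sub hf) (hm'.sub hf), sub_sub_sub_cancel_right]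
  refine (norm_velocity_le hσ _ (hm.sub hm') _).trans ?_
  have hKN := mul_nonneg hK (lpNorm_nonneg (f := fNN σ (ρ t : Measure (Param d)) -
    fNN σ (ρ' t : Measure (Param d))) (p := 2) (μ := stdGaussian _))
  gcongr
  · exact hC t ht.1
  · exact abs_clip_fst_le hR₀ θ

theorem lpNorm_fNN_map_sub_fNN_map_le {γ : Measure (Param d × Param d)} [IsProbabilityMeasure γ]
    {X Y : Param d → Param d} (hσ : IsActivation σ K) (hX : Measurable X) (hY : Measurable Y)
    (hRX : ∀ᵐ θ ∂(γ.map Prod.fst).map X, |θ.1| ≤ R)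
    (hRY : ∀ᵐ θ ∂(γ.map Prod.snd).map Y, |θ.1| ≤ R)
    (hγ : Integrable (fun z => ‖X z.1 - Y z.2‖) γ) :
    lpNorm (fNN σ ((γ.map Prod.fst).map X) - fNN σ ((γ.map Prod.snd).map Y)) 2 (stdGaussian _)
      ≤ K * (1 + R) * ∫ z, ‖X z.1 - Y z.2‖ ∂γ := by
  have hXY := hX.prodMap hY
  have hprob := Measure.isProbabilityMeasure_map (μ := γ) hXY.aemeasurable
  have hnorm : AEStronglyMeasurable (fun z : Param d × Param d => ‖z.1 - z.2‖)
      (γ.map (Prod.map X Y)) := Continuous.aestronglyMeasurable (by fun_prop)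
  have hfst : (γ.map Prod.fst).map X = (γ.map (Prod.map X Y)).map Prod.fst := by
    rw [Measure.map_map hX measurable_fst, Measure.map_map measurable_fst hXY]
    rfl
  have hsnd : (γ.map Prod.snd).map Y = (γ.map (Prod.map X Y)).map Prod.snd := by
    rw [Measure.map_map hY measurable_snd, Measure.map_map measurable_snd hXY]
    rfl
  rw [hfst] at hRX ⊢
  rw [hsnd] at hRY ⊢
  have h := lpNorm_fNN_sub_fNN_le hσ (ae_of_ae_map measurable_fst.aemeasurable hRX)
    (ae_of_ae_map measurable_snd.aemeasurable hRY)
    ((integrable_map_measure hnorm hXY.aemeasurable).2 hγ)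
  rwa [integral_map hXY.aemeasurable hnorm] at h

theorem lpNorm_fNN_sub_fNN_le_integral_norm_flow_sub_flow (hσ : IsActivation σ K)
    (hf : MemLp fstar 2 (stdGaussian _)) (hQ : lpNorm fstar 2 (stdGaussian _) ≤ Q)
    (hξ : ContinuousOn ξ (Ici 0)) (hC : ∀ t, 0 ≤ t → ‖ξ t‖ ≤ C)
    (hρ : IsMeanFieldFlow σ fstar (fun t => (ξ t).1) (fun t => (ξ t).2) ρ)
    (hρ' : IsMeanFieldFlow σ fstar (fun t => (ξ t).1) (fun t => (ξ t).2) ρ')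
    (hR : ∀ t ∈ Icc 0 T, ∀ᵐ θ ∂(ρ t : Measure (Param d)), |θ.1| ≤ R)
    (hR' : ∀ t ∈ Icc 0 T, ∀ᵐ θ ∂(ρ' t : Measure (Param d)), |θ.1| ≤ R) (hR₀ : 0 ≤ R) (hT : 0 < T)
    {γ : Measure (Param d × Param d)} [IsProbabilityMeasure γ]
    (hγ : γ ∈ couplings (ρ 0 : Measure (Param d)) (ρ' 0 : Measure (Param d)))
    (hint : Integrable (fun z => ‖z.1 - z.2‖) γ) {t : ℝ} (ht : t ∈ Icc 0 T) :
    lpNorm (fNN σ (ρ t : Measure (Param d)) - fNN σ (ρ' t : Measure (Param d))) 2 (stdGaussian _)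
      ≤ K * (1 + R) * ∫ z, ‖flow (clippedVelocity σ fstar ξ ρ T hR₀) 0 z.1 t
        - flow (clippedVelocity σ fstar ξ ρ' T hR₀) 0 z.2 t‖ ∂γ := by
  have hv := isRegularField_clippedVelocity hσ hf hρ.continuousOn hR hT.le hQ hξ hC hR₀
  have hv' := isRegularField_clippedVelocity hσ hf hρ'.continuousOn hR' hT.le hQ hξ hC hR₀
  have hRt := hR t ht
  have hRt' := hR' t ht
  rw [hρ.eq_map_flow hσ hf hξ hC hR hR₀ hT ht, ← hγ.1] at hRt ⊢
  rw [hρ'.eq_map_flow hσ hf hξ hC hR' hR₀ hT ht, ← hγ.2] at hRt' ⊢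
  exact lpNorm_fNN_map_sub_fNN_map_le hσ (hv.lipschitzWith_flow 0 t).continuous.measurable
    (hv'.lipschitzWith_flow 0 t).continuous.measurable hRt hRt'
    (integrable_norm_flow_sub_flow hv hv' hint t)

/-- The Lipschitz constant up to time `T` of the trained network in `L²`, with respect to the first
moment of the cost of a coupling of the initial laws. -/
def stabilityConstant (C K Q R T : ℝ) : ℝ :=
  K * (1 + R) * Real.exp ((velocityLipschitzConstant C K Q R + C * (K * (K * (1 + R))) * (1 + R)
    * Real.exp (velocityLipschitzConstant C K Q R * T)) * T)

theorem lpNorm_fNN_sub_fNN_le_stabilityConstant (hσ : IsActivation σ K)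
    (hf : MemLp fstar 2 (stdGaussian _)) (hQ : lpNorm fstar 2 (stdGaussian _) ≤ Q)
    (hξ : ContinuousOn ξ (Ici 0)) (hC : ∀ t, 0 ≤ t → ‖ξ t‖ ≤ C)
    (hρ : IsMeanFieldFlow σ fstar (fun t => (ξ t).1) (fun t => (ξ t).2) ρ)
    (hρ' : IsMeanFieldFlow σ fstar (fun t => (ξ t).1) (fun t => (ξ t).2) ρ')
    (hR : ∀ t ∈ Icc 0 T, ∀ᵐ θ ∂(ρ t : Measure (Param d)), |θ.1| ≤ R)
    (hR' : ∀ t ∈ Icc 0 T, ∀ᵐ θ ∂(ρ' t : Measure (Param d)), |θ.1| ≤ R) (hT : 0 < T)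
    {γ : Measure (Param d × Param d)} [IsProbabilityMeasure γ]
    (hγ : γ ∈ couplings (ρ 0 : Measure (Param d)) (ρ' 0 : Measure (Param d)))
    (hint : Integrable (fun z => ‖z.1 - z.2‖) γ) {t : ℝ} (ht : t ∈ Icc 0 T) :
    lpNorm (fNN σ (ρ t : Measure (Param d)) - fNN σ (ρ' t : Measure (Param d))) 2 (stdGaussian _)
      ≤ stabilityConstant C K Q R T * ∫ z, ‖z.1 - z.2‖ ∂γ := by
  have hR₀ : 0 ≤ R := by
    obtain ⟨θ, hθ⟩ := (hR t ht).exists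
    exact (abs_nonneg _).trans hθ
  have hK := hσ.nonneg
  have hC₀ : 0 ≤ C := (norm_nonneg _).trans (hC 0 le_rfl)
  have hQ₀ : 0 ≤ Q := lpNorm_nonneg.trans hQ
  have hm := sqrtFourthMoment_nonneg
  have hv := isRegularField_clippedVelocity hσ hf hρ.continuousOn hR hT.le hQ hξ hC hR₀
  have hv' := isRegularField_clippedVelocity hσ hf hρ'.continuousOn hR' hT.le hQ hξ hC hR₀
  have hnetwork {s : ℝ} (hs : s ∈ Icc 0 T) :=
    lpNorm_fNN_sub_fNN_le_integral_norm_flow_sub_flow hσ hf hQ hξ hC hρ hρ' hR hR' hR₀ hT hγ hint hs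
  have hflow := integral_norm_flow_sub_flow_le (B := C * (K * (K * (1 + R))) * (1 + R)) hv hv' hint
    (by positivity) (fun s hs θ => ?_) ht
  · rw [Real.coe_toNNReal _ (by rw [velocityLipschitzConstant]; positivity)] at hflow
    refine (hnetwork ht).trans ?_
    rw [stabilityConstant, mul_assoc (K * (1 + R)), mul_comm (Real.exp _)]
    exact mul_le_mul_of_nonneg_left hflow (by positivity)
  · refine (norm_clippedVelocity_sub_clippedVelocity_le hσ hf hC hs (hρ.integrable_fst hs.1)
      (hρ'.integrable_fst hs.1) hR₀ θ).trans ?_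
    refine (mul_le_mul_of_nonneg_right (mul_le_mul_of_nonneg_left (mul_le_mul_of_nonneg_left
      (hnetwork hs) hK) hC₀) (by positivity)).trans_eq (by ring)

end Stability

section Cost

variable {d : ℕ} {γ : Measure (Param d × Param d)}

/-- The cost of a coupling `γ` in the definition of the 2-Wasserstein distance. -/
def quadraticCost (γ : Measure (Param d × Param d)) : ℝ≥0∞ :=
  ∫⁻ z, ENNReal.ofReal (|z.1.1 - z.2.1| ^ 2 + ‖z.1.2 - z.2.2‖ ^ 2) ∂γ

theorem W2_sq (μ ν : Measure (Param d)) : W2 μ ν ^ 2 = ⨅ γ ∈ couplings μ ν, quadraticCost γ := by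
  simp only [W2, quadraticCost, ← ENNReal.rpow_natCast, ← ENNReal.rpow_mul]
  norm_num

theorem isProbabilityMeasure_of_mem_couplings {μ ν : Measure (Param d)} [IsProbabilityMeasure μ]
    (hγ : γ ∈ couplings μ ν) : IsProbabilityMeasure γ :=
  have : IsProbabilityMeasure (γ.map Prod.fst) := hγ.1 ▸ inferInstance
  Measure.isProbabilityMeasure_of_map Prod.fst

theorem sq_norm_sub_le (θ θ' : Param d) :
    ‖θ - θ'‖ ^ 2 ≤ |θ.1 - θ'.1| ^ 2 + ‖θ.2 - θ'.2‖ ^ 2 := by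
  rcases Prod.norm_def (θ - θ') ▸ max_choice ‖(θ - θ').1‖ ‖(θ - θ').2‖ with h | h
  · rw [h]
    exact le_add_of_nonneg_right (sq_nonneg _)
  · rw [h]
    exact le_add_of_nonneg_left (sq_nonneg _)

theorem lintegral_sq_norm_sub_le_quadraticCost (γ : Measure (Param d × Param d)) :
    ∫⁻ z, ENNReal.ofReal (‖z.1 - z.2‖ ^ 2) ∂γ ≤ quadraticCost γ :=
  lintegral_mono fun z => ENNReal.ofReal_le_ofReal (sq_norm_sub_le z.1 z.2)

theorem memLp_norm_sub_of_quadraticCost_ne_top (h : quadraticCost γ ≠ ⊤) :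
    MemLp (fun z => ‖z.1 - z.2‖) 2 γ := by
  have hm : AEStronglyMeasurable (fun z : Param d × Param d => ‖z.1 - z.2‖) γ :=
    Continuous.aestronglyMeasurable (by fun_prop)
  refine (memLp_two_iff_integrable_sq hm).2 ⟨hm.pow 2, ?_⟩
  rw [hasFiniteIntegral_iff_ofReal (.of_forall fun _ => sq_nonneg _)]
  exact (lintegral_sq_norm_sub_le_quadraticCost γ).trans_lt h.lt_top

theorem ofReal_sq_integral_norm_sub_le_quadraticCost [IsProbabilityMeasure γ]
    (h : quadraticCost γ ≠ ⊤) :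
    ENNReal.ofReal ((∫ z, ‖z.1 - z.2‖ ∂γ) ^ 2) ≤ quadraticCost γ := by
  have hm := memLp_norm_sub_of_quadraticCost_ne_top h
  refine le_trans ?_ (lintegral_sq_norm_sub_le_quadraticCost γ)
  rw [← ofReal_integral_eq_lintegral_ofReal hm.integrable_sq (.of_forall fun _ => sq_nonneg _)]
  exact ENNReal.ofReal_le_ofReal ((convexOn_pow 2).map_integral_le (continuousOn_pow 2) isClosed_Ici
    (.of_forall fun _ => norm_nonneg _) (hm.integrable one_le_two) hm.integrable_sq)

end Cost

section Target

variable {d p : ℕ}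

theorem memLp_eval_stdGaussian (h : MvPolynomial (Fin p) ℝ) {q : ℝ≥0∞} (hq : q ≠ ⊤) :
    MemLp (fun y : EuclideanSpace ℝ (Fin p) => h.eval y) q (stdGaussian _) := by
  induction h using MvPolynomial.induction_on generalizing q with
  | C a => simpa using memLp_const a
  | add f g hf hg =>
    simp only [map_add]
    exact (hf hq).add (hg hq)
  | mul_X f i hf =>
    have hq₂ : q * 2 ≠ ⊤ := ENNReal.mul_ne_top hq (by simp)
    have hX : MemLp (fun y : EuclideanSpace ℝ (Fin p) => y i) (q * 2) (stdGaussian _) :=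
      IsGaussian.memLp_dual _ (EuclideanSpace.proj i) _ hq₂
    have : ENNReal.HolderTriple (q * 2) (q * 2) q := ⟨by
      rcases eq_or_ne q 0 with rfl | _
      · simp
      · rw [ENNReal.mul_inv (by simp) (by simp), ← mul_add, ENNReal.inv_two_add_inv_two, mul_one]⟩
    simpa using hX.mul' (hf hq₂)

theorem measurePreserving_repr_orthogonalProjectionOnto
    (V : Submodule ℝ (EuclideanSpace ℝ (Fin d))) (b : OrthonormalBasis (Fin p) ℝ V) :
    MeasurePreserving (fun x => b.repr (V.orthogonalProjectionOnto x)) (stdGaussian _)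
      (stdGaussian _) := by
  have hm : Continuous fun x => b.repr (V.orthogonalProjectionOnto x) := by fun_prop
  have hadj (x : EuclideanSpace ℝ (Fin d)) (t : EuclideanSpace ℝ (Fin p)) :
      inner ℝ (b.repr (V.orthogonalProjectionOnto x)) t
        = inner ℝ x (b.repr.symm t : EuclideanSpace ℝ (Fin d)) := by
    rw [← b.repr.symm.inner_map_map, LinearIsometryEquiv.symm_apply_apply,
      ← Submodule.inner_orthogonalProjectionOnto_eq_of_mem_right]
  have := Measure.isProbabilityMeasure_map (μ := stdGaussian (EuclideanSpace ℝ (Fin d)))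
    hm.aemeasurable
  refine ⟨hm.measurable, Measure.ext_of_charFun (funext fun t => ?_)⟩
  rw [charFun_apply, integral_map hm.aemeasurable (by fun_prop)]
  simp only [hadj]
  rw [← charFun_apply, charFun_stdGaussian, charFun_stdGaussian, Submodule.norm_coe,
    LinearIsometryEquiv.norm_map]

theorem memLp_target (h : MvPolynomial (Fin p) ℝ) (V : Submodule ℝ (EuclideanSpace ℝ (Fin d)))
    (b : OrthonormalBasis (Fin p) ℝ V) : MemLp (target h V b) 2 (stdGaussian _) :=
  (memLp_eval_stdGaussian h ENNReal.ofNat_ne_top).comp_measurePreserving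
    (measurePreserving_repr_orthogonalProjectionOnto V b)

theorem lpNorm_target (h : MvPolynomial (Fin p) ℝ) (V : Submodule ℝ (EuclideanSpace ℝ (Fin d)))
    (b : OrthonormalBasis (Fin p) ℝ V) :
    lpNorm (target h V b) 2 (stdGaussian _)
      = lpNorm (fun y : EuclideanSpace ℝ (Fin p) => h.eval y) 2 (stdGaussian _) := by
  have hm := (memLp_eval_stdGaussian h (q := 2) ENNReal.ofNat_ne_top).1
  rw [← toReal_eLpNorm (memLp_target h V b).1, ← toReal_eLpNorm hm]
  exact congrArg _ (eLpNorm_comp_measurePreserving hm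
    (measurePreserving_repr_orthogonalProjectionOnto V b))

theorem _root_.IsInitialization.ae_abs_fst_le {ρ₀ : ProbabilityMeasure (Param d)} {K : ℝ}
    (h : IsInitialization ρ₀ K) : ∀ᵐ θ ∂(ρ₀ : Measure (Param d)), |θ.1| ≤ K := by
  obtain ⟨ρa, ρw, _, _, hprod, -, hsupp⟩ := h
  rw [hprod]
  have ha : ∀ᵐ a ∂ρa, a ∈ Icc (-K) K := hsupp
  exact Measure.quasiMeasurePreserving_fst.ae (ha.mono fun a => abs_le.2)

end Target

section Stability

variable {d : ℕ} {σ : ℝ → ℝ} {K : ℝ} {fstar : EuclideanSpace ℝ (Fin d) → ℝ} {ξ : ℝ → ℝ × ℝ}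
  {ρ ρ' : ℝ → ProbabilityMeasure (Param d)} {C Q R T : ℝ}

theorem lintegral_sq_fNN_sub_fNN_eq {μ ν : Measure (Param d)} [SFinite μ] [SFinite ν]
    (hσ : IsActivation σ K)
    (hμ : Integrable Prod.fst μ) (hν : Integrable Prod.fst ν) :
    ∫⁻ x, ENNReal.ofReal (|fNN σ μ x - fNN σ ν x| ^ 2) ∂stdGaussian _
      = ENNReal.ofReal (lpNorm (fNN σ μ - fNN σ ν) 2 (stdGaussian _) ^ 2) := by
  have hm := (memLp_fNN hσ hμ).sub (memLp_fNN hσ hν)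
  rw [lpNorm_two_sq hm.1, ofReal_integral_eq_lintegral_ofReal hm.integrable_sq
    (.of_forall fun _ => sq_nonneg _)]
  simp only [sq_abs, Pi.sub_apply]

theorem lintegral_sq_fNN_sub_fNN_le_quadraticCost (hσ : IsActivation σ K)
    (hf : MemLp fstar 2 (stdGaussian _)) (hQ : lpNorm fstar 2 (stdGaussian _) ≤ Q)
    (hξ : ContinuousOn ξ (Ici 0)) (hC : ∀ t, 0 ≤ t → ‖ξ t‖ ≤ C)
    (hρ : IsMeanFieldFlow σ fstar (fun t => (ξ t).1) (fun t => (ξ t).2) ρ)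
    (hρ' : IsMeanFieldFlow σ fstar (fun t => (ξ t).1) (fun t => (ξ t).2) ρ')
    (hR : ∀ᵐ θ ∂(ρ 0 : Measure (Param d)), |θ.1| ≤ R)
    (hR' : ∀ᵐ θ ∂(ρ' 0 : Measure (Param d)), |θ.1| ≤ R) (hT : 0 < T)
    {γ : Measure (Param d × Param d)}
    (hγ : γ ∈ couplings (ρ 0 : Measure (Param d)) (ρ' 0 : Measure (Param d)))
    (hcost : quadraticCost γ ≠ ⊤) {t : ℝ} (ht : t ∈ Icc 0 T) :
    ∫⁻ x, ENNReal.ofReal (|fNN σ (ρ t : Measure (Param d)) x - fNN σ (ρ' t) x| ^ 2)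
        ∂stdGaussian _
      ≤ ENNReal.ofReal (stabilityConstant C K Q (outputWeightBound C K Q R T) T ^ 2)
        * quadraticCost γ := by
  have := isProbabilityMeasure_of_mem_couplings hγ
  have hstab := lpNorm_fNN_sub_fNN_le_stabilityConstant hσ hf hQ hξ hC hρ hρ'
    (fun _ => hρ.ae_abs_fst_le hσ hf hQ hξ hC hT hR)
    (fun _ => hρ'.ae_abs_fst_le hσ hf hQ hξ hC hT hR') hT hγ
    ((memLp_norm_sub_of_quadraticCost_ne_top hcost).integrable one_le_two) ht
  rw [lintegral_sq_fNN_sub_fNN_eq hσ (hρ.integrable_fst ht.1) (hρ'.integrable_fst ht.1)]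
  refine (ENNReal.ofReal_le_ofReal (pow_le_pow_left₀ lpNorm_nonneg hstab 2)).trans ?_
  rw [mul_pow, ENNReal.ofReal_mul (sq_nonneg _)]
  gcongr
  exact ofReal_sq_integral_norm_sub_le_quadraticCost hcost

end Stability

end MeanFieldStability

end

open MeanFieldStability

theorem theorem3p5_general (Kσ Kξ Kρ Q T : ℝ) (hT : 0 < T) :
    ∃ Cs : ℝ, 0 < Cs ∧
      ∀ (d : ℕ) (fstar : EuclideanSpace ℝ (Fin d) → ℝ) (σ ξa ξw : ℝ → ℝ)
        (ρ ρ' : ℝ → ProbabilityMeasure (Param d)),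
        MemLp fstar 2 (stdGaussian _) → lpNorm fstar 2 (stdGaussian _) ≤ Q → IsActivation σ Kσ →
        ContinuousOn ξa (Ici 0) → ContinuousOn ξw (Ici 0) →
        (∀ t, 0 ≤ t → |ξa t| ≤ Kξ) → (∀ t, 0 ≤ t → |ξw t| ≤ Kξ) →
        (∀ᵐ θ ∂(ρ 0 : Measure (Param d)), |θ.1| ≤ Kρ) →
        (∀ᵐ θ ∂(ρ' 0 : Measure (Param d)), |θ.1| ≤ Kρ) →
        IsMeanFieldFlow σ fstar ξa ξw ρ → IsMeanFieldFlow σ fstar ξa ξw ρ' →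
        (⨆ t ∈ Icc (0 : ℝ) T, ∫⁻ x, ENNReal.ofReal (|fNN σ (ρ t) x - fNN σ (ρ' t) x| ^ 2)
            ∂(stdGaussian (EuclideanSpace ℝ (Fin d))))
          ≤ ENNReal.ofReal Cs * W2 (ρ 0 : Measure (Param d)) (ρ' 0) ^ 2 := by
  set S := stabilityConstant Kξ Kσ Q (outputWeightBound Kξ Kσ Q Kρ T) T
  have hCs : 0 < S ^ 2 + 1 := by positivity
  refine ⟨S ^ 2 + 1, hCs, fun d fstar σ ξa ξw ρ ρ' hf hQ hσ hξa hξw ha hw hρ₀ hρ₀' hρ hρ' =>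
    iSup₂_le fun t ht => ?_⟩
  have hCs₀ : ENNReal.ofReal (S ^ 2 + 1) ≠ 0 := (ENNReal.ofReal_pos.2 hCs).ne'
  simp only [W2_sq, ENNReal.mul_iInf_of_ne hCs₀ ENNReal.ofReal_ne_top]
  refine le_iInf₂ fun γ hγ => ?_
  rcases eq_or_ne (quadraticCost γ) ⊤ with hcost | hcost
  · simp [hcost, ENNReal.mul_top hCs₀]
  refine (lintegral_sq_fNN_sub_fNN_le_quadraticCost (ξ := fun t => (ξa t, ξw t)) hσ hf hQ
    (hξa.prodMk hξw) (fun s hs => max_le (ha s hs) (hw s hs)) hρ hρ' hρ₀ hρ₀' hT hγ hcost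
    ht).trans ?_
  gcongr
  exact le_add_of_nonneg_right zero_le_one

theorem theorem3p5 (p : ℕ) (h : MvPolynomial (Fin p) ℝ) (Kσ Kξ Kρ T : ℝ)
    (hKσ : 0 < Kσ) (hKξ : 0 < Kξ) (hKρ : 0 < Kρ) (hT : 0 < T) :
    ∃ Cs : ℝ, 0 < Cs ∧
      ∀ (d : ℕ) (V : Submodule ℝ (EuclideanSpace ℝ (Fin d))) (b : OrthonormalBasis (Fin p) ℝ V)
        (σ ξa ξw : ℝ → ℝ) (ρ ρ' : ℝ → ProbabilityMeasure (Param d)),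
        IsActivation σ Kσ → IsLearningRate ξa Kξ → IsLearningRate ξw Kξ →
        IsInitialization (ρ 0) Kρ → IsInitialization (ρ' 0) Kρ →
        IsMeanFieldFlow σ (target h V b) ξa ξw ρ →
        IsMeanFieldFlow σ (target h V b) ξa ξw ρ' →
        (⨆ t ∈ Icc (0 : ℝ) T, ∫⁻ x, ENNReal.ofReal (|fNN σ (ρ t) x - fNN σ (ρ' t) x| ^ 2)
            ∂(stdGaussian (EuclideanSpace ℝ (Fin d))))
          ≤ ENNReal.ofReal Cs * W2 (ρ 0 : Measure (Param d)) (ρ' 0) ^ 2 := by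
  obtain ⟨Cs, hCs, hstab⟩ := theorem3p5_general Kσ Kξ Kρ
    (lpNorm (fun y : EuclideanSpace ℝ (Fin p) => h.eval y) 2 (stdGaussian _)) T hT
  exact ⟨Cs, hCs, fun d V b σ ξa ξw ρ ρ' hσ hξa hξw hρ₀ hρ₀' =>
    hstab d _ σ ξa ξw ρ ρ' (memLp_target h V b) (lpNorm_target h V b).le hσ
      hξa.lipschitz.choose_spec.continuousOn hξw.lipschitz.choose_spec.continuousOn
      hξa.bound hξw.bound hρ₀.ae_abs_fst_le hρ₀'.ae_abs_fst_le⟩
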